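/- A tournament $T$ on a finite set $V(T)$ of $n$ alternatives has exactly one directed edge between any two distinct alternatives; $E(T)$ is its edge set, and each edge $e$ has a weight $w(e)>0$. The Copeland set $\mathit{CO}(T)$ consists of the alternatives of largest outdegree. For $R\subseteq E(T)$ let $T^R$ be the tournament obtained by reversing the edges in $R$, and let $w(R)=\sum_{e\in R}w(e)$. A constructive reversal set (CRS) for $x\notin \mathit{CO}(T)$ is a set $R\subseteq E(T)$ with $x\in \mathit{CO}(T^R)$, and the margin of victory of $x$ is $\mathsf{MoV}_{\mathit{CO}}(x,T)=-\min\{w(R): R\text{ is a CRS for }x\text{ in }T\}$. **Theorem.** (1) Given a tournament $T$, positive edge weights $w$ and an alternative $x\notin \mathit{CO}(T)$, the value $\mathsf{MoV}_{\mathit{CO}}(x,T)$, together with a CRS of minimum weight, can be computed in polynomial time. Precisely, there are one program for a random access machine, which operates on weights only by copying, addition, subtraction and comparison, and one polynomial $p$ such that the program solves the problem - for all positive real weights, within time $p(n)$, if each operation on weights has unit cost and operations on natural numbers have logarithmic cost; - for all positive rational weights, within time $p(L)$, if all operations have logarithmic cost (bit cost), where $L$ is $n$ plus the total number of bits of the weights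 of the edges. (2) Let $w$ be a positive real weight function and $x\notin \mathit{CO}(T)$. For $c\in\mathbb{N}$ let $G_c$ be the network with node set $\{s,t\}\cup E(T)\cup V(T)$ and the following arcs: an arc of cost $0$ and capacity $1$ from $s$ to each $e\in E(T)$; for each $e=(u,v)\in E(T)$ an arc of cost $0$ and capacity $1$ from $e$ to $u$ and an arc of cost $w(e)$ and capacity $1$ from $e$ to $v$; an arc of cost $0$ and capacity $c$ from each $v\in V(T)\setminus\{x\}$ to $t$. The balances (inflow minus outflow) are $b_s=-n(n-1)/2$, $b_x=c$, $b_t=n(n-1)/2-c$, and $b_v=0$ for all other nodes; a $b$-flow is a nonnegative flow that respects the capacities and the balances. Then, for each $c$, the set of costs of the integral $b$-flows in $G_c$ equals the set of weights of the CRSs $R$ for $x$ in $T$ for which $x$ has outdegree $c$ in $T^R$. Moreover, $-\mathsf{MoV}_{\mathit{CO}}(x,T)$ is the minimum cost of an integral $b$-flow in one of the networks $G_c$ with $c\in\{\lceil (n-1)/2\rceil,\dots,n\}$. -/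

import Mathlib

namespace CopelandMoV

/-! ## Tournaments, the Copeland set and the margin of victory -/

section Tournaments

/-- A tournament on the vertex set `V`: a set of directed edges such that there is exactly one edge
between any two distinct vertices (and no loop). -/
structure Tournament (V : Type*) where
  edges : Finset (V × V)
  no_loop : ∀ x : V, (x, x) ∉ edges
  one_edge : ∀ x y : V, x ≠ y → ((x, y) ∈ edges ↔ (y, x) ∉ edges)

variable {V : Type*} [DecidableEq V]

namespace Tournament

/-- Membership in the edge set after the edges of `R` have been reversed. -/
theorem mem_reverse_iff (T : Tournament V) {R : Finset (V × V)} (x y : V) :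
    (x, y) ∈ (T.edges \ R) ∪ R.image Prod.swap ↔
      ((x, y) ∈ T.edges ∧ (x, y) ∉ R) ∨ (y, x) ∈ R := by
  simp only [Finset.mem_union, Finset.mem_sdiff, Finset.mem_image, Prod.exists, Prod.swap_prod_mk,
    Prod.mk.injEq]
  constructor
  · rintro (h | ⟨a, b, h, rfl, rfl⟩)
    · exact Or.inl h
    · exact Or.inr h
  · rintro (h | h)
    · exact Or.inl h
    · exact Or.inr ⟨y, x, h, rfl, rfl⟩

/-- The tournament `T ^ R` that results from `T` when all edges in `R` are reversed. -/
def reverse (T : Tournament V) (R : Finset (V × V)) (hR : R ⊆ T.edges) : Tournament V where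
  edges := (T.edges \ R) ∪ R.image Prod.swap
  no_loop := by
    intro x hx
    rw [mem_reverse_iff] at hx
    rcases hx with h | h
    · exact T.no_loop x h.1
    · exact T.no_loop x (hR h)
  one_edge := by
    intro x y hxy
    rw [mem_reverse_iff, mem_reverse_iff]
    have h1 := T.one_edge x y hxy
    have h2 := @hR (x, y)
    have h3 := @hR (y, x)
    tauto

variable [Fintype V]

/-- The dominion of `x`: the alternatives that `x` dominates. -/
def dominion (T : Tournament V) (x : V) : Finset V :=
  Finset.univ.filter fun y => (x, y) ∈ T.edges

/-- The outdegree of `x`. -/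
def outdegree (T : Tournament V) (x : V) : ℕ := (T.dominion x).card

/-- The Copeland set: the alternatives with a largest dominion. -/
def copelandSet (T : Tournament V) : Set V :=
  {x | ∀ y : V, T.outdegree y ≤ T.outdegree x}

end Tournament

/-- `R` is a destructive reversal set for `x` in `T` with respect to the tournament solution `S`. -/
def IsDRS (S : Tournament V → Set V) (T : Tournament V) (x : V) (R : Finset (V × V)) : Prop :=
  x ∈ S T ∧ ∃ hR : R ⊆ T.edges, x ∉ S (T.reverse R hR)

/-- `R` is a constructive reversal set for `x` in `T` with respect to the tournament
solution `S`. -/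
def IsCRS (S : Tournament V → Set V) (T : Tournament V) (x : V) (R : Finset (V × V)) : Prop :=
  x ∉ S T ∧ ∃ hR : R ⊆ T.edges, x ∈ S (T.reverse R hR)

variable {K : Type*} [AddCommGroup K] [LinearOrder K]

/-- The cost of a set of edges. -/
def weight (w : V × V → K) (R : Finset (V × V)) : K := ∑ e ∈ R, w e

/-- `m` is the margin of victory of `x` in `T` with respect to the tournament solution `S`. -/
def IsMoV (S : Tournament V → Set V) (T : Tournament V) (w : V × V → K) (x : V) (m : K) : Prop :=
  (x ∈ S T → IsLeast {k | ∃ R, IsDRS S T x R ∧ weight w R = k} m) ∧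
    (x ∉ S T → IsLeast {k | ∃ R, IsCRS S T x R ∧ weight w R = k} (-m))

end Tournaments

/-! ## A random access machine

Programs are structured programs over a random access memory with two kinds of cells: cells that
hold natural numbers, and cells that hold numbers of an ordered abelian group `K` (weights). Both
kinds are organised in arrays: `nat a i` is the `i`-th cell of the `a`-th array. A program is a
finite object that depends neither on `K` nor on the input. Weights can only be copied, added,
subtracted and compared. -/

section Machine

/-- Expressions with natural number values. -/
inductive NatExpr : Type
  | const (k : ℕ) : NatExpr
  | get (a : ℕ) (i : NatExpr) : NatExpr
  | add (e f : NatExpr) : NatExpr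
  | sub (e f : NatExpr) : NatExpr
  | mul (e f : NatExpr) : NatExpr

/-- Expressions whose values are weights. -/
inductive WtExpr : Type
  | zero : WtExpr
  | get (a : ℕ) (i : NatExpr) : WtExpr
  | add (e f : WtExpr) : WtExpr
  | sub (e f : WtExpr) : WtExpr

/-- Tests. -/
inductive Test : Type
  | natEq (e f : NatExpr) : Test
  | natLt (e f : NatExpr) : Test
  | wtLt (e f : WtExpr) : Test
  | not (b : Test) : Test
  | and (b c : Test) : Test

/-- Programs. -/
inductive Program : Type
  | skip : Program
  | setNat (a : ℕ) (i e : NatExpr) : Program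
  | setWt (a : ℕ) (i : NatExpr) (e : WtExpr) : Program
  | seq (P Q : Program) : Program
  | ite (b : Test) (P Q : Program) : Program
  | loop (b : Test) (P : Program) : Program

/-- The contents of the memory. -/
structure Memory (K : Type*) where
  nat : ℕ → ℕ → ℕ
  wt : ℕ → ℕ → K

variable {K : Type*}

/-- Overwrite the `i`-th cell of the `a`-th array of natural numbers. -/
def Memory.setNat (s : Memory K) (a i v : ℕ) : Memory K where
  nat := Function.update s.nat a (Function.update (s.nat a) i v)
  wt := s.wt

/-- Overwrite the `i`-th cell of the `a`-th array of weights. -/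
def Memory.setWt (s : Memory K) (a i : ℕ) (v : K) : Memory K where
  nat := s.nat
  wt := Function.update s.wt a (Function.update (s.wt a) i v)

/-- The value of an expression (subtraction of natural numbers is truncated at zero). -/
def NatExpr.val (s : Memory K) : NatExpr → ℕ
  | const k => k
  | get a i => s.nat a (i.val s)
  | add e f => e.val s + f.val s
  | sub e f => e.val s - f.val s
  | mul e f => e.val s * f.val s

/-- The cost of evaluating an expression (logarithmic cost): one unit for each operation, plus the
number of bits of each number that occurs, addresses and intermediate results included. -/
def NatExpr.cost (s : Memory K) : NatExpr → ℕ
  | const k => 1 + Nat.size k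
  | get a i => 1 + Nat.size (s.nat a (i.val s)) + i.cost s
  | add e f => 1 + Nat.size (e.val s + f.val s) + e.cost s + f.cost s
  | sub e f => 1 + Nat.size (e.val s - f.val s) + e.cost s + f.cost s
  | mul e f => 1 + Nat.size (e.val s * f.val s) + e.cost s + f.cost s

/-- The value of an expression. -/
def WtExpr.val [AddCommGroup K] (s : Memory K) : WtExpr → K
  | zero => 0
  | get a i => s.wt a (i.val s)
  | add e f => e.val s + f.val s
  | sub e f => e.val s - f.val s

/-- The cost of evaluating an expression, where a weight `v` is charged with `sz v` in addition to
the unit charge for each operation. -/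
def WtExpr.cost [AddCommGroup K] (sz : K → ℕ) (s : Memory K) : WtExpr → ℕ
  | zero => 1 + sz 0
  | get a i => 1 + sz (s.wt a (i.val s)) + i.cost s
  | add e f => 1 + sz (e.val s + f.val s) + e.cost sz s + f.cost sz s
  | sub e f => 1 + sz (e.val s - f.val s) + e.cost sz s + f.cost sz s

variable [AddCommGroup K] [LinearOrder K]

/-- The truth value of a test. -/
def Test.Holds (s : Memory K) : Test → Prop
  | natEq e f => e.val s = f.val s
  | natLt e f => e.val s < f.val s
  | wtLt e f => e.val s < f.val s
  | not b => ¬ b.Holds s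
  | and b c => b.Holds s ∧ c.Holds s

/-- The cost of a test. -/
def Test.cost (sz : K → ℕ) (s : Memory K) : Test → ℕ
  | natEq e f => 1 + e.cost s + f.cost s
  | natLt e f => 1 + e.cost s + f.cost s
  | wtLt e f => 1 + e.cost sz s + f.cost sz s
  | not b => 1 + b.cost sz s
  | and b c => 1 + b.cost sz s + c.cost sz s

/-- `Runs sz P s s' t`: started with memory `s`, the program `P` halts with memory `s'` after a
running time of exactly `t`, where a weight `v` is charged with `1 + sz v` and a natural number
with its number of bits. -/
inductive Runs (sz : K → ℕ) : Program → Memory K → Memory K → ℕ → Prop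
  | skip (s : Memory K) : Runs sz Program.skip s s 1
  | setNat (s : Memory K) (a : ℕ) (i e : NatExpr) :
      Runs sz (Program.setNat a i e) s (s.setNat a (i.val s) (e.val s)) (1 + i.cost s + e.cost s)
  | setWt (s : Memory K) (a : ℕ) (i : NatExpr) (e : WtExpr) :
      Runs sz (Program.setWt a i e) s (s.setWt a (i.val s) (e.val s))
        (1 + i.cost s + e.cost sz s)
  | seq {P Q : Program} {s s' s'' : Memory K} {t t' : ℕ} :
      Runs sz P s s' t → Runs sz Q s' s'' t' → Runs sz (Program.seq P Q) s s'' (t + t')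
  | ite_true {b : Test} {P Q : Program} {s s' : Memory K} {t : ℕ} :
      b.Holds s → Runs sz P s s' t → Runs sz (Program.ite b P Q) s s' (1 + b.cost sz s + t)
  | ite_false {b : Test} {P Q : Program} {s s' : Memory K} {t : ℕ} :
      ¬ b.Holds s → Runs sz Q s s' t → Runs sz (Program.ite b P Q) s s' (1 + b.cost sz s + t)
  | loop_true {b : Test} {P : Program} {s s' s'' : Memory K} {t t' : ℕ} :
      b.Holds s → Runs sz P s s' t → Runs sz (Program.loop b P) s' s'' t' →
        Runs sz (Program.loop b P) s s'' (1 + b.cost sz s + t + t')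
  | loop_false {b : Test} {P : Program} {s : Memory K} :
      ¬ b.Holds s → Runs sz (Program.loop b P) s s (1 + b.cost sz s)

/-- Programs are deterministic: the final memory and the running time are unique. -/
theorem Runs.unique {sz : K → ℕ} {P : Program} {s s₁ : Memory K} {t₁ : ℕ}
    (h : Runs sz P s s₁ t₁) : ∀ {s₂ : Memory K} {t₂ : ℕ}, Runs sz P s s₂ t₂ → s₁ = s₂ ∧ t₁ = t₂ := by
  induction h <;> intro s₂ t₂ h₂ <;> cases h₂ <;> grind

/-- The cells of an array that holds the `n × n` matrix `g`, row by row: the entry in row `i` and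
column `j` is in cell `i * n + j`, and all further cells hold zero. -/
def matrixCells {β : Type*} [Zero β] {n : ℕ} (g : Fin n → Fin n → β) (k : ℕ) : β :=
  if h : k < n * n then
    g ⟨k / n, Nat.div_lt_of_lt_mul h⟩ ⟨k % n, Nat.mod_lt k (Nat.pos_of_lt_mul_left h)⟩
  else 0

/-- The input of the problem: array `0` of natural numbers holds `n` and `x`, array `1` holds the
adjacency matrix of the tournament, and array `0` of weights holds the weights of the edges (and
zero for pairs that are not edges). All other cells hold zero. -/
def inputMemory {n : ℕ} (T : Tournament (Fin n)) (w : Fin n × Fin n → K) (x : Fin n) :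
    Memory K where
  nat a k :=
    if a = 0 then (if k = 0 then n else if k = 1 then (x : ℕ) else 0)
    else if a = 1 then matrixCells (fun i j => if (i, j) ∈ T.edges then 1 else 0) k
    else 0
  wt a k :=
    if a = 0 then matrixCells (fun i j => if (i, j) ∈ T.edges then w (i, j) else 0) k
    else 0

/-- Started on the instance `(T, w, x)`, the program `P` halts within time `B`. It then holds the
margin of victory of the Copeland non-winner `x` in cell `0` of array `1` of weights, and the
characteristic matrix of a minimum constructive reversal set, row by row, in array `2` of natural
numbers. -/
def ComputesMoV (sz : K → ℕ) (P : Program) {n : ℕ} (T : Tournament (Fin n))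
    (w : Fin n × Fin n → K) (x : Fin n) (B : ℕ) : Prop :=
  ∃ (s : Memory K) (t : ℕ), Runs sz P (inputMemory T w x) s t ∧ t ≤ B ∧
    IsMoV Tournament.copelandSet T w x (s.wt 1 0) ∧
    ∃ R : Finset (Fin n × Fin n), IsCRS Tournament.copelandSet T x R ∧
      s.wt 1 0 = -weight w R ∧
      ∀ i j : Fin n, s.nat 2 ((i : ℕ) * n + (j : ℕ)) = if (i, j) ∈ R then 1 else 0

/-- The number of bits of a rational number, given by numerator and denominator. -/
def ratBits (q : ℚ) : ℕ := 1 + Nat.size q.num.natAbs + Nat.size q.den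

end Machine

/-! ## Networks with capacities, costs and balances -/

section Networks

/-- A network on the node set `N` with capacities and costs on the arcs and balances on the
nodes. -/
structure Network (N : Type*) where
  arcs : Set (N × N)
  cap : N × N → ℕ
  cost : N × N → ℝ
  balance : N → ℤ

variable {N : Type*} [Fintype N]

/-- `f` is a `b`-flow: a flow that respects the capacities and for which each node `v` absorbs
exactly its balance. -/
structure Network.IsBFlow (G : Network N) (f : N × N → ℝ) : Prop where
  off_arcs : ∀ a, a ∉ G.arcs → f a = 0
  nonneg : ∀ a, 0 ≤ f a
  le_cap : ∀ a ∈ G.arcs, f a ≤ G.cap a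
  balanced : ∀ v, ∑ u, f (u, v) - ∑ u, f (v, u) = G.balance v

/-- An integral `b`-flow. -/
def Network.IsIntegralBFlow (G : Network N) (f : N × N → ℝ) : Prop :=
  G.IsBFlow f ∧ ∀ a, ∃ z : ℤ, f a = z

/-- The cost of a flow. -/
def Network.flowCost (G : Network N) (f : N × N → ℝ) : ℝ := ∑ a, f a * G.cost a

variable {V : Type*}

/-- The nodes of the network of a tournament: a source, one node for each edge, one node for each
vertex, and a sink. -/
inductive Node (T : Tournament V) : Type _
  | source : Node T
  | edge (e : {e : V × V // e ∈ T.edges}) : Node T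
  | vertex (v : V) : Node T
  | sink : Node T

/-- The node type as a sum type. -/
def Node.equiv (T : Tournament V) :
    Node T ≃ (Unit ⊕ Unit) ⊕ ({e : V × V // e ∈ T.edges} ⊕ V) where
  toFun
    | source => Sum.inl (Sum.inl ())
    | sink => Sum.inl (Sum.inr ())
    | edge e => Sum.inr (Sum.inl e)
    | vertex v => Sum.inr (Sum.inr v)
  invFun
    | Sum.inl (Sum.inl _) => source
    | Sum.inl (Sum.inr _) => sink
    | Sum.inr (Sum.inl e) => edge e
    | Sum.inr (Sum.inr v) => vertex v
  left_inv a := by cases a <;> rfl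
  right_inv a := by rcases a with (a | a) | a | a <;> rfl

variable [Fintype V] [DecidableEq V]

instance (T : Tournament V) : Fintype (Node T) := Fintype.ofEquiv _ (Node.equiv T).symm

/-- The network for the target outdegree `c` of `x`. -/
def copelandNetwork (T : Tournament V) (w : V × V → ℝ) (x : V) (c : ℕ) : Network (Node T) where
  arcs := {a | match a with
    | (Node.source, Node.edge _) => True
    | (Node.edge e, Node.vertex v) => v = e.1.1 ∨ v = e.1.2
    | (Node.vertex v, Node.sink) => v ≠ x
    | _ => False}
  cap a := match a with
    | (Node.vertex _, Node.sink) => c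
    | _ => 1
  cost a := match a with
    | (Node.edge e, Node.vertex v) => if v = e.1.1 then 0 else w e.1
    | _ => 0
  balance a := match a with
    | Node.source => -((Fintype.card V * (Fintype.card V - 1) / 2 : ℕ) : ℤ)
    | Node.edge _ => 0
    | Node.vertex v => if v = x then (c : ℤ) else 0
    | Node.sink => ((Fintype.card V * (Fintype.card V - 1) / 2 : ℕ) : ℤ) - c

end Networks

end CopelandMoV

open CopelandMoV

/-! Reversing edges amounts to choosing, for each pair of alternatives, which of the two owns the
edge; the cost is the weight of the edges that change owner. The alternative `x` wins with outdegree
`c` iff it owns `c` edges and nobody owns more.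

Part (2) reads this as a flow problem. The source saturates every edge node, integrality forces an
edge node to send its unit to a single endpoint (the owner), the arc capacities to the sink cap the
other outdegrees at `c`, and the balance at `x` fixes its outdegree
(`exists_reversal_of_isIntegralBFlow`, `isIntegralBFlow_reversalFlow`). A winner has at least the
average outdegree, which gives the range of `c` (`Tournament.outdegree_bounds`).

For part (1) a penalised problem is solved for `c = n - 1, …, 0`: minimise the reversal cost plus
`M` for each edge that a vertex owns beyond `c`, minus `M` for each edge of `x`, where `M` is twice
the total weight. Since `M` exceeds every reversal cost, whenever some orientation lets `x` win with
outdegree `c`, an optimum of the penalised problem also lets `x` win and costs no more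
(`Potential.optimal_of_feasible`). Optimality is certified by linear programming duality, through
vertex potentials (`Potential.optimal`). At the start `x` owns all its edges and no capacity binds
(`startOrientation_potential`). Capacities are then lowered one vertex at a time. Lowering the
capacity of a saturated vertex leaves it with one edge in excess; the excess is passed on along a
shortest path, found by Dijkstra's algorithm on reduced costs, and the distances are the new
potentials (`DijkstraInv.step`, `AugmentInv.step`, `AugmentInv.finish`). There are `n ^ 2`
lowerings, each of `O(n ^ 2)` steps.

For the running time, `WP` counts steps, and the cost of a step is bounded by a polynomial in the
largest natural number times the size of a weight. Distances are recomputed from the marginal costs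
in every run, so each stored weight is a signed sum of `O(n ^ 2)` input weights, with no growth over
the augmentations. For rational inputs the product of all denominators is a common denominator of
such sums, which bounds their bits (`ratBits_le`). -/

set_option linter.unusedSectionVars false

namespace CopelandMoV

/-! ## Reasoning about programs -/

section ProgramLogic

open Polynomial

/-- A bound on the value of an expression in terms of a bound on the memory cells. -/
noncomputable def NatExpr.valBound : NatExpr → ℕ[X]
  | const k => C k
  | get _ _ => X
  | add e f => e.valBound + f.valBound
  | sub e _ => e.valBound
  | mul e f => e.valBound * f.valBound

/-- A bound on the cost of an expression in terms of a bound on the memory cells. -/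
noncomputable def NatExpr.costBound : NatExpr → ℕ[X]
  | const k => C (1 + k)
  | get _ i => 1 + X + i.costBound
  | add e f => 1 + (e.valBound + f.valBound) + e.costBound + f.costBound
  | sub e f => 1 + e.valBound + e.costBound + f.costBound
  | mul e f => 1 + e.valBound * f.valBound + e.costBound + f.costBound

/-- The number of leaves of an expression. -/
def WtExpr.leaves : WtExpr → ℕ
  | zero => 1
  | get _ _ => 1
  | add e f => e.leaves + f.leaves
  | sub e f => e.leaves + f.leaves

/-- A bound on the cost of an expression, in units of the size of a weight. -/
noncomputable def WtExpr.costBound : WtExpr → ℕ[X]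
  | zero => 2
  | get _ i => 2 + i.costBound
  | add e f => C (e.leaves + f.leaves + 1) + e.costBound + f.costBound
  | sub e f => C (e.leaves + f.leaves + 1) + e.costBound + f.costBound

/-- A bound on the cost of a test. -/
noncomputable def Test.costBound : Test → ℕ[X]
  | natEq e f => 1 + e.costBound + f.costBound
  | natLt e f => 1 + e.costBound + f.costBound
  | wtLt e f => 1 + e.costBound + f.costBound
  | not b => 1 + b.costBound
  | and b c => 1 + b.costBound + c.costBound

/-- A bound on the cost of each single step of a program. -/
noncomputable def Program.stepBound : Program → ℕ[X]
  | skip => 1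
  | setNat _ i e => 1 + i.costBound + e.costBound
  | setWt _ i e => 1 + i.costBound + e.costBound
  | seq P Q => P.stepBound + Q.stepBound
  | ite b P Q => 1 + b.costBound + P.stepBound + Q.stepBound
  | loop b P => 1 + b.costBound + P.stepBound

/-- The arrays of natural numbers that a program writes to. -/
def Program.natWrites : Program → List ℕ
  | skip => []
  | setNat a _ _ => [a]
  | setWt _ _ _ => []
  | seq P Q => P.natWrites ++ Q.natWrites
  | ite _ P Q => P.natWrites ++ Q.natWrites
  | loop _ P => P.natWrites

/-- The arrays of weights that a program writes to. -/
def Program.wtWrites : Program → List ℕ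
  | skip => []
  | setNat _ _ _ => []
  | setWt a _ _ => [a]
  | seq P Q => P.wtWrites ++ Q.wtWrites
  | ite _ P Q => P.wtWrites ++ Q.wtWrites
  | loop _ P => P.wtWrites

variable {K : Type*} [AddCommGroup K] [LinearOrder K] {sz : K → ℕ}

/-- Bounds on the contents of the memory: natural numbers are at most `cell`, and weights satisfy
`bd lvl`, where `bd` is a predicate that is graded by complexity. -/
structure Limits (sz : K → ℕ) where
  cell : ℕ
  bd : ℕ → K → Prop
  lvl : ℕ
  unit : ℕ
  bd_zero : bd 0 0
  bd_mono : ∀ {a b v}, a ≤ b → bd a v → bd b v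
  bd_add : ∀ {a b v v'}, bd a v → bd b v' → bd (a + b) (v + v')
  bd_sub : ∀ {a b v v'}, bd a v → bd b v' → bd (a + b) (v - v')
  size_le : ∀ {a v}, bd (a * lvl) v → sz v ≤ (a + 1) * unit

namespace Limits

variable (Λ : Limits sz)

/-- The memory respects the limits. -/
structure Good (s : Memory K) : Prop where
  nat : ∀ a i, s.nat a i ≤ Λ.cell
  wt : ∀ a i, Λ.bd Λ.lvl (s.wt a i)

/-- A bound on the cost of a step of `P`. -/
noncomputable def rate (P : Program) : ℕ := P.stepBound.eval Λ.cell * (1 + Λ.unit)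

end Limits

/-- Only arrays that the program writes to differ. -/
structure Frame (P : Program) (s s' : Memory K) : Prop where
  nat : ∀ a, a ∉ P.natWrites → s'.nat a = s.nat a
  wt : ∀ a, a ∉ P.wtWrites → s'.wt a = s.wt a

theorem Frame.refl (P : Program) (s : Memory K) : Frame P s s := ⟨fun _ _ => rfl, fun _ _ => rfl⟩

theorem Frame.trans {P : Program} {s s' s'' : Memory K} (h : Frame P s s') (h' : Frame P s' s'') :
    Frame P s s'' :=
  ⟨fun a ha => (h'.nat a ha).trans (h.nat a ha), fun a ha => (h'.wt a ha).trans (h.wt a ha)⟩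

theorem Frame.mono {P Q : Program} {s s' : Memory K} (h : Frame P s s')
    (hn : P.natWrites ⊆ Q.natWrites) (hw : P.wtWrites ⊆ Q.wtWrites) : Frame Q s s' :=
  ⟨fun a ha => h.nat a fun h => ha (hn h), fun a ha => h.wt a fun h => ha (hw h)⟩

namespace Memory

theorem setNat_nat (s : Memory K) (a i v b : ℕ) :
    (s.setNat a i v).nat b = if b = a then Function.update (s.nat a) i v else s.nat b := by
  by_cases h : b = a
  · subst h; simp [setNat]
  · simp [setNat, h]

@[simp] theorem setNat_wt (s : Memory K) (a i v : ℕ) : (s.setNat a i v).wt = s.wt := rfl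

theorem setWt_wt (s : Memory K) (a i : ℕ) (v : K) (b : ℕ) :
    (s.setWt a i v).wt b = if b = a then Function.update (s.wt a) i v else s.wt b := by
  by_cases h : b = a
  · subst h; simp [setWt]
  · simp [setWt, h]

@[simp] theorem setWt_nat (s : Memory K) (a i : ℕ) (v : K) : (s.setWt a i v).nat = s.nat := rfl

end Memory

section Costs

variable {Λ : Limits sz} {s : Memory K}

theorem NatExpr.val_le (hs : Λ.Good s) (e : NatExpr) : e.val s ≤ e.valBound.eval Λ.cell := by
  induction e with
  | const k => simp [val, valBound]
  | get a i _ => simpa [val, valBound] using hs.nat _ _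
  | add e f he hf => simpa [val, valBound] using add_le_add he hf
  | sub e f he _ => simpa [val, valBound] using (Nat.sub_le _ _).trans he
  | mul e f he hf => simpa [val, valBound] using Nat.mul_le_mul he hf

theorem size_le_self (k : ℕ) : Nat.size k ≤ k := Nat.size_le.2 Nat.lt_two_pow_self

theorem NatExpr.cost_le (hs : Λ.Good s) (e : NatExpr) :
    e.cost s ≤ e.costBound.eval Λ.cell := by
  induction e with
  | const k => simpa [cost, costBound] using size_le_self k
  | get a i hi =>
    have h := (size_le_self _).trans (hs.nat a (i.val s))
    simp only [cost, costBound, eval_add, eval_one, eval_X]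
    lia
  | add e f he hf =>
    have h := (size_le_self _).trans ((NatExpr.add e f).val_le hs)
    simp only [cost, costBound, valBound, val, eval_add, eval_one] at *
    lia
  | sub e f he hf =>
    have h := (size_le_self _).trans ((NatExpr.sub e f).val_le hs)
    simp only [cost, costBound, valBound, val, eval_add, eval_one] at *
    lia
  | mul e f he hf =>
    have h := (size_le_self _).trans ((NatExpr.mul e f).val_le hs)
    simp only [cost, costBound, valBound, val, eval_add, eval_mul, eval_one] at *
    lia

/-- Every leaf is zero or a memory cell, hence of level at most `lvl`, and levels add up under
addition and subtraction. This is why `Limits.size_le` is stated for multiples of `lvl`. -/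
theorem WtExpr.bd_val (hs : Λ.Good s) (e : WtExpr) : Λ.bd (e.leaves * Λ.lvl) (e.val s) := by
  induction e with
  | zero => exact Λ.bd_mono (Nat.zero_le _) Λ.bd_zero
  | get a i => simpa [leaves, val] using hs.wt _ _
  | add e f he hf => simpa [leaves, val, add_mul] using Λ.bd_add he hf
  | sub e f he hf => simpa [leaves, val, add_mul] using Λ.bd_sub he hf

theorem WtExpr.cost_le (hs : Λ.Good s) (e : WtExpr) :
    e.cost sz s ≤ e.costBound.eval Λ.cell * (1 + Λ.unit) := by
  induction e with
  | zero =>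
    have h := Λ.size_le (WtExpr.zero.bd_val hs)
    simp only [cost, costBound, leaves, val, eval_ofNat] at *
    nlinarith
  | get a i =>
    have h := Λ.size_le ((WtExpr.get a i).bd_val hs)
    have h' := i.cost_le hs
    simp only [cost, costBound, leaves, val, eval_ofNat, eval_add] at *
    nlinarith
  | add e f he hf =>
    have h := Λ.size_le ((WtExpr.add e f).bd_val hs)
    simp only [cost, costBound, leaves, val, eval_C, eval_add] at *
    nlinarith
  | sub e f he hf =>
    have h := Λ.size_le ((WtExpr.sub e f).bd_val hs)
    simp only [cost, costBound, leaves, val, eval_C, eval_add] at *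
    nlinarith

theorem Test.cost_le (hs : Λ.Good s) (b : Test) :
    b.cost sz s ≤ b.costBound.eval Λ.cell * (1 + Λ.unit) := by
  induction b with
  | natEq e f =>
    have h := e.cost_le hs
    have h' := f.cost_le hs
    simp only [cost, costBound, eval_one, eval_add]
    nlinarith
  | natLt e f =>
    have h := e.cost_le hs
    have h' := f.cost_le hs
    simp only [cost, costBound, eval_one, eval_add]
    nlinarith
  | wtLt e f =>
    have h := e.cost_le hs
    have h' := f.cost_le hs
    simp only [cost, costBound, eval_one, eval_add]
    nlinarith
  | not b hb =>
    simp only [cost, costBound, eval_one, eval_add]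
    nlinarith
  | and b c hb hc =>
    simp only [cost, costBound, eval_one, eval_add]
    nlinarith

end Costs

/-- Started on `s`, the program `P` halts after at most `b` steps, on a memory that respects the
limits, differs from `s` only in arrays that `P` writes to, and satisfies `Q`. -/
def WP (Λ : Limits sz) (P : Program) (b : ℕ) (Q : Memory K → Prop) (s : Memory K) : Prop :=
  ∃ s' t, Runs sz P s s' t ∧ t ≤ b * Λ.rate P ∧ Λ.Good s' ∧ Frame P s s' ∧ Q s'

namespace WP

variable {Λ : Limits sz} {s : Memory K} {P P' : Program} {b b' : ℕ} {Q Q' : Memory K → Prop}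

theorem conseq (h : WP Λ P b Q s) (hb : b ≤ b')
    (hQ : ∀ s', Λ.Good s' → Frame P s s' → Q s' → Q' s') : WP Λ P b' Q' s := by
  obtain ⟨s', t, hr, ht, hg, hf, hq⟩ := h
  exact ⟨s', t, hr, ht.trans (Nat.mul_le_mul_right _ hb), hg, hf, hQ s' hg hf hq⟩

theorem skip (hs : Λ.Good s) (hQ : Q s) : WP Λ .skip (b + 1) Q s := by
  refine ⟨s, 1, .skip s, ?_, hs, Frame.refl _ _, hQ⟩
  simp only [Limits.rate, Program.stepBound, eval_one]
  nlinarith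

theorem setNat {a : ℕ} {i e : NatExpr} (hs : Λ.Good s) (he : e.val s ≤ Λ.cell)
    (hQ : Λ.Good (s.setNat a (i.val s) (e.val s)) → Q (s.setNat a (i.val s) (e.val s))) :
    WP Λ (.setNat a i e) (b + 1) Q s := by
  have hg : Λ.Good (s.setNat a (i.val s) (e.val s)) := by
    refine ⟨fun b j => ?_, hs.wt⟩
    rw [Memory.setNat_nat]
    split_ifs with h
    · by_cases hj : j = i.val s
      · simpa [hj] using he
      · simpa [hj] using hs.nat _ _
    · exact hs.nat _ _
  refine ⟨_, _, .setNat s a i e, ?_, hg, ⟨fun b hb => ?_, fun _ _ => rfl⟩, hQ hg⟩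
  · have h1 := i.cost_le hs
    have h2 := e.cost_le hs
    refine le_trans ?_ (Nat.mul_le_mul_right _ (Nat.le_add_left 1 b))
    simp only [Limits.rate, Program.stepBound, eval_add, eval_one]
    nlinarith
  · have : b ≠ a := by simpa [Program.natWrites] using hb
    simp [Memory.setNat_nat, this]

theorem setWt {a : ℕ} {i : NatExpr} {e : WtExpr} (hs : Λ.Good s) (he : Λ.bd Λ.lvl (e.val s))
    (hQ : Λ.Good (s.setWt a (i.val s) (e.val s)) → Q (s.setWt a (i.val s) (e.val s))) :
    WP Λ (.setWt a i e) (b + 1) Q s := by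
  have hg : Λ.Good (s.setWt a (i.val s) (e.val s)) := by
    refine ⟨hs.nat, fun b j => ?_⟩
    rw [Memory.setWt_wt]
    split_ifs with h
    · by_cases hj : j = i.val s
      · simpa [hj] using he
      · simpa [hj] using hs.wt _ _
    · exact hs.wt _ _
  refine ⟨_, _, .setWt s a i e, ?_, hg, ⟨fun _ _ => rfl, fun b hb => ?_⟩, hQ hg⟩
  · have h1 := i.cost_le hs
    have h2 := e.cost_le hs
    refine le_trans ?_ (Nat.mul_le_mul_right _ (Nat.le_add_left 1 b))
    simp only [Limits.rate, Program.stepBound, eval_add, eval_one]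
    nlinarith
  · have : b ≠ a := by simpa [Program.wtWrites] using hb
    simp [Memory.setWt_wt, this]

/-- The rate of the composite program is the sum of the two rates, so step counts add although each
part is timed at its own rate. -/
theorem seq (h : WP Λ P b (WP Λ P' b' Q) s) : WP Λ (.seq P P') (b + b') Q s := by
  obtain ⟨s', t, hr, ht, -, hf, s'', t', hr', ht', hg, hf', hq⟩ := h
  refine ⟨s'', t + t', .seq hr hr', ?_, hg,
    (hf.mono (by simp [Program.natWrites]) (by simp [Program.wtWrites])).trans
      (hf'.mono (by simp [Program.natWrites]) (by simp [Program.wtWrites])), hq⟩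
  simp only [Limits.rate, Program.stepBound, eval_add] at *
  nlinarith [Nat.zero_le (b * (P'.stepBound.eval Λ.cell * (1 + Λ.unit))),
    Nat.zero_le (b' * (P.stepBound.eval Λ.cell * (1 + Λ.unit)))]

theorem ite {c : Test} (hs : Λ.Good s) (ht : c.Holds s → WP Λ P b Q s)
    (hf : ¬ c.Holds s → WP Λ P' b Q s) : WP Λ (.ite c P P') (b + 1) Q s := by
  have hc := c.cost_le hs
  by_cases h : c.Holds s
  · obtain ⟨s', t, hr, ht, hg, hf, hq⟩ := ht h
    refine ⟨s', _, .ite_true h hr, ?_, hg,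
      hf.mono (by simp [Program.natWrites]) (by simp [Program.wtWrites]), hq⟩
    simp only [Limits.rate, Program.stepBound, eval_add, eval_one] at *
    nlinarith [Nat.zero_le (b * (P'.stepBound.eval Λ.cell * (1 + Λ.unit))),
      Nat.zero_le (b * (c.costBound.eval Λ.cell * (1 + Λ.unit))), Nat.zero_le (b * (1 + Λ.unit)),
      Nat.zero_le (P'.stepBound.eval Λ.cell * (1 + Λ.unit)),
      Nat.zero_le (P.stepBound.eval Λ.cell * (1 + Λ.unit))]
  · obtain ⟨s', t, hr, ht, hg, hf, hq⟩ := hf h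
    refine ⟨s', _, .ite_false h hr, ?_, hg,
      hf.mono (by simp [Program.natWrites]) (by simp [Program.wtWrites]), hq⟩
    simp only [Limits.rate, Program.stepBound, eval_add, eval_one] at *
    nlinarith [Nat.zero_le (b * (P.stepBound.eval Λ.cell * (1 + Λ.unit))),
      Nat.zero_le (b * (c.costBound.eval Λ.cell * (1 + Λ.unit))), Nat.zero_le (b * (1 + Λ.unit)),
      Nat.zero_le (P'.stepBound.eval Λ.cell * (1 + Λ.unit)),
      Nat.zero_le (P.stepBound.eval Λ.cell * (1 + Λ.unit))]

/-- The rule for loops with a variant. -/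
theorem loop {c : Test} (I : ℕ → Memory K → Prop)
    (step : ∀ d s', Λ.Good s' → Frame P s s' → I d s' → c.Holds s' →
      WP Λ P b (fun s'' => ∃ d' < d, I d' s'') s') (d : ℕ) (hs : Λ.Good s) (hI : I d s) :
    WP Λ (.loop c P) (d * (b + 1) + 1) (fun s' => (∃ d', I d' s') ∧ ¬ c.Holds s') s := by
  suffices H : ∀ d s', Λ.Good s' → Frame P s s' → I d s' →
      WP Λ (.loop c P) (d * (b + 1) + 1) (fun s' => (∃ d', I d' s') ∧ ¬ c.Holds s') s' from
    H d s hs (Frame.refl _ _) hI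
  intro d
  induction d using Nat.strong_induction_on with
  | _ d ih =>
    intro s' hs' hf' hI'
    have hc := c.cost_le hs'
    have hm : ∀ {s s' : Memory K}, Frame P s s' → Frame (.loop c P) s s' := fun hf =>
      hf.mono (by simp [Program.natWrites]) (by simp [Program.wtWrites])
    by_cases h : c.Holds s'
    · obtain ⟨s₁, t₁, hr₁, ht₁, hg₁, hf₁, d₁, hd₁, hI₁⟩ := step d s' hs' hf' hI' h
      obtain ⟨s₂, t₂, hr₂, ht₂, hg₂, hf₂, hQ₂⟩ := ih d₁ hd₁ s₁ hg₁ (hf'.trans hf₁) hI₁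
      refine ⟨s₂, _, .loop_true h hr₁ hr₂, ?_, hg₂, (hm hf₁).trans hf₂, hQ₂⟩
      -- One step at the rate of the loop pays for a test as well as for a step of the body; so a
      -- pass through the loop takes `b + 1` steps.
      have h1 : Λ.rate (.loop c P) =
          (1 + Λ.unit) + c.costBound.eval Λ.cell * (1 + Λ.unit) + Λ.rate P := by
        simp only [Limits.rate, Program.stepBound, eval_add, eval_one]; ring
      have h2 : (d₁ + 1) * (b + 1) + 1 ≤ d * (b + 1) + 1 := by gcongr; exact hd₁
      refine le_trans ?_ (Nat.mul_le_mul_right _ h2)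
      have h3 : t₁ ≤ b * Λ.rate (.loop c P) := ht₁.trans (by gcongr; lia)
      nlinarith
    · refine ⟨s', _, .loop_false h, ?_, hs', Frame.refl _ _, ⟨d, hI'⟩, h⟩
      have h1 : Λ.rate (.loop c P) =
          (1 + Λ.unit) + c.costBound.eval Λ.cell * (1 + Λ.unit) + Λ.rate P := by
        simp only [Limits.rate, Program.stepBound, eval_add, eval_one]; ring
      nlinarith [Nat.zero_le (d * (b + 1) * Λ.rate (.loop c P))]

end WP

/-- Run `P` for `v = 0, …, n - 1`, where `v` is in cell `0` of an array, and `n` in cell `0` of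
array `0`. -/
def forLoop (v : ℕ) (P : Program) : Program :=
  .seq (.setNat v (.const 0) (.const 0))
    (.loop (.natLt (.get v (.const 0)) (.get 0 (.const 0)))
      (.seq P (.setNat v (.const 0) (.add (.get v (.const 0)) (.const 1)))))

/-- The invariant at `k` refers to the memory whose counter is already `k`; the body therefore has
to establish it at `k + 1` for the memory after the increment. Each pass takes `b` steps for the
body, one for the increment and one for the test; the two further steps are the initialisation and
the last test. -/
theorem WP.forLoop {Λ : Limits sz} {s : Memory K} {P : Program} {b n v : ℕ}
    (I : ℕ → Memory K → Prop) (hs : Λ.Good s) (hn : s.nat 0 0 = n) (hv : v ≠ 0)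
    (hv' : v ∉ P.natWrites) (h0 : 0 ∉ P.natWrites) (init : I 0 (s.setNat v 0 0))
    (step : ∀ k < n, ∀ s', Λ.Good s' → Frame (forLoop v P) s s' → s'.nat v 0 = k → I k s' →
      WP Λ P b (fun s'' => I (k + 1) (s''.setNat v 0 (k + 1))) s') :
    WP Λ (forLoop v P) (n * (b + 2) + 2) (I n) s := by
  unfold CopelandMoV.forLoop
  have hb : 1 + (n * (b + 1 + 1) + 1) = n * (b + 2) + 2 := by ring
  rw [← hb]
  refine WP.seq (WP.setNat hs (by simp [NatExpr.val]) fun hg => ?_)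
  have hnc : n ≤ Λ.cell := hn ▸ hs.nat 0 0
  simp only [NatExpr.val] at hg ⊢
  refine (WP.loop (b := b + 1) (fun d s' => ∃ k, k + d = n ∧ s'.nat v 0 = k ∧ I k s')
    ?_ n hg ⟨0, by simp, by simp [Memory.setNat_nat], init⟩).conseq le_rfl ?_
  · rintro d s' hg' hf' ⟨k, hk, hvk, hI⟩ hlt
    have hfr : ∀ {s₁ s₂ : Memory K}, Frame (P.seq (.setNat v (.const 0)
          (.add (.get v (.const 0)) (.const 1)))) s₁ s₂ → Frame (CopelandMoV.forLoop v P) s₁ s₂ :=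
      fun h => h.mono (by simp [Program.natWrites, CopelandMoV.forLoop])
        (by simp [Program.wtWrites, CopelandMoV.forLoop])
    have hf1 : Frame (CopelandMoV.forLoop v P) s (s.setNat v 0 0) := by
      refine ⟨fun a ha => ?_, fun _ _ => rfl⟩
      have : a ≠ v := by
        rintro rfl
        simp [Program.natWrites, CopelandMoV.forLoop] at ha
      simp [Memory.setNat_nat, this]
    have hn' : s'.nat 0 0 = n := by
      rw [hf'.nat 0 (by simp [Program.natWrites, h0, hv.symm]), Memory.setNat_nat,
        if_neg hv.symm, hn]
    simp only [Test.Holds, NatExpr.val, hvk, hn'] at hlt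
    refine WP.seq ((step k hlt s' hg' (hf1.trans (hfr hf')) hvk hI).conseq le_rfl ?_)
    intro s'' hg'' hf'' hI''
    have hvk' : s''.nat v 0 = k := by rw [hf''.nat v hv', hvk]
    refine WP.setNat hg'' (by simp [NatExpr.val, hvk']; lia) fun _ => ?_
    refine ⟨d - 1, by lia, k + 1, by lia, ?_, ?_⟩
    · simp [Memory.setNat_nat, NatExpr.val, hvk']
    · simpa [NatExpr.val, hvk'] using hI''
  · rintro s' hg' hf' ⟨⟨d, k, hk, hvk, hI⟩, hlt⟩
    have hn' : s'.nat 0 0 = n := by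
      rw [hf'.nat 0 (by simp [Program.natWrites, h0, hv.symm]), Memory.setNat_nat,
        if_neg hv.symm, hn]
    simp only [Test.Holds, NatExpr.val, hvk, hn'] at hlt
    have : k = n := by lia
    exact this ▸ hI

end ProgramLogic

/-! ## Optimality of orientations with potentials -/

section Orientations

variable {K : Type*} [Field K] [LinearOrder K] [IsStrictOrderedRing K]

/-- `A` describes an orientation of the complete graph on `0, …, n - 1`: `A i j = 1` if `i` owns the
edge between `i` and `j`. -/
def Orients (n : ℕ) (A : ℕ → ℕ → ℕ) : Prop :=
  ∀ i < n, ∀ j < n, A i j + A j i = if i = j then 0 else 1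

/-- The cost of raising the number of edges that a vertex owns from `d` to `d + 1`. -/
def marginal (M off : K) (d c : ℕ) : K := (if d < c then 0 else M) - off

/-- The cost of owning `d` edges. -/
def ownCost (M off : K) (d c : ℕ) : K := M * ((d - c : ℕ) : K) - off * d

/-- Potentials that certify that an orientation is optimal. -/
structure Potential (n : ℕ) (W : ℕ → ℕ → K) (M : K) (off : ℕ → K) (A : ℕ → ℕ → ℕ)
    (deg cap : ℕ → ℕ) (p : ℕ → K) : Prop where
  arc : ∀ i < n, ∀ j < n, A i j = 1 → p i ≤ W i j - W j i + p j
  le : ∀ i < n, p i ≤ marginal M (off i) (deg i) (cap i)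
  ge : ∀ i < n, 0 < deg i → marginal M (off i) (deg i - 1) (cap i) ≤ p i

theorem marginal_mono {M off : K} (hM : 0 ≤ M) {d d' c : ℕ} (h : d ≤ d') :
    marginal M off d c ≤ marginal M off d' c := by
  unfold marginal
  split_ifs <;> first | lia | linarith

theorem ownCost_succ (M off : K) (d c : ℕ) :
    ownCost M off (d + 1) c = ownCost M off d c + marginal M off d c := by
  unfold ownCost marginal
  split_ifs with h
  · rw [Nat.sub_eq_zero_of_le (by lia), Nat.sub_eq_zero_of_le (by lia)]
    push_cast; ring
  · rw [Nat.succ_sub (by lia)]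
    push_cast; ring

/-- The cost of owning edges is convex with increments `marginal`, so a slope between the last
increment and the next one is a subgradient. The increments are summed upwards or downwards from
`d`. -/
theorem ownCost_subgradient {M off p : K} (hM : 0 ≤ M) {d c : ℕ} (h1 : p ≤ marginal M off d c)
    (h2 : 0 < d → marginal M off (d - 1) c ≤ p) (d' : ℕ) :
    p * (d' - d) ≤ ownCost M off d' c - ownCost M off d c := by
  rcases le_total d d' with h | h
  · induction d', h using Nat.le_induction with
    | base => simp
    | succ e he ih =>
      have h3 := marginal_mono (off := off) (c := c) hM he
      rw [ownCost_succ]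
      push_cast
      linarith
  · obtain ⟨e, rfl⟩ := Nat.exists_eq_add_of_le h
    clear h
    induction e generalizing d' with
    | zero => simp
    | succ e ih =>
      have h3 := marginal_mono (off := off) (c := c) hM (show d' ≤ d' + (e + 1) - 1 by lia)
      have h4 := h2 (by lia)
      have h5 := ih (d' + 1) (by rwa [show d' + 1 + e = d' + (e + 1) by lia])
        (by rwa [show d' + 1 + e = d' + (e + 1) by lia])
      rw [ownCost_succ, show d' + 1 + e = d' + (e + 1) by lia] at h5
      push_cast at h5 ⊢
      linarith

/-- Lowering the capacity of a vertex. -/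
theorem Potential.lower {n : ℕ} {W : ℕ → ℕ → K} {M : K} {off : ℕ → K} {A : ℕ → ℕ → ℕ}
    {deg cap cap' : ℕ → ℕ} {p : ℕ → K} (h : Potential n W M off A deg cap p) (hM : 0 ≤ M) {l : ℕ}
    (hl : deg l ≠ cap l) (hc : ∀ v, cap' v = if v = l then cap l - 1 else cap v) :
    Potential n W M off A deg cap' p := by
  -- As `deg l ≠ cap l`, the marginal cost of the last owned edge of `l` does not change, and that
  -- of the next edge can only rise.
  refine ⟨h.arc, fun v hv => (h.le v hv).trans ?_, fun v hv hpos => le_trans ?_ (h.ge v hv hpos)⟩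
  · rw [hc]
    unfold marginal
    split_ifs <;> first | lia | linarith
  · rw [hc]
    unfold marginal
    split_ifs with h1 h2 <;> try subst h1
    all_goals first | lia | linarith

/-- Lowering the capacity of a saturated vertex, which gives up one edge. -/
theorem Potential.lower_saturated {n : ℕ} {W : ℕ → ℕ → K} {M : K} {off : ℕ → K} {A : ℕ → ℕ → ℕ}
    {deg deg' cap cap' : ℕ → ℕ} {p : ℕ → K} (h : Potential n W M off A deg cap p) {l : ℕ}
    (hl : deg l = cap l) (hl0 : 0 < cap l)
    (hc : ∀ v, cap' v = if v = l then cap l - 1 else cap v)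
    (hd : ∀ v, deg' v = if v = l then deg l - 1 else deg v) :
    Potential n W M off A deg' cap' p := by
  -- Marginal costs depend on degree and capacity only through their comparison, which is unaffected
  -- when both drop by one.
  refine ⟨h.arc, fun v hv => (h.le v hv).trans (le_of_eq ?_), fun v hv hpos =>
    le_trans (le_of_eq ?_) (h.ge v hv ?_)⟩
  · rw [hc, hd]
    unfold marginal
    split_ifs with h1 h2 <;> try subst h1
    all_goals lia
  · rw [hd] at hpos
    rw [hc, hd]
    unfold marginal
    split_ifs at hpos ⊢ with h1 h2 <;> try subst h1
    all_goals lia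
  · rw [hd] at hpos
    split_ifs at hpos with h1 <;> [subst h1; skip] <;> lia

theorem Orients.sum_le {n : ℕ} {A : ℕ → ℕ → ℕ} (h : Orients n A) {i : ℕ} (hi : i < n) :
    ∑ j ∈ Finset.range n, A i j ≤ n := by
  refine (Finset.sum_le_card_nsmul _ _ 1 fun j hj => ?_).trans (by simp)
  have := h i hi j (Finset.mem_range.1 hj)
  split_ifs at this <;> lia

/-- The total cost of the reversed edges. -/
def reversalCost (n : ℕ) (W : ℕ → ℕ → K) (A : ℕ → ℕ → ℕ) : K :=
  ∑ i ∈ Finset.range n, ∑ j ∈ Finset.range n, (A j i : K) * W i j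

/-- Summation by parts: a vertex's change of degree is a sum over the edges that change owner.
Passing an edge from `i` to `j` changes the reversal cost by `W i j - W j i`, and `arc` bounds this
below by `p i - p j`. -/
theorem Orients.reversalCost_sub_le {n : ℕ} {W : ℕ → ℕ → K} {A A' : ℕ → ℕ → ℕ} {p : ℕ → K}
    (hA : Orients n A) (hA' : Orients n A')
    (arc : ∀ i < n, ∀ j < n, A i j = 1 → p i ≤ W i j - W j i + p j) :
    ∑ i ∈ Finset.range n, p i *
        (((∑ j ∈ Finset.range n, A i j : ℕ) : K) - ((∑ j ∈ Finset.range n, A' i j : ℕ) : K)) ≤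
      reversalCost n W A' - reversalCost n W A := by
  -- For indices below `n`, `F i j` is one if `i` owns the edge in `A` but `j` owns it in `A'`, and
  -- zero otherwise.
  let F : ℕ → ℕ → K := fun i j => A i j * (1 - A' i j)
  have key : ∀ i < n, ∀ j < n, (A i j : K) - A' i j = F i j - F j i ∧
      (A' j i : K) - A j i = F i j - F j i := by
    intro i hi j hj
    have h1 := hA i hi j hj
    have h2 := hA' i hi j hj
    simp only [F]
    by_cases hij : i = j
    · subst hij
      simp_all
    · rw [if_neg hij] at h1 h2
      have h3 : A i j = 0 ∧ A j i = 1 ∨ A i j = 1 ∧ A j i = 0 := by lia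
      have h4 : A' i j = 0 ∧ A' j i = 1 ∨ A' i j = 1 ∧ A' j i = 0 := by lia
      rcases h3 with ⟨h3, h5⟩ | ⟨h3, h5⟩ <;> rcases h4 with ⟨h4, h6⟩ | ⟨h4, h6⟩ <;>
        simp [h3, h4, h5, h6]
  have e1 : ∑ i ∈ Finset.range n, p i *
        (((∑ j ∈ Finset.range n, A i j : ℕ) : K) - ((∑ j ∈ Finset.range n, A' i j : ℕ) : K)) =
      ∑ i ∈ Finset.range n, ∑ j ∈ Finset.range n, F i j * (p i - p j) := by
    have : ∑ i ∈ Finset.range n, ∑ j ∈ Finset.range n, F i j * p j =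
        ∑ i ∈ Finset.range n, ∑ j ∈ Finset.range n, F j i * p i := Finset.sum_comm
    simp only [mul_sub, Finset.sum_sub_distrib]
    rw [this, ← Finset.sum_sub_distrib, ← Finset.sum_sub_distrib]
    refine Finset.sum_congr rfl fun i hi => ?_
    rw [← mul_sub, ← Finset.sum_sub_distrib]
    push_cast
    rw [← Finset.sum_sub_distrib, Finset.mul_sum]
    refine Finset.sum_congr rfl fun j hj => ?_
    rw [(key i (Finset.mem_range.1 hi) j (Finset.mem_range.1 hj)).1]
    ring
  have e2 : reversalCost n W A' - reversalCost n W A =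
      ∑ i ∈ Finset.range n, ∑ j ∈ Finset.range n, F i j * (W i j - W j i) := by
    have : ∑ i ∈ Finset.range n, ∑ j ∈ Finset.range n, F i j * W j i =
        ∑ i ∈ Finset.range n, ∑ j ∈ Finset.range n, F j i * W i j := Finset.sum_comm
    simp only [mul_sub, Finset.sum_sub_distrib]
    rw [this, ← Finset.sum_sub_distrib, reversalCost, reversalCost, ← Finset.sum_sub_distrib]
    refine Finset.sum_congr rfl fun i hi => ?_
    rw [← Finset.sum_sub_distrib, ← Finset.sum_sub_distrib]
    refine Finset.sum_congr rfl fun j hj => ?_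
    rw [← sub_mul, ← sub_mul, (key i (Finset.mem_range.1 hi) j (Finset.mem_range.1 hj)).2]
  rw [e1, e2]
  refine Finset.sum_le_sum fun i hi => Finset.sum_le_sum fun j hj => ?_
  rw [Finset.mem_range] at hi hj
  have h1 := hA i hi j hj
  have h2 := hA' i hi j hj
  have h3 : A i j = 0 ∨ A i j = 1 := by split_ifs at h1 <;> lia
  have h4 : A' i j = 0 ∨ A' i j = 1 := by split_ifs at h2 <;> lia
  rcases h3 with h3 | h3
  · simp [F, h3]
  · have h5 := arc i hi j hj h3
    rcases h4 with h4 | h4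
    · simp only [F, h3, h4]; push_cast; linarith
    · simp [F, h3, h4]

/-- Orientations with potentials are optimal. -/
theorem Potential.optimal {n : ℕ} {W : ℕ → ℕ → K} {M : K} {off : ℕ → K} {A A' : ℕ → ℕ → ℕ}
    {deg cap : ℕ → ℕ} {p : ℕ → K} (hp : Potential n W M off A deg cap p) (hM : 0 ≤ M)
    (hA : Orients n A) (hA' : Orients n A')
    (hdeg : ∀ i < n, ∑ j ∈ Finset.range n, A i j = deg i) :
    reversalCost n W A + ∑ i ∈ Finset.range n, ownCost M (off i) (deg i) (cap i) ≤
      reversalCost n W A' + ∑ i ∈ Finset.range n,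
        ownCost M (off i) (∑ j ∈ Finset.range n, A' i j) (cap i) := by
  have h1 := hA.reversalCost_sub_le hA' hp.arc
  have h2 : ∑ i ∈ Finset.range n, p i * (((∑ j ∈ Finset.range n, A' i j : ℕ) : K) -
      ((∑ j ∈ Finset.range n, A i j : ℕ) : K)) ≤
      ∑ i ∈ Finset.range n, ownCost M (off i) (∑ j ∈ Finset.range n, A' i j) (cap i) -
      ∑ i ∈ Finset.range n, ownCost M (off i) (deg i) (cap i) := by
    rw [← Finset.sum_sub_distrib]
    refine Finset.sum_le_sum fun i hi => ?_
    rw [Finset.mem_range] at hi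
    rw [hdeg i hi]
    exact ownCost_subgradient hM (hp.le i hi) (hp.ge i hi) _
  have h3 : ∑ i ∈ Finset.range n, p i * (((∑ j ∈ Finset.range n, A' i j : ℕ) : K) -
      ((∑ j ∈ Finset.range n, A i j : ℕ) : K)) = - ∑ i ∈ Finset.range n, p i *
        (((∑ j ∈ Finset.range n, A i j : ℕ) : K) - ((∑ j ∈ Finset.range n, A' i j : ℕ) : K)) := by
    rw [← Finset.sum_neg_distrib]
    exact Finset.sum_congr rfl fun i _ => by ring
  linarith

/-- If all capacities are `c`, and `x` gets a large reward for each edge that it owns, then an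
optimal orientation is at least as good as each orientation in which `x` owns `c` edges and no
vertex owns more. -/
theorem Potential.optimal_of_feasible {n x c : ℕ} {W : ℕ → ℕ → K} {M : K} {A A' : ℕ → ℕ → ℕ}
    {deg cap : ℕ → ℕ} {off p : ℕ → K} (hp : Potential n W M off A deg cap p) (hx : x < n)
    (hoff : ∀ i < n, off i = if i = x then M else 0) (hcap : ∀ i < n, cap i = c)
    (hW : ∀ i < n, ∀ j < n, 0 ≤ W i j) (hA : Orients n A) (hA' : Orients n A')
    (hdeg : ∀ i < n, ∑ j ∈ Finset.range n, A i j = deg i)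
    (hx' : ∑ j ∈ Finset.range n, A' x j = c) (hle : ∀ i < n, ∑ j ∈ Finset.range n, A' i j ≤ c)
    (hM : reversalCost n W A' < M) :
    (∀ i < n, deg i ≤ deg x) ∧ reversalCost n W A ≤ reversalCost n W A' := by
  have hpos : ∀ A : ℕ → ℕ → ℕ, 0 ≤ reversalCost n W A := fun A =>
    Finset.sum_nonneg fun i hi => Finset.sum_nonneg fun j hj =>
      mul_nonneg (Nat.cast_nonneg _) (hW i (Finset.mem_range.1 hi) j (Finset.mem_range.1 hj))
  have hM0 : 0 ≤ M := (hpos A').trans hM.le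
  have key := hp.optimal hM0 hA hA' hdeg
  have hsum : ∀ d : ℕ → ℕ, ∑ i ∈ Finset.range n, ownCost M (off i) (d i) (cap i) =
      M * ((∑ i ∈ Finset.range n, (d i - c) : ℕ) : K) - M * d x := by
    intro d
    have : ∑ i ∈ Finset.range n, ownCost M (off i) (d i) (cap i) =
        ∑ i ∈ Finset.range n, (M * ((d i - c : ℕ) : K) - if i = x then M * d i else 0) := by
      refine Finset.sum_congr rfl fun i hi => ?_
      rw [Finset.mem_range] at hi
      rw [ownCost, hoff i hi, hcap i hi]
      split_ifs <;> simp
    rw [this, Finset.sum_sub_distrib, Finset.sum_ite_eq' (Finset.range n) x,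
      if_pos (Finset.mem_range.2 hx), ← Finset.mul_sum]
    push_cast
    rfl
  rw [hsum deg, hsum fun i => ∑ j ∈ Finset.range n, A' i j] at key
  have hz : ∑ i ∈ Finset.range n, ((∑ j ∈ Finset.range n, A' i j) - c) = 0 :=
    Finset.sum_eq_zero fun i hi => Nat.sub_eq_zero_of_le (hle i (Finset.mem_range.1 hi))
  rw [hz, hx'] at key
  set V := ∑ i ∈ Finset.range n, (deg i - c) with hV
  have hVx : deg x - c ≤ V :=
    Finset.single_le_sum (f := fun i => deg i - c) (fun _ _ => Nat.zero_le _)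
      (Finset.mem_range.2 hx)
  have hA0 := hpos A
  -- Otherwise the penalised cost of `A` exceeds that of `A'` by at least `M - reversalCost n W A'`,
  -- which is positive.
  have hVle : V + c ≤ deg x := by
    by_contra hcon
    have h1 : ((deg x + 1 : ℕ) : K) ≤ ((V + c : ℕ) : K) := by
      exact_mod_cast (by lia : deg x + 1 ≤ V + c)
    have h2 := mul_le_mul_of_nonneg_left h1 hM0
    push_cast at h2 key
    linarith
  -- Now `V = deg x - c` with `c ≤ deg x`: all excess belongs to `x`. It may own more than `c`
  -- edges, since reward and penalty cancel, but nobody else does. The penalty terms of both sides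
  -- agree, and the reversal costs remain.
  refine ⟨fun i hi => ?_, ?_⟩
  · by_cases hix : i = x
    · rw [hix]
    · have h1 : (deg i - c) + (deg x - c) ≤ V := by
        rw [hV, ← Finset.sum_pair hix (f := fun i => deg i - c)]
        exact Finset.sum_le_sum_of_subset (by
          intro j hj
          simp only [Finset.mem_insert, Finset.mem_singleton] at hj
          rcases hj with rfl | rfl <;> simpa)
      lia
  · have h1 : ((deg x : ℕ) : K) ≤ ((V + c : ℕ) : K) := by
      exact_mod_cast (by lia : deg x ≤ V + c)
    have h2 := mul_le_mul_of_nonneg_left h1 hM0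
    push_cast at h2 key
    linarith

/-! ## Shortest paths -/

/-- The invariant of Dijkstra's algorithm for the arcs `(v, a)` with `A v a = 1` of cost `k v a`,
initial distances `g` and potentials `p`: `rank` is positive on the vertices with final distance,
which are `r` in number, and increases in the order in which they have been found. -/
structure DijkstraInv (n : ℕ) (k : ℕ → ℕ → K) (A : ℕ → ℕ → ℕ) (g p : ℕ → K) (r : ℕ)
    (rank succ : ℕ → ℕ) (D : ℕ → K) : Prop where
  rank_le : ∀ v < n, rank v ≤ r
  count : ((Finset.range n).filter fun v => rank v = 0).card + r = n
  sep : ∀ a < n, ∀ b < n, rank a ≠ 0 → rank b = 0 → D a - p a ≤ D b - p b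
  arc : ∀ v < n, ∀ a < n, rank a ≠ 0 → A v a = 1 → D v ≤ k v a + D a
  le : ∀ v < n, D v ≤ g v
  ge : ∀ v < n, p v ≤ D v
  tight : ∀ v < n, (succ v = v ∧ D v = g v) ∨
    (succ v < n ∧ rank (succ v) ≠ 0 ∧ (rank v = 0 ∨ rank (succ v) < rank v) ∧
      A v (succ v) = 1 ∧ D v = k v (succ v) + D (succ v))

section Dijkstra

variable {n : ℕ} {k : ℕ → ℕ → K} {A : ℕ → ℕ → ℕ} {g p : ℕ → K} {r : ℕ} {rank succ : ℕ → ℕ}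
  {D : ℕ → K}

theorem DijkstraInv.init (hp : ∀ v < n, p v ≤ g v) (hr : ∀ v < n, rank v = 0)
    (hs : ∀ v < n, succ v = v) (hD : ∀ v < n, D v = g v) :
    DijkstraInv n k A g p 0 rank succ D where
  rank_le v hv := (hr v hv).le
  count := by
    rw [Finset.filter_true_of_mem fun v hv => hr v (Finset.mem_range.1 hv)]
    simp
  sep a ha b hb h := absurd (hr a ha) h
  arc v hv a ha h := absurd (hr a ha) h
  le v hv := (hD v hv).le
  ge v hv := (hp v hv).trans (hD v hv).ge
  tight v hv := Or.inl ⟨hs v hv, hD v hv⟩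

theorem DijkstraInv.exists_rank_eq_zero (h : DijkstraInv n k A g p r rank succ D) (hr : r < n) :
    ∃ v < n, rank v = 0 := by
  have h1 := h.count
  have h2 : 0 < ((Finset.range n).filter fun v => rank v = 0).card := by lia
  obtain ⟨v, hv⟩ := Finset.card_pos.1 h2
  simp only [Finset.mem_filter, Finset.mem_range] at hv
  exact ⟨v, hv⟩

theorem DijkstraInv.rank_ne_zero (h : DijkstraInv n k A g p n rank succ D) :
    ∀ v < n, rank v ≠ 0 := by
  intro v hv h0
  have h1 := h.count
  have h2 : ((Finset.range n).filter fun v => rank v = 0).card = 0 := by lia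
  rw [Finset.card_eq_zero] at h2
  have : v ∈ (Finset.range n).filter fun v => rank v = 0 := by simp [hv, h0]
  rw [h2] at this
  simp at this

/-- The potentials make all reduced costs `k i j + p j - p i` of arcs nonnegative. Hence relaxing
along arcs into the chosen `u` never takes a reduced distance below that of `u`, which keeps the
finished vertices separated from the others. -/
theorem DijkstraInv.step (h : DijkstraInv n k A g p r rank succ D)
    (hp : ∀ i < n, ∀ j < n, A i j = 1 → p i ≤ k i j + p j) {u : ℕ} (hu : u < n)
    (hu0 : rank u = 0) (hmin : ∀ v < n, rank v = 0 → D u - p u ≤ D v - p v)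
    {rank' succ' : ℕ → ℕ} {D' : ℕ → K} (hr' : ∀ v, rank' v = if v = u then r + 1 else rank v)
    (hD' : ∀ v < n, D' v = if rank' v = 0 ∧ A v u = 1 ∧ k v u + D u < D v then k v u + D u else D v)
    (hs' : ∀ v < n, succ' v = if rank' v = 0 ∧ A v u = 1 ∧ k v u + D u < D v then u else succ v) :
    DijkstraInv n k A g p (r + 1) rank' succ' D' := by
  have hold : ∀ v < n, rank' v ≠ 0 → D' v = D v ∧ succ' v = succ v := by
    intro v hv h0
    rw [hD' v hv, hs' v hv, if_neg (by tauto), if_neg (by tauto)]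
    exact ⟨rfl, rfl⟩
  have hle : ∀ v < n, D' v ≤ D v := by
    intro v hv
    rw [hD' v hv]
    split_ifs with hc
    · exact hc.2.2.le
    · exact le_rfl
  have hu' : rank' u = r + 1 := by rw [hr', if_pos rfl]
  have hDu : D' u = D u := (hold u hu (by lia)).1
  have hrank : ∀ v, rank' v = 0 → v ≠ u ∧ rank v = 0 := by
    intro v hv
    rw [hr'] at hv
    split_ifs at hv with hc
    exact ⟨hc, hv⟩
  have hrank2 : ∀ v, rank v ≠ 0 → rank' v = rank v := by
    intro v hv
    rw [hr', if_neg (by rintro rfl; exact hv hu0)]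
  have hsepu : ∀ v < n, rank' v = 0 → D u - p u ≤ D' v - p v := by
    intro v hv h0
    rw [hD' v hv]
    split_ifs with hc
    · have := hp v hv u hu hc.2.1
      linarith
    · exact hmin v hv (hrank v h0).2
  refine ⟨?_, ?_, ?_, ?_, ?_, ?_, ?_⟩
  · intro v hv
    rw [hr']
    have := h.rank_le v hv
    split_ifs <;> lia
  · have h1 : ((Finset.range n).filter fun v => rank' v = 0) =
        ((Finset.range n).filter fun v => rank v = 0).erase u := by
      ext v
      simp only [Finset.mem_filter, Finset.mem_range, Finset.mem_erase, hr']
      split_ifs with hv <;> simp [hv]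
    have h2 : u ∈ (Finset.range n).filter fun v => rank v = 0 := by simp [hu, hu0]
    have h3 := Finset.card_erase_add_one h2
    have h4 := h.count
    rw [h1]
    lia
  · intro a ha b hb ha0 hb0
    refine le_trans ?_ (hsepu b hb hb0)
    rw [(hold a ha ha0).1]
    by_cases hau : a = u
    · rw [hau]
    · exact h.sep a ha u hu (by rwa [hr', if_neg hau] at ha0) hu0
  · intro v hv a ha ha0 hva
    rw [(hold a ha ha0).1]
    by_cases hau : a = u
    · subst hau
      by_cases hv0 : rank' v = 0
      · rw [hD' v hv]
        split_ifs with hc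
        · exact le_rfl
        · exact not_lt.1 fun hlt => hc ⟨hv0, hva, hlt⟩
      -- Arcs into `u` from finished vertices are not relaxed. They need no relaxation: `v` has at
      -- most the reduced distance of `u`, and the reduced cost of the arc is nonnegative.
      · rw [(hold v hv hv0).1]
        have h1 := hp v hv a ha hva
        have h2 : D v - p v ≤ D a - p a := by
          by_cases hvu : v = a
          · rw [hvu]
          · exact h.sep v hv a ha (by rwa [hr', if_neg hvu] at hv0) hu0
        linarith
    · exact (hle v hv).trans (h.arc v hv a ha (by rwa [hr', if_neg hau] at ha0) hva)
  · intro v hv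
    exact (hle v hv).trans (h.le v hv)
  · intro v hv
    rw [hD' v hv]
    split_ifs with hc
    · exact (hp v hv u hu hc.2.1).trans (by linarith [h.ge u hu])
    · exact h.ge v hv
  · intro v hv
    by_cases hc : rank' v = 0 ∧ A v u = 1 ∧ k v u + D u < D v
    · right
      rw [hs' v hv, hD' v hv, if_pos hc, if_pos hc]
      exact ⟨hu, by lia, Or.inl hc.1, hc.2.1, by rw [hDu]⟩
    · rw [hs' v hv, hD' v hv, if_neg hc, if_neg hc]
      rcases h.tight v hv with h1 | ⟨h1, h2, h3, h4, h5⟩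
      · exact Or.inl h1
      · right
        have h6 := hrank2 _ h2
        refine ⟨h1, by lia, ?_, h4, by rw [(hold _ h1 (by lia)).1]; exact h5⟩
        rw [h6, hr']
        have h7 := h.rank_le _ h1
        by_cases hvu : v = u
        · rw [if_pos hvu]; right; lia
        · rw [if_neg hvu]; exact h3

end Dijkstra

/-! ## Augmenting paths -/

/-- The invariant of the reversal of a shortest path: the vertex `u` owns one edge in excess of
`deg u`, and a shortest path leads on from `u` along `succ`. -/
structure AugmentInv (n : ℕ) (W : ℕ → ℕ → K) (M : K) (off : ℕ → K) (deg cap rank succ : ℕ → ℕ)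
    (D : ℕ → K) (A : ℕ → ℕ → ℕ) (u : ℕ) : Prop where
  lt : u < n
  orients : Orients n A
  potential : Potential n W M off A deg cap D
  owned : ∀ v < n, ∑ j ∈ Finset.range n, A v j = deg v + if v = u then 1 else 0
  tight : ∀ v < n, rank v ≤ rank u →
    (succ v = v ∧ D v = marginal M (off v) (deg v) (cap v)) ∨
    (succ v < n ∧ rank (succ v) < rank v ∧ A v (succ v) = 1 ∧
      D v = W v (succ v) - W (succ v) v + D (succ v))

section Augment

variable {n : ℕ} {W : ℕ → ℕ → K} {M : K} {off : ℕ → K} {deg cap rank succ : ℕ → ℕ}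
  {D : ℕ → K} {A : ℕ → ℕ → ℕ} {u : ℕ}

/-- Arcs on a shortest path are tight, so after an edge has passed from `u` to `succ u`, the
potential inequality for the opposite arc holds with equality. The degrees in `deg` are untouched;
only the location of the excess edge moves. -/
theorem AugmentInv.step (h : AugmentInv n W M off deg cap rank succ D A u) (hu : succ u ≠ u)
    {A' : ℕ → ℕ → ℕ} (hA' : ∀ i < n, ∀ j < n, A' i j =
      if i = succ u ∧ j = u then 1 else if i = u ∧ j = succ u then 0 else A i j) :
    rank (succ u) < rank u ∧
      AugmentInv n W M off deg cap rank succ D A' (succ u) := by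
  have hun := h.lt
  obtain ⟨hy, hr, hAu, hDu⟩ : succ u < n ∧ rank (succ u) < rank u ∧ A u (succ u) = 1 ∧
      D u = W u (succ u) - W (succ u) u + D (succ u) := by
    rcases h.tight u hun le_rfl with h1 | h1
    · exact absurd h1.1 hu
    · exact h1
  generalize hyd : succ u = y at *
  refine ⟨hr, hy, ?_, ⟨?_, h.potential.le, h.potential.ge⟩, ?_, ?_⟩
  · intro i hi j hj
    have h1 := h.orients i hi j hj
    have h2 := h.orients u hun y hy
    rw [if_neg (Ne.symm hu)] at h2
    rw [hA' i hi j hj, hA' j hj i hi]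
    grind
  · intro i hi j hj hij
    rw [hA' i hi j hj] at hij
    split_ifs at hij with h1 h2
    · rw [h1.1, h1.2]
      linarith
    · exact h.potential.arc i hi j hj hij
  · intro v hv
    -- Row `u` loses an entry and row `y` gains one; indicators on both sides avoid truncated
    -- subtraction.
    have h1 : ∑ j ∈ Finset.range n, (A' v j + if v = u ∧ j = y then 1 else 0) =
        ∑ j ∈ Finset.range n, (A v j + if v = y ∧ j = u then 1 else 0) := by
      refine Finset.sum_congr rfl fun j hj => ?_
      rw [Finset.mem_range] at hj
      have h2 := h.orients u hun y hy
      rw [if_neg (Ne.symm hu)] at h2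
      rw [hA' v hv j hj]
      grind
    have h2 : ∀ a b : ℕ, b < n → ∑ j ∈ Finset.range n, (if v = a ∧ j = b then 1 else 0) =
        if v = a then 1 else 0 := by
      intro a b hb
      by_cases hva : v = a
      · simp [hva, hb]
      · simp [hva]
    rw [Finset.sum_add_distrib, Finset.sum_add_distrib, h2 u y hy, h2 y u hun, h.owned v hv] at h1
    lia
  -- The two changed entries do not affect the rest of the path: `u` has larger rank than the
  -- vertices still considered, and rank decreases along `succ`, so none of them points back to `u`.
  · intro v hv hvr
    rcases h.tight v hv (by lia) with h1 | ⟨h1, h2, h3, h4⟩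
    · exact Or.inl h1
    · refine Or.inr ⟨h1, h2, ?_, h4⟩
      rw [hA' v hv _ h1, if_neg (by rintro ⟨-, h5⟩; rw [h5] at h2; lia),
        if_neg (by rintro ⟨h5, -⟩; rw [h5] at hvr; lia), h3]

/-- At the end of the path the distance equals the marginal cost of one more edge. When that edge is
counted, this becomes the marginal cost of the last edge, and the upper bound follows because
marginal costs increase. -/
theorem AugmentInv.finish (h : AugmentInv n W M off deg cap rank succ D A u) (hM : 0 ≤ M)
    (hu : succ u = u) {deg' : ℕ → ℕ} (hd : ∀ v < n, deg' v = if v = u then deg u + 1 else deg v) :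
    Potential n W M off A deg' cap D ∧ ∀ v < n, ∑ j ∈ Finset.range n, A v j = deg' v := by
  have hDu : D u = marginal M (off u) (deg u) (cap u) := by
    rcases h.tight u h.lt le_rfl with h1 | h1
    · exact h1.2
    · rw [hu] at h1
      lia
  refine ⟨⟨h.potential.arc, fun v hv => ?_, fun v hv hpos => ?_⟩, fun v hv => ?_⟩
  · rw [hd v hv]
    split_ifs with hvu
    · rw [hvu, hDu]
      exact marginal_mono hM (by lia)
    · exact h.potential.le v hv
  · rw [hd v hv] at hpos ⊢
    split_ifs at hpos ⊢ with hvu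
    · rw [hvu, hDu, Nat.add_sub_cancel]
    · exact h.potential.ge v hv hpos
  · rw [h.owned v hv, hd v hv]
    split_ifs with hvu
    · rw [hvu]
    · rfl

end Augment

end Orientations

/-! ## The program -/

section Programs

/-- The entry in row `i` and column `j` of an `n × n` matrix that is stored row by row. -/
def mat {β : Type*} (f : ℕ → β) (n i j : ℕ) : β := f (i * n + j)

/-- Row-by-row addresses determine the entry as soon as the column indices are below `n`; no bound
on the rows is needed. -/
theorem mat_update {β : Type*} (f : ℕ → β) {n i j i' j' : ℕ} (v : β) (hj : j < n) (hj' : j' < n) :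
    mat (Function.update f (i * n + j) v) n i' j' = if i' = i ∧ j' = j then v else mat f n i' j' := by
  have h : i' * n + j' = i * n + j ↔ i' = i ∧ j' = j := by
    constructor
    · intro h
      have h1 : (i' * n + j') / n = i' := by
        rw [mul_comm, Nat.mul_add_div (by lia), Nat.div_eq_of_lt hj', add_zero]
      have h2 : (i * n + j) / n = i := by
        rw [mul_comm, Nat.mul_add_div (by lia), Nat.div_eq_of_lt hj, add_zero]
      have h3 : i' = i := by rw [← h1, h, h2]
      subst h3
      exact ⟨rfl, by lia⟩
    · rintro ⟨rfl, rfl⟩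
      rfl
  simp [mat, Function.update_apply, h]

/-- The first cell of an array of natural numbers. -/
def scalar (a : ℕ) : NatExpr := .get a (.const 0)

/-- The address of a matrix entry. -/
def entry (e f : NatExpr) : NatExpr := .add (.mul e (scalar 0)) f

/-- Choose a vertex without final distance for which the reduced distance is least. -/
def selectVertex : Program :=
  -- Memory layout. Natural numbers: 3 orientation, 4 degrees, 5 ranks, 6 successors, 7 capacities,
  -- 12 current vertex, 13 whether `x` wins, 8 to 11 and 14, 15 loop counters. Weights: 2 the
  -- constant `M`, 3 potentials and distances, 4 previous potentials, 5 best cost so far, 6 cost of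
  -- the current orientation, 7 reward for each owned edge (the offset). Arrays 0 to 2 of natural
  -- numbers and 0, 1 of weights hold input and output as prescribed.
  .seq (.setNat 12 (.const 0) (scalar 0))
    (forLoop 11
      (.ite (.and (.natEq (.get 5 (scalar 11)) (.const 0))
          (.not (.and (.not (.natEq (scalar 12) (scalar 0)))
            (.not (.wtLt (.sub (.get 3 (scalar 11)) (.get 4 (scalar 11)))
              (.sub (.get 3 (scalar 12)) (.get 4 (scalar 12))))))))
        (.setNat 12 (.const 0) (scalar 11)) .skip))

/-- The length of a path that starts with the arc to the chosen vertex. -/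
def pathLength : WtExpr :=
  .add (.sub (.get 0 (entry (scalar 11) (scalar 12))) (.get 0 (entry (scalar 12) (scalar 11))))
    (.get 3 (scalar 12))

/-- Update the distances along the arcs to the chosen vertex. -/
def relax : Program :=
  forLoop 11
    (.ite (.and (.and (.natEq (.get 5 (scalar 11)) (.const 0))
        (.natEq (.get 3 (entry (scalar 11) (scalar 12))) (.const 1)))
        (.wtLt pathLength (.get 3 (scalar 11))))
      (.seq (.setWt 3 (scalar 11) pathLength) (.setNat 6 (scalar 11) (scalar 12))) .skip)

/-- The initial distances. -/
def initDistances : Program :=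
  forLoop 11
    (.seq (.setWt 4 (scalar 11) (.get 3 (scalar 11)))
      (.seq (.setNat 5 (scalar 11) (.const 0))
        (.seq (.setNat 6 (scalar 11) (scalar 11))
          (.ite (.natLt (.get 4 (scalar 11)) (.get 7 (scalar 11)))
            (.setWt 3 (scalar 11) (.sub .zero (.get 7 (scalar 11))))
            (.setWt 3 (scalar 11) (.sub (.get 2 (.const 0)) (.get 7 (scalar 11))))))))

/-- Dijkstra's algorithm. -/
def dijkstra : Program :=
  .seq initDistances
    (forLoop 10
      (.seq selectVertex
        (.seq (.setNat 5 (scalar 12) (.add (scalar 10) (.const 1))) relax)))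

/-- Reverse a shortest path. -/
def reversePath : Program :=
  .loop (.not (.natEq (.get 6 (scalar 12)) (scalar 12)))
    (.seq (.setNat 3 (entry (scalar 12) (.get 6 (scalar 12))) (.const 0))
      (.seq (.setNat 3 (entry (.get 6 (scalar 12)) (scalar 12)) (.const 1))
        (.setNat 12 (.const 0) (.get 6 (scalar 12)))))

/-- Restore optimality when the vertex in array `9` owns one edge in excess. -/
def augment : Program :=
  .seq dijkstra
    (.seq (.setNat 12 (.const 0) (scalar 9))
      (.seq reversePath
        (.setNat 4 (scalar 12) (.add (.get 4 (scalar 12)) (.const 1)))))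

/-- Lower the capacity of the vertex in array `9`. -/
def lowerCap : Program :=
  .ite (.natEq (.get 4 (scalar 9)) (.get 7 (scalar 9)))
    (.seq (.setNat 7 (scalar 9) (.sub (.get 7 (scalar 9)) (.const 1)))
      (.seq (.setNat 4 (scalar 9) (.sub (.get 4 (scalar 9)) (.const 1))) augment))
    (.setNat 7 (scalar 9) (.sub (.get 7 (scalar 9)) (.const 1)))

/-- Compute the cost of the current orientation and whether the given alternative wins. -/
def evaluate : Program :=
  .seq (.setWt 6 (.const 0) .zero)
    (.seq (.setNat 13 (.const 0) (.const 1))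
      (forLoop 14
        (.seq (.ite (.natLt (.get 4 (.get 0 (.const 1))) (.get 4 (scalar 14)))
            (.setNat 13 (.const 0) (.const 0)) .skip)
          (forLoop 15
            (.ite (.natEq (.get 3 (entry (scalar 15) (scalar 14))) (.const 1))
              (.setWt 6 (.const 0) (.add (.get 6 (.const 0))
                (.get 0 (entry (scalar 14) (scalar 15))))) .skip)))))

/-- Store the current reversal set. -/
def storeReversal : Program :=
  forLoop 14
    (forLoop 15
      (.setNat 2 (entry (scalar 14) (scalar 15))
        (.mul (.get 1 (entry (scalar 14) (scalar 15)))
          (.get 3 (entry (scalar 15) (scalar 14))))))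

/-- Update the best reversal set. -/
def updateBest : Program :=
  .seq evaluate
    (.ite (.and (.natEq (scalar 13) (.const 1)) (.wtLt (.get 6 (.const 0)) (.get 5 (.const 0))))
      (.seq (.setWt 5 (.const 0) (.get 6 (.const 0))) storeReversal) .skip)

/-- The initial orientation, in which the given alternative owns all its edges. -/
def initOrientation : Program :=
  forLoop 14
    (.seq (.setNat 7 (scalar 14) (scalar 0))
      (forLoop 15
        (.seq
          (.setWt 2 (.const 0) (.add (.get 2 (.const 0))
            (.add (.get 0 (entry (scalar 14) (scalar 15)))
              (.get 0 (entry (scalar 14) (scalar 15))))))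
          (.ite (.and (.not (.natEq (scalar 15) (.get 0 (.const 1))))
              (.not (.and (.not (.natEq (scalar 14) (.get 0 (.const 1))))
                (.not (.natEq (.get 1 (entry (scalar 14) (scalar 15))) (.const 1))))))
            (.seq (.setNat 3 (entry (scalar 14) (scalar 15)) (.const 1))
              (.setNat 4 (scalar 14) (.add (.get 4 (scalar 14)) (.const 1)))) .skip))))

/-- The program that computes the margin of victory. -/
def copelandProgram : Program :=
  .seq initOrientation
    (.seq (.setWt 5 (.const 0) (.get 2 (.const 0)))
      (.seq (.setWt 7 (.get 0 (.const 1)) (.get 2 (.const 0)))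
        (.seq (.setWt 3 (.get 0 (.const 1)) (.sub .zero (.get 2 (.const 0))))
          (.seq (forLoop 8 (.seq (forLoop 9 lowerCap) updateBest))
            (.setWt 1 (.const 0) (.sub .zero (.get 5 (.const 0))))))))

end Programs

/-! ### Correctness of the subroutines: Dijkstra's algorithm, augmentation, lowering of capacities
-/

section Specs

variable {K : Type*} [Field K] [LinearOrder K] [IsStrictOrderedRing K] {sz : K → ℕ}
  {Λ : Limits sz} {s : Memory K} {n : ℕ}

@[simp] theorem scalar_val (a : ℕ) : (scalar a).val s = s.nat a 0 := rfl

@[simp] theorem entry_val (e f : NatExpr) : (entry e f).val s = e.val s * s.nat 0 0 + f.val s := rfl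

/-- Facts about parts of the memory that hold the input and constants. -/
structure Env (Λ : Limits sz) (n a : ℕ) (s : Memory K) : Prop where
  size : s.nat 0 0 = n
  cell : n + 1 ≤ Λ.cell
  -- Room for the distances: a marginal cost has level at most `2 * a`, and each of the `n` rounds
  -- of Dijkstra's algorithm adds an arc cost of level 2.
  lvl : 2 * a + 2 * n ≤ Λ.lvl
  big_nonneg : 0 ≤ s.wt 2 0
  bd_weight : ∀ i < n, ∀ j < n, Λ.bd 1 (mat (s.wt 0) n i j)
  bd_big : Λ.bd a (s.wt 2 0)
  bd_off : ∀ v < n, Λ.bd a (s.wt 7 v)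

theorem Env.congr {a : ℕ} {s' : Memory K} (h : Env Λ n a s) (h0 : s'.nat 0 = s.nat 0)
    (w0 : s'.wt 0 = s.wt 0) (w2 : s'.wt 2 = s.wt 2) (w7 : s'.wt 7 = s.wt 7) : Env Λ n a s' := by
  obtain ⟨h1, h2, h3, h4, h5, h6, h7⟩ := h
  constructor <;> simp_all

theorem selectVertex_spec (hs : Λ.Good s) (hn : s.nat 0 0 = n) (hex : ∃ v < n, s.nat 5 v = 0) :
    WP Λ selectVertex (4 * n + 3) (fun s' => s'.nat 12 0 < n ∧ s.nat 5 (s'.nat 12 0) = 0 ∧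
      ∀ v < n, s.nat 5 v = 0 →
        s.wt 3 (s'.nat 12 0) - s.wt 4 (s'.nat 12 0) ≤ s.wt 3 v - s.wt 4 v) s := by
  unfold selectVertex
  rw [show 4 * n + 3 = 1 + (n * (2 + 2) + 2) by ring]
  refine WP.seq (WP.setNat hs (by simpa using hs.nat 0 0) fun hg => ?_)
  simp only [scalar_val, hn, NatExpr.val] at hg ⊢
  -- The value `n` in array 12 signals that no vertex without final distance has been seen yet.
  refine (WP.forLoop (fun k s' => (s'.nat 12 0 = n ∧ ∀ v < k, s.nat 5 v ≠ 0) ∨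
    (s'.nat 12 0 < n ∧ s.nat 5 (s'.nat 12 0) = 0 ∧ ∀ v < k, s.nat 5 v = 0 →
        s.wt 3 (s'.nat 12 0) - s.wt 4 (s'.nat 12 0) ≤ s.wt 3 v - s.wt 4 v))
    hg (by simp [Memory.setNat_nat, hn]) (by decide) (by decide) (by decide)
    (by simp [Memory.setNat_nat]) ?_).conseq le_rfl ?_
  · intro k hk s' hg' hf hv hI
    have h5 : s'.nat 5 = s.nat 5 := by rw [hf.nat 5 (by decide)]; simp [Memory.setNat_nat]
    have h0 : s'.nat 0 0 = n := by rw [hf.nat 0 (by decide)]; simp [Memory.setNat_nat, hn]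
    have w3 : s'.wt 3 = s.wt 3 := by rw [hf.wt 3 (by decide)]; simp
    have w4 : s'.wt 4 = s.wt 4 := by rw [hf.wt 4 (by decide)]; simp
    refine WP.ite hg' (fun hc => WP.setNat hg' (by simpa using hg'.nat 11 0) fun _ => ?_)
      (fun hc => WP.skip hg' ?_)
    · simp only [Test.Holds, NatExpr.val, WtExpr.val, scalar_val, hv, h5, h0, w3, w4] at hc
      simp only [Memory.setNat_nat, scalar_val, NatExpr.val, hv]
      right
      simp only [Nat.reduceEqDiff, if_true, if_false,
        Function.update_self]
      refine ⟨hk, hc.1, fun v hv' h0v => ?_⟩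
      rcases Nat.lt_succ_iff_lt_or_eq.1 hv' with hlt | rfl
      · rcases hI with hI | hI
        · exact absurd h0v (hI.2 v hlt)
        · have : s.wt 3 k - s.wt 4 k < s.wt 3 (s'.nat 12 0) - s.wt 4 (s'.nat 12 0) := by
            by_contra hcon
            exact hc.2 ⟨hI.1.ne, hcon⟩
          exact this.le.trans (hI.2.2 v hlt h0v)
      · exact le_rfl
    · simp only [Test.Holds, NatExpr.val, WtExpr.val, scalar_val, hv, h5, h0, w3, w4] at hc
      simp only [Memory.setNat_nat, Nat.reduceEqDiff, if_false]
      by_cases h0k : s.nat 5 k = 0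
      · have hc' : s'.nat 12 0 ≠ n ∧ ¬ (s.wt 3 k - s.wt 4 k <
            s.wt 3 (s'.nat 12 0) - s.wt 4 (s'.nat 12 0)) := by
          by_contra hcon
          exact hc ⟨h0k, hcon⟩
        rcases hI with hI | hI
        · exact absurd hI.1 hc'.1
        · refine Or.inr ⟨hI.1, hI.2.1, fun v hv' h0v => ?_⟩
          rcases Nat.lt_succ_iff_lt_or_eq.1 hv' with hlt | rfl
          · exact hI.2.2 v hlt h0v
          · exact not_lt.1 hc'.2
      · rcases hI with hI | hI
        · refine Or.inl ⟨hI.1, fun v hv' => ?_⟩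
          rcases Nat.lt_succ_iff_lt_or_eq.1 hv' with hlt | rfl
          · exact hI.2 v hlt
          · exact h0k
        · refine Or.inr ⟨hI.1, hI.2.1, fun v hv' h0v => ?_⟩
          rcases Nat.lt_succ_iff_lt_or_eq.1 hv' with hlt | rfl
          · exact hI.2.2 v hlt h0v
          · exact absurd h0v h0k
  · rintro s' - - (hI | hI)
    · obtain ⟨v, hv, h0⟩ := hex
      exact absurd h0 (hI.2 v hv)
    · exact hI

theorem relax_spec {a d u : ℕ} (hs : Λ.Good s) (he : Env Λ n a s) (hu : u < n)
    (hsu : s.nat 12 0 = u) (hru : s.nat 5 u ≠ 0) (hD : ∀ v < n, Λ.bd d (s.wt 3 v))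
    (hd : d + 2 ≤ Λ.lvl) :
    WP Λ relax (5 * n + 2) (fun s' =>
      (∀ v < n, s'.wt 3 v = if s.nat 5 v = 0 ∧ mat (s.nat 3) n v u = 1 ∧
          mat (s.wt 0) n v u - mat (s.wt 0) n u v + s.wt 3 u < s.wt 3 v
        then mat (s.wt 0) n v u - mat (s.wt 0) n u v + s.wt 3 u else s.wt 3 v) ∧
      ∀ v < n, s'.nat 6 v = if s.nat 5 v = 0 ∧ mat (s.nat 3) n v u = 1 ∧
          mat (s.wt 0) n v u - mat (s.wt 0) n u v + s.wt 3 u < s.wt 3 v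
        then u else s.nat 6 v) s := by
  unfold relax
  rw [show 5 * n + 2 = n * (3 + 2) + 2 by ring]
  set c : ℕ → Prop := fun v => s.nat 5 v = 0 ∧ mat (s.nat 3) n v u = 1 ∧
    mat (s.wt 0) n v u - mat (s.wt 0) n u v + s.wt 3 u < s.wt 3 v with hc
  refine (WP.forLoop (fun k s' =>
      (∀ v, s'.wt 3 v = if v < k ∧ c v
        then mat (s.wt 0) n v u - mat (s.wt 0) n u v + s.wt 3 u else s.wt 3 v) ∧
      ∀ v, s'.nat 6 v = if v < k ∧ c v then u else s.nat 6 v) hs he.size (by decide) (by decide)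
      (by decide) (by simp [Memory.setNat_nat]) ?_).conseq le_rfl ?_
  · intro k hk s' hg' hf hv ⟨hI1, hI2⟩
    have n0 : s'.nat 0 0 = n := by rw [hf.nat 0 (by decide), he.size]
    have n3 : s'.nat 3 = s.nat 3 := hf.nat 3 (by decide)
    have n5 : s'.nat 5 = s.nat 5 := hf.nat 5 (by decide)
    have n12 : s'.nat 12 0 = u := by rw [hf.nat 12 (by decide), hsu]
    have w0 : s'.wt 0 = s.wt 0 := hf.wt 0 (by decide)
    -- The chosen vertex already has a nonzero rank, so the loop never changes its own distance.
    have hDu : s'.wt 3 u = s.wt 3 u := by rw [hI1, if_neg (by tauto)]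
    have hDk : s'.wt 3 k = s.wt 3 k := by rw [hI1, if_neg (by simp)]
    have hval : pathLength.val s' = mat (s.wt 0) n k u - mat (s.wt 0) n u k + s.wt 3 u := by
      simp only [pathLength, WtExpr.val, entry_val, scalar_val, hv, n12, n0, w0, mat, hDu]
    refine WP.ite hg' (fun ht => ?_) (fun ht => WP.skip hg' ?_)
    · have hck : c k := by
        simp only [Test.Holds, NatExpr.val, WtExpr.val, hval, scalar_val, entry_val, hv, n5, n3,
          n12, n0, hDk, and_assoc] at ht
        exact ht
      rw [show 2 = 1 + 1 from rfl]
      refine WP.seq (WP.setWt hg' ?_ fun hg1 => WP.setNat hg1 ?_ fun _ => ⟨fun v => ?_, fun v => ?_⟩)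
      · rw [hval, show (mat (s.wt 0) n k u - mat (s.wt 0) n u k + s.wt 3 u) =
          (mat (s.wt 0) n k u - mat (s.wt 0) n u k) + s.wt 3 u from rfl]
        exact Λ.bd_mono (by lia) (Λ.bd_add (Λ.bd_sub (he.bd_weight k hk u hu)
          (he.bd_weight u hu k hk)) (hD u hu))
      · simpa using hg1.nat 12 0
      · rw [hval]
        simp only [scalar_val, hv, Memory.setNat_wt, Memory.setWt_wt, if_true,
          Function.update_apply, hI1 v]
        grind
      · simp only [scalar_val, hv, n12, Memory.setNat_nat, Memory.setWt_nat, if_true,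
          Nat.reduceEqDiff, if_false, Function.update_apply, hI2 v]
        grind
    · have hck : ¬ c k := by
        simp only [Test.Holds, NatExpr.val, WtExpr.val, hval, scalar_val, entry_val, hv, n5, n3,
          n12, n0, hDk, and_assoc] at ht
        exact ht
      simp only [Memory.setNat_nat, Memory.setNat_wt, Nat.reduceEqDiff, if_false, hI1, hI2]
      grind
  · rintro s' - - ⟨h1, h2⟩
    refine ⟨fun v hv => ?_, fun v hv => ?_⟩
    · simp only [h1, hv, true_and, hc]
    · simp only [h2, hv, true_and, hc]

theorem marginal_bd {a d c : ℕ} {M o : K} (hM : Λ.bd a M) (ho : Λ.bd a o) :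
    Λ.bd (2 * a) (marginal M o d c) := by
  unfold marginal
  rw [two_mul]
  refine Λ.bd_sub ?_ ho
  split_ifs
  · exact Λ.bd_mono (Nat.zero_le _) Λ.bd_zero
  · exact hM

theorem initDistances_spec {a : ℕ} (hs : Λ.Good s) (he : Env Λ n a s) :
    WP Λ initDistances (7 * n + 2) (fun s' => ∀ v < n, s'.wt 4 v = s.wt 3 v ∧ s'.nat 5 v = 0 ∧
      s'.nat 6 v = v ∧ s'.wt 3 v = marginal (s.wt 2 0) (s.wt 7 v) (s.nat 4 v) (s.nat 7 v)) s := by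
  unfold initDistances
  rw [show 7 * n + 2 = n * ((1 + (1 + (1 + (1 + 1)))) + 2) + 2 by ring]
  refine (WP.forLoop (fun k s' => (∀ v < k, s'.wt 4 v = s.wt 3 v ∧ s'.nat 5 v = 0 ∧
      s'.nat 6 v = v ∧ s'.wt 3 v = marginal (s.wt 2 0) (s.wt 7 v) (s.nat 4 v) (s.nat 7 v)) ∧
      ∀ v, k ≤ v → s'.wt 3 v = s.wt 3 v) hs he.size (by decide) (by decide)
      (by decide) (by simp) ?_).conseq le_rfl fun s' _ _ h => h.1
  intro k hk s' hg hf hv ⟨hI1, hI2⟩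
  have n4 : s'.nat 4 = s.nat 4 := hf.nat 4 (by decide)
  have n7 : s'.nat 7 = s.nat 7 := hf.nat 7 (by decide)
  have w2 : s'.wt 2 = s.wt 2 := hf.wt 2 (by decide)
  have w7 : s'.wt 7 = s.wt 7 := hf.wt 7 (by decide)
  have hbd := marginal_bd (Λ := Λ) (d := s.nat 4 k) (c := s.nat 7 k) he.bd_big (he.bd_off k hk)
  have hlvl := he.lvl
  refine WP.seq (b := 1) (b' := 4)
    (WP.setWt hg (by simpa [WtExpr.val] using hg.wt _ _) fun hg1 => ?_)
  refine WP.seq (b := 1) (b' := 3) (WP.setNat (e := .const 0) hg1 (Nat.zero_le _) fun hg2 => ?_)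
  refine WP.seq (b := 1) (b' := 2) (WP.setNat hg2 (by simpa using hg2.nat _ _) fun hg3 => ?_)
  have hI2k := hI2 k le_rfl
  refine WP.ite hg3 (fun hc => WP.setWt hg3 ?_ fun _ => ?_) (fun hc => WP.setWt hg3 ?_ fun _ => ?_)
  all_goals
    simp only [Test.Holds, NatExpr.val, WtExpr.val, scalar_val, hv, Memory.setNat_nat,
      Memory.setWt_nat, Memory.setNat_wt, Memory.setWt_wt, Nat.reduceEqDiff, if_false, if_true, n4,
      n7, w2, w7, hI2k] at hc ⊢
  · rw [marginal, if_pos hc] at hbd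
    exact Λ.bd_mono (by lia) hbd
  · refine ⟨fun v hvk => ?_, fun v hvk => ?_⟩
    · rcases Nat.lt_succ_iff_lt_or_eq.1 hvk with hlt | rfl
      · simpa [hlt.ne] using hI1 v hlt
      · simp [marginal, hc]
    · rw [Function.update_of_ne (by lia)]
      exact hI2 v (by lia)
  · rw [marginal, if_neg hc] at hbd
    exact Λ.bd_mono (by lia) hbd
  · refine ⟨fun v hvk => ?_, fun v hvk => ?_⟩
    · rcases Nat.lt_succ_iff_lt_or_eq.1 hvk with hlt | rfl
      · simpa [hlt.ne] using hI1 v hlt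
      · simp [marginal, hc]
    · rw [Function.update_of_ne (by lia)]
      exact hI2 v (by lia)

/-- The distances that Dijkstra's algorithm computes start from the marginal costs. -/
theorem dijkstra_spec {a : ℕ} (hs : Λ.Good s) (he : Env Λ n a s)
    (hp : Potential n (mat (s.wt 0) n) (s.wt 2 0) (s.wt 7) (mat (s.nat 3) n) (s.nat 4) (s.nat 7)
      (s.wt 3)) :
    WP Λ dijkstra (7 * n + 2 + (n * (9 * n + 8) + 2)) (fun s' =>
      DijkstraInv n (fun i j => mat (s.wt 0) n i j - mat (s.wt 0) n j i) (mat (s.nat 3) n)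
        (fun v => marginal (s.wt 2 0) (s.wt 7 v) (s.nat 4 v) (s.nat 7 v)) (s.wt 3) n
        (s'.nat 5) (s'.nat 6) (s'.wt 3)) s := by
  unfold dijkstra
  refine WP.seq ((initDistances_spec hs he).conseq le_rfl ?_)
  intro s₁ hg₁ hf₁ h₁
  have he₁ : Env Λ n a s₁ := he.congr (hf₁.nat 0 (by decide)) (hf₁.wt 0 (by decide))
    (hf₁.wt 2 (by decide)) (hf₁.wt 7 (by decide))
  have n3 : s₁.nat 3 = s.nat 3 := hf₁.nat 3 (by decide)
  have w0 : s₁.wt 0 = s.wt 0 := hf₁.wt 0 (by decide)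
  rw [show n * (9 * n + 8) = n * (4 * n + 3 + (1 + (5 * n + 2)) + 2) by ring]
  -- The level of the distances after `r` rounds depends only on `a` and `r`, and not on the
  -- previous potentials; so levels do not accumulate over successive runs.
  refine (WP.forLoop (fun r s' =>
    DijkstraInv n (fun i j => mat (s.wt 0) n i j - mat (s.wt 0) n j i) (mat (s.nat 3) n)
        (fun v => marginal (s.wt 2 0) (s.wt 7 v) (s.nat 4 v) (s.nat 7 v)) (s.wt 3) r
        (s'.nat 5) (s'.nat 6) (s'.wt 3) ∧ ∀ v < n, Λ.bd (2 * a + 2 * r) (s'.wt 3 v)) hg₁ he₁.size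
    (by decide) (by decide) (by decide) ⟨DijkstraInv.init hp.le ?_ ?_ ?_, ?_⟩ ?_).conseq le_rfl
    fun _ _ _ h => h.1
  · intro v hv
    simpa [Memory.setNat_nat] using (h₁ v hv).2.1
  · intro v hv
    simpa [Memory.setNat_nat] using (h₁ v hv).2.2.1
  · intro v hv
    simpa [Memory.setNat_nat] using (h₁ v hv).2.2.2
  · intro v hv
    rw [Memory.setNat_wt, (h₁ v hv).2.2.2]
    exact marginal_bd he.bd_big (he.bd_off v hv)
  · intro r hr s₂ hg₂ hf₂ hv₂ ⟨hI, hbd⟩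
    have n0' : s₂.nat 0 = s₁.nat 0 := hf₂.nat 0 (by decide)
    have n3' : s₂.nat 3 = s.nat 3 := by rw [hf₂.nat 3 (by decide), n3]
    have w0' : s₂.wt 0 = s.wt 0 := by rw [hf₂.wt 0 (by decide), w0]
    have w4' : s₂.wt 4 = s₁.wt 4 := hf₂.wt 4 (by decide)
    have he₂ : Env Λ n a s₂ := he₁.congr n0' (hf₂.wt 0 (by decide))
      (hf₂.wt 2 (by decide)) (hf₂.wt 7 (by decide))
    refine WP.seq ((selectVertex_spec hg₂ he₂.size (hI.exists_rank_eq_zero hr)).conseq le_rfl ?_)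
    rintro s₃ hg₃ hf₃ ⟨hu, hu0, hmin⟩
    generalize hud : s₃.nat 12 0 = u at *
    have n5 : s₃.nat 5 = s₂.nat 5 := hf₃.nat 5 (by decide)
    have n10 : s₃.nat 10 0 = r := by rw [hf₃.nat 10 (by decide), hv₂]
    have w3 : s₃.wt 3 = s₂.wt 3 := hf₃.wt 3 (by decide)
    have hcell := he.cell
    refine WP.seq (WP.setNat hg₃ (by simp [NatExpr.val, n10]; lia) fun hg₄ => ?_)
    simp only [scalar_val, NatExpr.val, n10, hud] at hg₄ ⊢
    generalize hs₄ : s₃.setNat 5 u (r + 1) = s₄ at *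
    have n5' : s₄.nat 5 = Function.update (s₂.nat 5) u (r + 1) := by
      simp [← hs₄, Memory.setNat_nat, n5]
    have n3'' : s₄.nat 3 = s.nat 3 := by
      simp [← hs₄, Memory.setNat_nat, hf₃.nat 3 (by decide), n3']
    have n6 : s₄.nat 6 = s₂.nat 6 := by
      simp [← hs₄, Memory.setNat_nat, hf₃.nat 6 (by decide)]
    have w3' : s₄.wt 3 = s₂.wt 3 := by simp [← hs₄, w3]
    have w0'' : s₄.wt 0 = s.wt 0 := by simp [← hs₄, hf₃.wt 0 (by decide), w0']
    have he₄ : Env Λ n a s₄ := he₂.congr (by simp [← hs₄, Memory.setNat_nat, hf₃.nat 0 (by decide)])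
      (by rw [w0'', w0']) (by simp [← hs₄, hf₃.wt 2 (by decide)])
      (by simp [← hs₄, hf₃.wt 7 (by decide)])
    have hlvl := he.lvl
    refine (relax_spec (d := 2 * a + 2 * r) hg₄ he₄ hu (by simp [← hs₄, Memory.setNat_nat, hud])
      (by simp [n5']) (by rwa [w3']) (by lia)).conseq le_rfl ?_
    rintro s₅ hg₅ hf₅ ⟨hD, hS⟩
    have n5'' : s₅.nat 5 = s₄.nat 5 := hf₅.nat 5 (by decide)
    rw [← n5''] at hD hS
    rw [n3'', w0'', w3'] at hD hS
    rw [n6] at hS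
    refine ⟨?_, fun v hv => ?_⟩
    · simp only [Memory.setNat_nat, Memory.setNat_wt, Nat.reduceEqDiff, if_false]
      refine hI.step (fun i hi j hj hij => hp.arc i hi j hj hij) hu hu0 ?_ ?_ hD hS
      · intro v hv h0
        have := hmin v hv h0
        rwa [w4', (h₁ v hv).1, (h₁ u hu).1] at this
      · intro v
        rw [n5'', n5', Function.update_apply]
    · rw [Memory.setNat_wt, hD v hv]
      split_ifs
      · rw [show 2 * a + 2 * (r + 1) = 1 + 1 + (2 * a + 2 * r) by ring]
        refine Λ.bd_add (Λ.bd_sub ?_ ?_) (hbd u hu)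
        · rw [← w0'']; exact he₄.bd_weight v hv u hu
        · rw [← w0'']; exact he₄.bd_weight u hu v hv
      · exact Λ.bd_mono (by lia) (hbd v hv)

/-- The rank of the current vertex strictly decreases and is at most `n` at the start. Each pass
consists of three assignments and a test. -/
theorem reversePath_spec (hs : Λ.Good s) (hn : s.nat 0 0 = n) (hcell : 1 ≤ Λ.cell)
    {W : ℕ → ℕ → K} {M : K} {off D : ℕ → K} {deg cap : ℕ → ℕ} (hr : ∀ v < n, s.nat 5 v ≤ n)
    (hI : AugmentInv n W M off deg cap (s.nat 5) (s.nat 6) D (mat (s.nat 3) n) (s.nat 12 0)) :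
    WP Λ reversePath (4 * n + 1) (fun s' =>
      AugmentInv n W M off deg cap (s.nat 5) (s.nat 6) D (mat (s'.nat 3) n) (s'.nat 12 0) ∧
        s.nat 6 (s'.nat 12 0) = s'.nat 12 0) s := by
  unfold reversePath
  refine (WP.loop (b := 1 + (1 + 1)) (fun d s' => s.nat 5 (s'.nat 12 0) = d ∧
    AugmentInv n W M off deg cap (s.nat 5) (s.nat 6) D (mat (s'.nat 3) n) (s'.nat 12 0))
    ?_ _ hs ⟨rfl, hI⟩).conseq ?_ ?_
  · rintro d s' hg hf ⟨hd, hI⟩ hc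
    have n0 : s'.nat 0 0 = n := by rw [hf.nat 0 (by decide), hn]
    have n6 : s'.nat 6 = s.nat 6 := hf.nat 6 (by decide)
    have hu := hI.lt
    generalize hud : s'.nat 12 0 = u at *
    simp only [Test.Holds, NatExpr.val, scalar_val, hud, n6] at hc
    refine WP.seq (WP.setNat (e := .const 0) hg (Nat.zero_le _) fun hg1 => ?_)
    refine WP.seq (WP.setNat (e := .const 1) hg1 hcell fun hg2 => ?_)
    refine WP.setNat hg2 (by simpa [NatExpr.val] using hg2.nat _ _) fun hg3 => ?_
    simp only [NatExpr.val, scalar_val, entry_val, Memory.setNat_nat, Nat.reduceEqDiff, if_false,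
      if_true, OfNat.zero_ne_ofNat, n0, hud, n6, Function.update_self]
    have hy : s.nat 6 u < n := by
      rcases hI.tight u hu le_rfl with h | h
      · rw [h.1]; exact hu
      · exact h.1
    obtain ⟨h1, h2⟩ := hI.step hc (A' := mat (Function.update (Function.update (s'.nat 3)
      (u * n + s.nat 6 u) 0) (s.nat 6 u * n + u) 1) n) (fun i hi j hj => by
        rw [mat_update _ _ hu hj, mat_update _ _ hy hj])
    exact ⟨_, hd ▸ h1, rfl, h2⟩
  · have := hr _ hI.lt
    nlinarith
  · rintro s' hg hf ⟨⟨d, -, h⟩, hc⟩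
    have n6 : s'.nat 6 = s.nat 6 := hf.nat 6 (by decide)
    refine ⟨h, ?_⟩
    simpa [Test.Holds, NatExpr.val, n6] using hc

/-- The memory holds an optimal orientation. -/
structure Optimal (n : ℕ) (s : Memory K) : Prop where
  orients : Orients n (mat (s.nat 3) n)
  potential : Potential n (mat (s.wt 0) n) (s.wt 2 0) (s.wt 7) (mat (s.nat 3) n) (s.nat 4) (s.nat 7)
    (s.wt 3)
  owned : ∀ v < n, ∑ j ∈ Finset.range n, mat (s.nat 3) n v j = s.nat 4 v

/-- The degree array does not count the excess edge of `l`, so the distance of `l` is the cheapest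
way to place that edge, `l` itself included. Distances satisfy the arc and upper bounds of a
potential by construction, and the lower bounds because they are at least the old potentials. -/
theorem augment_spec {a l : ℕ} (hs : Λ.Good s) (he : Env Λ n a s) (hl : l < n)
    (hsl : s.nat 9 0 = l) (ho : Orients n (mat (s.nat 3) n))
    (hp : Potential n (mat (s.wt 0) n) (s.wt 2 0) (s.wt 7) (mat (s.nat 3) n) (s.nat 4) (s.nat 7)
      (s.wt 3))
    (hd : ∀ v < n, ∑ j ∈ Finset.range n, mat (s.nat 3) n v j = s.nat 4 v + if v = l then 1 else 0) :
    WP Λ augment (9 * n * n + 19 * n + 7) (fun s' => Optimal n s') s := by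
  unfold augment
  rw [show 9 * n * n + 19 * n + 7 =
    (7 * n + 2 + (n * (9 * n + 8) + 2)) + (1 + ((4 * n + 1) + 1)) by ring]
  refine WP.seq ((dijkstra_spec hs he hp).conseq le_rfl ?_)
  intro s₁ hg₁ hf₁ h₁
  refine WP.seq (WP.setNat hg₁ (by simpa using hg₁.nat _ _) fun hg₂ => ?_)
  simp only [NatExpr.val, scalar_val, hf₁.nat 9 (by decide), hsl] at hg₂ ⊢
  generalize hs₂ : s₁.setNat 12 0 l = s₂ at *
  have n0 : s₂.nat 0 0 = n := by simp [← hs₂, Memory.setNat_nat, hf₁.nat 0 (by decide), he.size]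
  have n3 : s₂.nat 3 = s.nat 3 := by simp [← hs₂, Memory.setNat_nat, hf₁.nat 3 (by decide)]
  have n4 : s₂.nat 4 = s.nat 4 := by simp [← hs₂, Memory.setNat_nat, hf₁.nat 4 (by decide)]
  have n5 : s₂.nat 5 = s₁.nat 5 := by simp [← hs₂, Memory.setNat_nat]
  have n6 : s₂.nat 6 = s₁.nat 6 := by simp [← hs₂, Memory.setNat_nat]
  have n7 : s₂.nat 7 = s.nat 7 := by simp [← hs₂, Memory.setNat_nat, hf₁.nat 7 (by decide)]
  have n12 : s₂.nat 12 0 = l := by simp [← hs₂, Memory.setNat_nat]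
  have w0 : s₂.wt 0 = s.wt 0 := by simp [← hs₂, hf₁.wt 0 (by decide)]
  have w2 : s₂.wt 2 = s.wt 2 := by simp [← hs₂, hf₁.wt 2 (by decide)]
  have w3 : s₂.wt 3 = s₁.wt 3 := by simp [← hs₂]
  have w7 : s₂.wt 7 = s.wt 7 := by simp [← hs₂, hf₁.wt 7 (by decide)]
  have hrank := h₁.rank_ne_zero
  have hcell := he.cell
  have hI : AugmentInv n (mat (s.wt 0) n) (s.wt 2 0) (s.wt 7) (s.nat 4) (s.nat 7) (s₂.nat 5)
      (s₂.nat 6) (s₁.wt 3) (mat (s₂.nat 3) n) (s₂.nat 12 0) := by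
    rw [n12, n3, n5, n6]
    refine ⟨hl, ho, ⟨fun i hi j hj hij => h₁.arc i hi j hj (hrank j hj) hij, h₁.le, fun v hv hpos =>
      (hp.ge v hv hpos).trans (h₁.ge v hv)⟩, hd, fun v hv _ => ?_⟩
    rcases h₁.tight v hv with h | ⟨h, -, h', h''⟩
    · exact Or.inl h
    · exact Or.inr ⟨h, h'.resolve_left (hrank v hv), h''⟩
  refine WP.seq ((reversePath_spec hg₂ n0 (by lia) (fun v hv => by
    rw [n5]; exact h₁.rank_le v hv) hI).conseq le_rfl ?_)
  rintro s₃ hg₃ hf₃ ⟨hI₃, hu⟩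
  have m4 : s₃.nat 4 = s.nat 4 := by rw [hf₃.nat 4 (by decide), n4]
  have m7 : s₃.nat 7 = s.nat 7 := by rw [hf₃.nat 7 (by decide), n7]
  have v0 : s₃.wt 0 = s.wt 0 := by rw [hf₃.wt 0 (by decide), w0]
  have v2 : s₃.wt 2 = s.wt 2 := by rw [hf₃.wt 2 (by decide), w2]
  have v3 : s₃.wt 3 = s₁.wt 3 := by rw [hf₃.wt 3 (by decide), w3]
  have v7 : s₃.wt 7 = s.wt 7 := by rw [hf₃.wt 7 (by decide), w7]
  have hle := hI₃.orients.sum_le hI₃.lt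
  rw [hI₃.owned _ hI₃.lt, if_pos rfl] at hle
  refine WP.setNat (b := 0) hg₃ (by simp only [NatExpr.val, scalar_val, m4]; lia) fun hg₄ => ?_
  simp only [NatExpr.val, scalar_val, m4]
  obtain ⟨h2, h3⟩ := hI₃.finish he.big_nonneg hu (deg' := Function.update (s.nat 4) (s₃.nat 12 0)
    (s.nat 4 (s₃.nat 12 0) + 1)) (fun v _ => by rw [Function.update_apply])
  constructor
  · simpa [Memory.setNat_nat] using hI₃.orients
  · simpa [Memory.setNat_nat, m4, m7, v0, v2, v3, v7] using h2
  · simpa [Memory.setNat_nat, m4] using h3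

theorem lowerCap_spec {a l : ℕ} (hs : Λ.Good s) (he : Env Λ n a s) (hl : l < n)
    (hsl : s.nat 9 0 = l) (ho : Optimal n s) (hcap : 0 < s.nat 7 l) :
    WP Λ lowerCap (9 * n * n + 19 * n + 10) (fun s' => Optimal n s' ∧
      s'.nat 7 = Function.update (s.nat 7) l (s.nat 7 l - 1)) s := by
  unfold lowerCap
  rw [show 9 * n * n + 19 * n + 10 = 1 + (1 + (9 * n * n + 19 * n + 7)) + 1 by ring]
  refine WP.ite hs (fun hc => ?_) (fun hc => ?_)
  · simp only [Test.Holds, NatExpr.val, scalar_val, hsl] at hc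
    refine WP.seq (WP.setNat hs ((Nat.sub_le _ _).trans (hs.nat _ _)) fun hg₁ => ?_)
    refine WP.seq (WP.setNat hg₁ ((Nat.sub_le _ _).trans (hg₁.nat _ _)) fun hg₂ => ?_)
    simp only [NatExpr.val, scalar_val, hsl, Memory.setNat_nat, Nat.reduceEqDiff, if_false] at hg₂ ⊢
    generalize hs₂ : (s.setNat 7 l (s.nat 7 l - 1)).setNat 4 l (s.nat 4 l - 1) = s₂ at *
    have n0 : s₂.nat 0 = s.nat 0 := by simp [← hs₂, Memory.setNat_nat]
    have n9 : s₂.nat 9 0 = l := by simp [← hs₂, Memory.setNat_nat, hsl]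
    have n3 : s₂.nat 3 = s.nat 3 := by simp [← hs₂, Memory.setNat_nat]
    have n4 : s₂.nat 4 = Function.update (s.nat 4) l (s.nat 4 l - 1) := by
      simp [← hs₂, Memory.setNat_nat]
    have n7 : s₂.nat 7 = Function.update (s.nat 7) l (s.nat 7 l - 1) := by
      simp [← hs₂, Memory.setNat_nat]
    have w : s₂.wt = s.wt := by simp [← hs₂]
    refine (augment_spec (a := a) hg₂ (he.congr n0 (by rw [w]) (by rw [w]) (by rw [w])) hl n9
      (by rw [n3]; exact ho.orients) ?_ fun v hv => ?_).conseq le_rfl fun s' _ hf h =>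
        ⟨h, by rw [hf.nat 7 (by decide), n7]⟩
    · rw [w, n3]
      refine ho.potential.lower_saturated hc hcap (fun v => ?_) fun v => ?_
      · rw [n7, Function.update_apply]
      · rw [n4, Function.update_apply]
    · rw [n3, n4, ho.owned v hv, Function.update_apply]
      split_ifs with h
      · subst h; lia
      · rfl
  · simp only [Test.Holds, NatExpr.val, scalar_val, hsl] at hc
    refine (WP.setNat (b := 0) hs ((Nat.sub_le _ _).trans (hs.nat _ _)) fun hg₁ => ?_).conseq
      (by lia) fun _ _ _ h => h
    simp only [NatExpr.val, scalar_val, hsl]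
    refine ⟨⟨?_, ?_, ?_⟩, by simp [Memory.setNat_nat]⟩
    · simpa [Memory.setNat_nat] using ho.orients
    · have := ho.potential.lower he.big_nonneg hc
        (cap' := Function.update (s.nat 7) l (s.nat 7 l - 1)) (fun v => Function.update_apply ..)
      simpa [Memory.setNat_nat] using this
    · simpa [Memory.setNat_nat] using ho.owned

/-- Lower all capacities from `c + 1` to `c`. -/
theorem lowerCaps_spec {a c : ℕ} (hs : Λ.Good s) (he : Env Λ n a s) (ho : Optimal n s)
    (hcap : ∀ v < n, s.nat 7 v = c + 1) :
    WP Λ (forLoop 9 lowerCap) (n * (9 * n * n + 19 * n + 12) + 2) (fun s' => Optimal n s' ∧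
      ∀ v < n, s'.nat 7 v = c) s := by
  rw [show n * (9 * n * n + 19 * n + 12) + 2 = n * (9 * n * n + 19 * n + 10 + 2) + 2 by ring]
  have hset : ∀ {s : Memory K} {k : ℕ}, Optimal n s → Optimal n (s.setNat 9 0 k) := by
    rintro s k ⟨h1, h2, h3⟩
    constructor <;> simpa [Memory.setNat_nat]
  refine (WP.forLoop (fun k s' => Optimal n s' ∧ ∀ v < n, s'.nat 7 v = if v < k then c else c + 1)
    hs he.size (by decide) (by decide) (by decide) ⟨hset ho, ?_⟩ ?_).conseq le_rfl
    fun s' _ _ h => ⟨h.1, fun v hv => by rw [h.2 v hv, if_pos hv]⟩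
  · simpa [Memory.setNat_nat] using hcap
  · rintro k hk s' hg hf hv ⟨hI, hc⟩
    have hck : s'.nat 7 k = c + 1 := by rw [hc k hk, if_neg (by simp)]
    refine (lowerCap_spec (a := a) hg (he.congr (hf.nat 0 (by decide)) (hf.wt 0 (by decide))
      (hf.wt 2 (by decide)) (hf.wt 7 (by decide))) hk hv hI (by lia)).conseq le_rfl ?_
    rintro s'' hg' hf' ⟨h1, h2⟩
    refine ⟨hset h1, fun v hv => ?_⟩
    simp only [Memory.setNat_nat, Nat.reduceEqDiff, if_false, h2, Function.update_apply, hck,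
      hc v hv]
    grind

end Specs

/-! ### Correctness of the initialisation, the evaluation and the main loop -/

section MainSpecs

variable {K : Type*} [Field K] [LinearOrder K] [IsStrictOrderedRing K] {sz : K → ℕ}
  {Λ : Limits sz} {s : Memory K} {n : ℕ}

theorem Orients.le_one {A : ℕ → ℕ → ℕ} (h : Orients n A) {i j : ℕ} (hi : i < n) (hj : j < n) :
    A i j ≤ 1 := by
  have := h i hi j hj
  split_ifs at this <;> lia

theorem Orients.sum_lt {A : ℕ → ℕ → ℕ} (h : Orients n A) {i : ℕ} (hi : i < n) :
    ∑ j ∈ Finset.range n, A i j < n := by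
  calc ∑ j ∈ Finset.range n, A i j < ∑ j ∈ Finset.range n, 1 :=
        Finset.sum_lt_sum (fun j hj => h.le_one hi (Finset.mem_range.1 hj))
          ⟨i, Finset.mem_range.2 hi, by have := h i hi i hi; rw [if_pos rfl] at this; lia⟩
    _ = n := by simp

theorem evaluate_spec {a x : ℕ} (hs : Λ.Good s) (he : Env Λ n a s) (hx : s.nat 0 1 = x)
    (hlvl : n * n ≤ Λ.lvl) (hA : Orients n (mat (s.nat 3) n)) :
    WP Λ evaluate (n * (4 * n + 6) + 4) (fun s' =>
      s'.wt 6 0 = reversalCost n (mat (s.wt 0) n) (mat (s.nat 3) n) ∧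
      (s'.nat 13 0 = 1 ↔ ∀ v < n, s.nat 4 v ≤ s.nat 4 x)) s := by
  unfold evaluate
  have hcell := he.cell
  rw [show n * (4 * n + 6) + 4 = 1 + (1 + (n * ((1 + 1) + (n * (2 + 2) + 2) + 2) + 2)) by ring]
  refine WP.seq (WP.setWt (e := .zero) hs (Λ.bd_mono (Nat.zero_le _) Λ.bd_zero) fun hg₁ => ?_)
  refine WP.seq (WP.setNat (e := .const 1) hg₁ (by simp only [NatExpr.val]; lia) fun hg₂ => ?_)
  simp only [NatExpr.val, WtExpr.val] at hg₂ ⊢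
  refine (WP.forLoop (fun k s' =>
    (s'.wt 6 0 = ∑ i ∈ Finset.range k, ∑ j ∈ Finset.range n,
      ((mat (s.nat 3) n j i : ℕ) : K) * mat (s.wt 0) n i j) ∧ Λ.bd (k * n) (s'.wt 6 0) ∧
    (s'.nat 13 0 = 1 ↔ ∀ v < k, s.nat 4 v ≤ s.nat 4 x)) hg₂
    (by simp [Memory.setNat_nat, he.size]) (by decide) (by decide) (by decide) ?_ ?_).conseq le_rfl
    fun _ _ _ h => ⟨h.1, h.2.2⟩
  · simp [Memory.setNat_nat, Memory.setWt_wt, Λ.bd_zero]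
  · rintro k hk s₃ hg₃ hf₃ hv₃ ⟨h1, h2, h3⟩
    have n0 : s₃.nat 0 = s.nat 0 := by rw [hf₃.nat 0 (by decide)]; simp [Memory.setNat_nat]
    have n3 : s₃.nat 3 = s.nat 3 := by rw [hf₃.nat 3 (by decide)]; simp [Memory.setNat_nat]
    have n4 : s₃.nat 4 = s.nat 4 := by rw [hf₃.nat 4 (by decide)]; simp [Memory.setNat_nat]
    have w0 : s₃.wt 0 = s.wt 0 := by rw [hf₃.wt 0 (by decide)]; simp [Memory.setWt_wt]
    refine WP.seq (WP.conseq (Q := fun s' => s'.nat 13 0 = 1 ↔ ∀ v < k + 1, s.nat 4 v ≤ s.nat 4 x)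
      (WP.ite (b := 1) hg₃ (fun hc => WP.setNat (e := .const 0) hg₃ (Nat.zero_le _) fun _ => ?_)
        (fun hc => WP.skip hg₃ ?_)) le_rfl ?_)
    · simp only [Test.Holds, NatExpr.val, scalar_val, n4, n0, hx, hv₃] at hc
      simp only [Memory.setNat_nat, if_true, NatExpr.val, Function.update_self, zero_ne_one,
        false_iff]
      intro h
      exact absurd (h k (by lia)) (by lia)
    · simp only [Test.Holds, NatExpr.val, scalar_val, n4, n0, hx, hv₃] at hc
      rw [h3]
      refine ⟨fun h v hv => ?_, fun h v hv => h v (by lia)⟩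
      rcases Nat.lt_succ_iff_lt_or_eq.1 hv with hlt | rfl
      · exact h v hlt
      · lia
    · intro s₄ hg₄ hf₄ h4
      have n0' : s₄.nat 0 = s.nat 0 := by rw [hf₄.nat 0 (by decide), n0]
      have n3' : s₄.nat 3 = s.nat 3 := by rw [hf₄.nat 3 (by decide), n3]
      have n14' : s₄.nat 14 0 = k := by rw [hf₄.nat 14 (by decide), hv₃]
      have w0' : s₄.wt 0 = s.wt 0 := by rw [hf₄.wt 0 (by decide), w0]
      have w6' : s₄.wt 6 = s₃.wt 6 := by rw [hf₄.wt 6 (by decide)]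
      refine (WP.forLoop (fun l s' => s'.wt 6 0 = s₃.wt 6 0 + ∑ j ∈ Finset.range l,
        ((mat (s.nat 3) n j k : ℕ) : K) * mat (s.wt 0) n k j ∧ Λ.bd (k * n + l) (s'.wt 6 0)) hg₄
        (by rw [n0', he.size]) (by decide) (by decide) (by decide) ?_ ?_).conseq le_rfl ?_
      · simp [w6', h2]
      · rintro l hl s₅ hg₅ hf₅ hv₅ ⟨h5, h6⟩
        have n0 : s₅.nat 0 0 = n := by rw [hf₅.nat 0 (by decide), n0', he.size]
        have n3 : s₅.nat 3 = s.nat 3 := by rw [hf₅.nat 3 (by decide), n3']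
        have n14 : s₅.nat 14 0 = k := by rw [hf₅.nat 14 (by decide), n14']
        have w0 : s₅.wt 0 = s.wt 0 := by rw [hf₅.wt 0 (by decide), w0']
        have hval : s₅.wt 0 (s₅.nat 14 0 * s₅.nat 0 0 + s₅.nat 15 0) = mat (s.wt 0) n k l := by
          simp [w0, n14, n0, hv₅, mat]
        have hb : Λ.bd (k * n + (l + 1)) (s₅.wt 6 0 + mat (s.wt 0) n k l) :=
          Λ.bd_add (a := k * n + l) h6 (he.bd_weight k hk l hl)
        have hkn : k * n + (l + 1) ≤ n * n := by nlinarith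
        refine WP.ite (b := 1) hg₅ (fun hc => WP.setWt hg₅ ?_ fun _ => ?_)
          (fun hc => WP.skip hg₅ ?_)
        · simp only [WtExpr.val, entry_val, scalar_val, hval, NatExpr.val]
          exact Λ.bd_mono (by lia) hb
        · have hc' : mat (s.nat 3) n l k = 1 := by
            simp only [Test.Holds, NatExpr.val, entry_val, scalar_val, n14, n0, hv₅, n3] at hc
            exact hc
          simp only [WtExpr.val, entry_val, scalar_val, hval, NatExpr.val, Memory.setNat_wt,
            Memory.setWt_wt, if_true, Function.update_self]
          refine ⟨?_, hb⟩
          rw [Finset.sum_range_succ, hc', h5]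
          push_cast
          ring
        · have hc' : mat (s.nat 3) n l k ≠ 1 := by
            simp only [Test.Holds, NatExpr.val, entry_val, scalar_val, n14, n0, hv₅, n3] at hc
            exact hc
          have hc0 : mat (s.nat 3) n l k = 0 := by have := hA.le_one hl hk; lia
          simp only [Memory.setNat_wt]
          refine ⟨?_, Λ.bd_mono (by lia) h6⟩
          rw [Finset.sum_range_succ, hc0, h5]
          push_cast
          ring
      · rintro s₆ hg₆ hf₆ ⟨h5, h6⟩
        simp only [Memory.setNat_wt, Memory.setNat_nat, Nat.reduceEqDiff, if_false]
        refine ⟨by rw [h5, h1, Finset.sum_range_succ], Λ.bd_mono (by lia) h6, ?_⟩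
        rw [hf₆.nat 13 (by decide)]
        exact h4

theorem storeReversal_spec {a : ℕ} (hs : Λ.Good s) (he : Env Λ n a s)
    (hA : Orients n (mat (s.nat 3) n)) (hadj : Orients n (mat (s.nat 1) n)) :
    WP Λ storeReversal (n * (3 * n + 4) + 2) (fun s' => ∀ i < n, ∀ j < n,
      mat (s'.nat 2) n i j = mat (s.nat 1) n i j * mat (s.nat 3) n j i) s := by
  unfold storeReversal
  have hcell := he.cell
  rw [show n * (3 * n + 4) + 2 = n * ((n * (1 + 2) + 2) + 2) + 2 by ring]
  refine (WP.forLoop (fun k s' => ∀ i < k, ∀ j < n,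
      mat (s'.nat 2) n i j = mat (s.nat 1) n i j * mat (s.nat 3) n j i) hs he.size (by decide)
      (by decide) (by decide) (by simp) ?_)
  intro k hk s₁ hg₁ hf₁ hv₁ h₁
  refine (WP.forLoop (fun l s' => ∀ i < n, ∀ j < n, i < k ∨ i = k ∧ j < l →
      mat (s'.nat 2) n i j = mat (s.nat 1) n i j * mat (s.nat 3) n j i) hg₁
      (by rw [hf₁.nat 0 (by decide), he.size]) (by decide) (by decide) (by decide) ?_ ?_).conseq
      le_rfl ?_
  · rintro i hi j hj (h | h)
    · simpa [Memory.setNat_nat] using h₁ i h j hj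
    · lia
  · intro l hl s₂ hg₂ hf₂ hv₂ h₂
    have n0 : s₂.nat 0 0 = n := by rw [hf₂.nat 0 (by decide), hf₁.nat 0 (by decide), he.size]
    have n1 : s₂.nat 1 = s.nat 1 := by rw [hf₂.nat 1 (by decide), hf₁.nat 1 (by decide)]
    have n3 : s₂.nat 3 = s.nat 3 := by rw [hf₂.nat 3 (by decide), hf₁.nat 3 (by decide)]
    have n14 : s₂.nat 14 0 = k := by rw [hf₂.nat 14 (by decide), hv₁]
    have hval : s₂.nat 1 (s₂.nat 14 0 * s₂.nat 0 0 + s₂.nat 15 0) *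
        s₂.nat 3 (s₂.nat 15 0 * s₂.nat 0 0 + s₂.nat 14 0) =
        mat (s.nat 1) n k l * mat (s.nat 3) n l k := by
      rw [n1, n3, n14, n0, hv₂]; rfl
    have h3 := hA.le_one hl hk
    have h4 := hadj.le_one hk hl
    refine WP.setNat hg₂ ?_ fun hg₃ i hi j hj hij => ?_
    · simp only [NatExpr.val, entry_val, scalar_val, hval]
      nlinarith
    · simp only [NatExpr.val, entry_val, scalar_val, Memory.setNat_nat, Nat.reduceEqDiff,
        if_false, if_true, n14, n0, n1, n3, hv₂]
      rw [mat_update _ _ hl hj]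
      split_ifs with hc
      · rw [hc.1, hc.2]; rfl
      · exact h₂ i hi j hj (by lia)
  · intro s₃ hg₃ hf₃ h₃ i hi j hj
    simp only [Memory.setNat_nat, Nat.reduceEqDiff, if_false]
    exact h₃ i (by lia) j hj (by lia)

theorem updateBest_spec {a x : ℕ} (hs : Λ.Good s) (he : Env Λ n a s) (hx : s.nat 0 1 = x)
    (hlvl : n * n ≤ Λ.lvl) (hA : Orients n (mat (s.nat 3) n)) (hadj : Orients n (mat (s.nat 1) n)) :
    WP Λ updateBest (n * (4 * n + 6) + 4 + (n * (3 * n + 4) + 4)) (fun s' =>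
      (((∀ v < n, s.nat 4 v ≤ s.nat 4 x) ∧
          reversalCost n (mat (s.wt 0) n) (mat (s.nat 3) n) < s.wt 5 0) ∧
        s'.wt 5 0 = reversalCost n (mat (s.wt 0) n) (mat (s.nat 3) n) ∧ ∀ i < n, ∀ j < n,
          mat (s'.nat 2) n i j = mat (s.nat 1) n i j * mat (s.nat 3) n j i) ∨
      (¬ ((∀ v < n, s.nat 4 v ≤ s.nat 4 x) ∧
          reversalCost n (mat (s.wt 0) n) (mat (s.nat 3) n) < s.wt 5 0) ∧
        s'.wt 5 0 = s.wt 5 0 ∧ s'.nat 2 = s.nat 2)) s := by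
  unfold updateBest
  rw [show n * (3 * n + 4) + 4 = 1 + (n * (3 * n + 4) + 2) + 1 by ring]
  refine WP.seq ((evaluate_spec hs he hx hlvl hA).conseq le_rfl ?_)
  rintro s₁ hg₁ hf₁ ⟨h1, h2⟩
  have w5 : s₁.wt 5 = s.wt 5 := hf₁.wt 5 (by decide)
  refine WP.ite hg₁ (fun hc => WP.seq (WP.setWt hg₁ (hg₁.wt _ _) fun hg₂ => ?_))
    (fun hc => (WP.skip (b := 0) hg₁ ?_).conseq (by lia) fun _ _ _ h => h)
  · simp only [Test.Holds, NatExpr.val, WtExpr.val, scalar_val, h1, w5, h2] at hc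
    simp only [NatExpr.val, WtExpr.val, h1] at hg₂ ⊢
    generalize hs₂ : s₁.setWt 5 0 (reversalCost n (mat (s.wt 0) n) (mat (s.nat 3) n)) = s₂ at *
    have n0 : s₂.nat 0 = s.nat 0 := by simp [← hs₂, hf₁.nat 0 (by decide)]
    have n1 : s₂.nat 1 = s.nat 1 := by simp [← hs₂, hf₁.nat 1 (by decide)]
    have n3 : s₂.nat 3 = s.nat 3 := by simp [← hs₂, hf₁.nat 3 (by decide)]
    have he₂ : Env Λ n a s₂ := he.congr n0 (by simp [← hs₂, Memory.setWt_wt, hf₁.wt 0 (by decide)])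
      (by simp [← hs₂, Memory.setWt_wt, hf₁.wt 2 (by decide)])
      (by simp [← hs₂, Memory.setWt_wt, hf₁.wt 7 (by decide)])
    refine (storeReversal_spec hg₂ he₂ (by rwa [n3]) (by rwa [n1])).conseq le_rfl ?_
    intro s₃ hg₃ hf₃ h₃
    refine Or.inl ⟨hc, ?_, by rwa [n1, n3] at h₃⟩
    rw [hf₃.wt 5 (by decide), ← hs₂]
    simp [Memory.setWt_wt]
  · simp only [Test.Holds, NatExpr.val, WtExpr.val, scalar_val, h1, w5, h2] at hc
    exact Or.inr ⟨hc, by rw [w5], hf₁.nat 2 (by decide)⟩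

/-- The orientation in which `x` owns all its edges, and the others are as in the tournament. -/
def startOrientation (adj : ℕ → ℕ → ℕ) (x i j : ℕ) : ℕ :=
  if j ≠ x ∧ (i = x ∨ adj i j = 1) then 1 else 0

theorem initOrientation_spec {x : ℕ} (hs : Λ.Good s) (hn : s.nat 0 0 = n) (hx : s.nat 0 1 = x)
    (hcell : n + 1 ≤ Λ.cell) (hlvl : 2 * (n * n) ≤ Λ.lvl)
    (hW : ∀ i < n, ∀ j < n, Λ.bd 1 (mat (s.wt 0) n i j)) (h3 : s.nat 3 = 0) (h4 : s.nat 4 = 0)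
    (h2 : s.wt 2 0 = 0) :
    WP Λ initOrientation (n * (6 * n + 5) + 2) (fun s' =>
      (∀ i < n, ∀ j < n, mat (s'.nat 3) n i j = startOrientation (mat (s.nat 1) n) x i j) ∧
      (∀ i < n, s'.nat 4 i = ∑ j ∈ Finset.range n, startOrientation (mat (s.nat 1) n) x i j) ∧
      (∀ i < n, s'.nat 7 i = n) ∧
      s'.wt 2 0 = ∑ i ∈ Finset.range n, ∑ j ∈ Finset.range n,
        (mat (s.wt 0) n i j + mat (s.wt 0) n i j) ∧ Λ.bd (2 * (n * n)) (s'.wt 2 0)) s := by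
  unfold initOrientation
  rw [show n * (6 * n + 5) + 2 = n * (1 + (n * (1 + (1 + 1 + 1) + 2) + 2) + 2) + 2 by ring]
  set A := startOrientation (mat (s.nat 1) n) x with hA
  have hA1 : ∀ i j, A i j ≤ 1 := by
    intro i j
    rw [hA, startOrientation]
    split_ifs <;> lia
  refine (WP.forLoop (fun k s' =>
      (∀ i < n, ∀ j < n, mat (s'.nat 3) n i j = if i < k then A i j else 0) ∧
      (∀ i < n, s'.nat 4 i = if i < k then ∑ j ∈ Finset.range n, A i j else 0) ∧
      (∀ i < k, s'.nat 7 i = n) ∧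
      s'.wt 2 0 = ∑ i ∈ Finset.range k, ∑ j ∈ Finset.range n,
        (mat (s.wt 0) n i j + mat (s.wt 0) n i j) ∧ Λ.bd (2 * (k * n)) (s'.wt 2 0)) hs hn
      (by decide) (by decide) (by decide) ?_ ?_).conseq le_rfl ?_
  · simp [Memory.setNat_nat, mat, h3, h4, h2, Λ.bd_zero]
  · rintro k hk s₁ hg₁ hf₁ hv₁ ⟨i3, i4, i7, i2, ib⟩
    have n0 : s₁.nat 0 = s.nat 0 := hf₁.nat 0 (by decide)
    refine WP.seq (WP.setNat hg₁ (hg₁.nat _ _) fun hg₂ => ?_)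
    simp only [scalar_val, hv₁, n0, hn] at hg₂ ⊢
    generalize hs₂ : s₁.setNat 7 k n = s₂ at *
    have m0 : s₂.nat 0 = s.nat 0 := by simp [← hs₂, Memory.setNat_nat, n0]
    have m1 : s₂.nat 1 = s.nat 1 := by simp [← hs₂, Memory.setNat_nat, hf₁.nat 1 (by decide)]
    have m3 : s₂.nat 3 = s₁.nat 3 := by simp [← hs₂, Memory.setNat_nat]
    have m4 : s₂.nat 4 = s₁.nat 4 := by simp [← hs₂, Memory.setNat_nat]
    have m7 : s₂.nat 7 = Function.update (s₁.nat 7) k n := by simp [← hs₂, Memory.setNat_nat]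
    have m14 : s₂.nat 14 0 = k := by simp [← hs₂, Memory.setNat_nat, hv₁]
    have v0 : s₂.wt 0 = s.wt 0 := by simp [← hs₂, hf₁.wt 0 (by decide)]
    have v2 : s₂.wt 2 = s₁.wt 2 := by simp [← hs₂]
    refine (WP.forLoop (fun l s' =>
      (∀ i < n, ∀ j < n, mat (s'.nat 3) n i j = if i < k ∨ i = k ∧ j < l then A i j else 0) ∧
      (∀ i < n, s'.nat 4 i = if i < k then ∑ j ∈ Finset.range n, A i j else
        if i = k then ∑ j ∈ Finset.range l, A i j else 0) ∧
      s'.wt 2 0 = s₁.wt 2 0 + ∑ j ∈ Finset.range l, (mat (s.wt 0) n k j + mat (s.wt 0) n k j) ∧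
      Λ.bd (2 * (k * n + l)) (s'.wt 2 0)) hg₂ (by rw [m0, hn])
      (by decide) (by decide) (by decide) ?_ ?_).conseq le_rfl ?_
    · simp only [Memory.setNat_nat, Memory.setNat_wt, Nat.reduceEqDiff, if_false, m3, m4, v2]
      refine ⟨fun i hi j hj => ?_, fun i hi => ?_, by simp, by simpa using ib⟩
      · rw [i3 i hi j hj]; simp
      · rw [i4 i hi]; simp
    · rintro l hl s₃ hg₃ hf₃ hv₃ ⟨j3, j4, j2, jb⟩
      have p0 : s₃.nat 0 = s.nat 0 := by rw [hf₃.nat 0 (by decide), m0]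
      have p1 : s₃.nat 1 = s.nat 1 := by rw [hf₃.nat 1 (by decide), m1]
      have p14 : s₃.nat 14 0 = k := by rw [hf₃.nat 14 (by decide), m14]
      have u0 : s₃.wt 0 = s.wt 0 := by rw [hf₃.wt 0 (by decide), v0]
      have hb : Λ.bd (2 * (k * n + (l + 1)))
          (s₃.wt 2 0 + (mat (s.wt 0) n k l + mat (s.wt 0) n k l)) := by
        rw [show 2 * (k * n + (l + 1)) = 2 * (k * n + l) + (1 + 1) by ring]
        exact Λ.bd_add jb (Λ.bd_add (hW k hk l hl) (hW k hk l hl))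
      have hkn : k * n + (l + 1) ≤ n * n := by nlinarith
      have hval : s₃.wt 0 (s₃.nat 14 0 * s₃.nat 0 0 + s₃.nat 15 0) = mat (s.wt 0) n k l := by
        simp [u0, p14, p0, hn, hv₃, mat]
      refine WP.seq (b := 1) (b' := 3) (WP.setWt hg₃ ?_ fun hg₄ => ?_)
      · simp only [WtExpr.val, entry_val, scalar_val, hval, NatExpr.val]
        exact Λ.bd_mono (by lia) hb
      simp only [WtExpr.val, entry_val, scalar_val, hval, NatExpr.val] at hg₄ ⊢
      have htest : ∀ P, (Test.Holds (s₃.setWt 2 0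
          (s₃.wt 2 0 + (mat (s.wt 0) n k l + mat (s.wt 0) n k l)))
          (.and (.not (.natEq (scalar 15) (.get 0 (.const 1))))
              (.not (.and (.not (.natEq (scalar 14) (.get 0 (.const 1))))
                (.not (.natEq (.get 1 (entry (scalar 14) (scalar 15))) (.const 1)))))) ↔ P) ↔
          ((l ≠ x ∧ (k = x ∨ mat (s.nat 1) n k l = 1)) ↔ P) := by
        intro P
        simp only [Test.Holds, NatExpr.val, scalar_val, entry_val, Memory.setWt_nat, p0, p1, p14,
          hx, hv₃, hn, mat]
        tauto
      have htest := (htest _).2 Iff.rfl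
      have j4k : s₃.nat 4 k = ∑ j ∈ Finset.range l, A k j := by
        rw [j4 k hk, if_neg (by simp), if_pos rfl]
      have hsum : ∑ j ∈ Finset.range l, A k j ≤ l := by
        refine (Finset.sum_le_card_nsmul _ _ 1 fun j _ => hA1 k j).trans (by simp)
      refine WP.ite (b := 2) hg₄ (fun hc => ?_) (fun hc => WP.skip hg₄ ?_)
      · rw [htest] at hc
        have hAkl : A k l = 1 := by rw [hA, startOrientation, if_pos hc]
        refine WP.seq (b := 1) (b' := 1) (WP.setNat (e := .const 1) hg₄
          (by simp only [NatExpr.val]; lia) fun hg₅ => ?_)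
        refine WP.setNat (b := 0) hg₅ ?_ fun hg₆ => ?_
        · simp only [NatExpr.val, scalar_val, entry_val, Memory.setNat_nat, Memory.setWt_nat,
            Nat.reduceEqDiff, if_false, p14, j4k]
          lia
        · simp only [NatExpr.val, scalar_val, entry_val, Memory.setNat_nat, Memory.setWt_nat,
            Memory.setNat_wt, Memory.setWt_wt, if_true, Function.update_self,
            Nat.reduceEqDiff, if_false, p14, p0, hn, hv₃, j4k]
          refine ⟨fun i hi j hj => ?_, fun i hi => ?_, ?_, hb⟩
          · rw [mat_update _ _ hl hj, j3 i hi j hj]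
            grind
          · rw [Function.update_apply, j4 i hi, Finset.sum_range_succ]
            grind
          · rw [j2, Finset.sum_range_succ, add_assoc]
      · rw [htest] at hc
        have hAkl : A k l = 0 := by rw [hA, startOrientation, if_neg hc]
        simp only [Memory.setNat_nat, Memory.setWt_nat, Memory.setNat_wt, Memory.setWt_wt, if_true,
          Function.update_self, Nat.reduceEqDiff, if_false]
        refine ⟨fun i hi j hj => ?_, fun i hi => ?_, ?_, hb⟩
        · rw [j3 i hi j hj]
          grind
        · rw [j4 i hi, Finset.sum_range_succ]
          grind
        · rw [j2, Finset.sum_range_succ, add_assoc]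
    · rintro s₃ hg₃ hf₃ ⟨j3, j4, j2, jb⟩
      simp only [Memory.setNat_nat, Memory.setNat_wt, Nat.reduceEqDiff, if_false]
      refine ⟨fun i hi j hj => ?_, fun i hi => ?_, fun i hi => ?_, ?_,
        Λ.bd_mono (by lia) jb⟩
      · rw [j3 i hi j hj]
        grind
      · rw [j4 i hi]
        grind
      · rw [hf₃.nat 7 (by decide), m7, Function.update_apply]
        have := i7 i
        grind
      · rw [j2, i2, Finset.sum_range_succ]
  · rintro s' - - ⟨h1, h2, h3, h4, h5⟩
    refine ⟨fun i hi j hj => ?_, fun i hi => ?_, h3, h4, h5⟩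
    · rw [h1 i hi j hj, if_pos hi]
    · rw [h2 i hi, if_pos hi]

theorem startOrientation_orients {adj : ℕ → ℕ → ℕ} (h : Orients n adj) (x : ℕ) :
    Orients n (startOrientation adj x) := by
  intro i hi j hj
  have h1 := h i hi j hj
  unfold startOrientation
  grind

/-- With capacities `n` no penalty applies to an owned edge, so minus the reward is the right
potential. Edges of `x` are kept because the reward `M` is at least every weight; the other edges
have their original owner, and passing them on would save nothing. -/
theorem startOrientation_potential {adj : ℕ → ℕ → ℕ} (h : Orients n adj) {x : ℕ}
    {W : ℕ → ℕ → K} {M : K} {off p : ℕ → K} {deg cap : ℕ → ℕ}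
    (hoff : ∀ v < n, off v = if v = x then M else 0) (hp : ∀ v < n, p v = - off v)
    (hcap : ∀ v < n, cap v = n)
    (hdeg : ∀ v < n, ∑ j ∈ Finset.range n, startOrientation adj x v j = deg v)
    (hW : ∀ i < n, ∀ j < n, 0 ≤ W i j) (hW0 : ∀ i < n, ∀ j < n, adj i j ≠ 1 → W i j = 0)
    (hM : ∀ i < n, ∀ j < n, W i j ≤ M) :
    Potential n W M off (startOrientation adj x) deg cap p := by
  have hle : ∀ v < n, deg v ≤ n := fun v hv =>
    hdeg v hv ▸ (startOrientation_orients h x).sum_le hv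
  refine ⟨fun i hi j hj hij => ?_, fun v hv => ?_, fun v hv hpos => ?_⟩
  · have h1 : j ≠ x ∧ (i = x ∨ adj i j = 1) := by
      by_contra hcon
      rw [startOrientation, if_neg hcon] at hij
      simp at hij
    rw [hp i hi, hp j hj, hoff i hi, hoff j hj, if_neg h1.1]
    have h2 := hW i hi j hj
    have h3 := hM j hj i hi
    split_ifs with hix
    · linarith
    · have h4 := h i hi j hj
      have h5 : adj j i ≠ 1 := by
        rcases h1.2 with h6 | h6
        · exact absurd h6 hix
        · split_ifs at h4 <;> lia
      rw [hW0 j hj i hi h5]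
      linarith
  · have h1 := hM v hv v hv
    have h2 := hW v hv v hv
    rw [hp v hv, marginal]
    split_ifs <;> linarith
  · have := hle v hv
    rw [hp v hv, marginal, hcap v hv, if_pos (by lia)]
    linarith

/-- A bound on the number of steps of the program. -/
def stepCount (n : ℕ) : ℕ :=
  n * (6 * n + 5) + 2 + (1 + (1 + (1 + ((n * (n * (9 * n * n + 19 * n + 12) + 2 +
    (n * (4 * n + 6) + 4 + (n * (3 * n + 4) + 4)) + 2) + 2) + 1))))

/-- `M` serves as penalty, as reward and as the initial value, effectively infinite, of the best
cost. A positive weight makes `M` strictly greater than the total weight, hence than every reversal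
cost. -/
theorem copelandProgram_spec {x : ℕ} (hs : Λ.Good s) (hn : s.nat 0 0 = n) (hx : s.nat 0 1 = x)
    (hxn : x < n) (hcell : n + 1 ≤ Λ.cell) (hlvl : 4 * (n * n) + 2 * n ≤ Λ.lvl)
    (hbW : ∀ i < n, ∀ j < n, Λ.bd 1 (mat (s.wt 0) n i j)) (h3 : s.nat 3 = 0) (h4 : s.nat 4 = 0)
    (hw2 : s.wt 2 0 = 0) (hw3 : s.wt 3 = 0) (hw7 : s.wt 7 = 0)
    (hadj : Orients n (mat (s.nat 1) n)) (hW : ∀ i < n, ∀ j < n, 0 ≤ mat (s.wt 0) n i j)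
    (hW0 : ∀ i < n, ∀ j < n, mat (s.nat 1) n i j ≠ 1 → mat (s.wt 0) n i j = 0)
    (hpos : ∃ i < n, ∃ j < n, 0 < mat (s.wt 0) n i j) :
    WP Λ copelandProgram (stepCount n) (fun s' => ∃ A, Orients n A ∧
      (∀ v < n, ∑ j ∈ Finset.range n, A v j ≤ ∑ j ∈ Finset.range n, A x j) ∧
      s'.wt 1 0 = - reversalCost n (mat (s.wt 0) n) A ∧
      (∀ i < n, ∀ j < n, mat (s'.nat 2) n i j = mat (s.nat 1) n i j * A j i) ∧
      ∀ A', Orients n A' →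
        (∀ v < n, ∑ j ∈ Finset.range n, A' v j ≤ ∑ j ∈ Finset.range n, A' x j) →
        reversalCost n (mat (s.wt 0) n) A ≤ reversalCost n (mat (s.wt 0) n) A') s := by
  unfold copelandProgram stepCount
  have hset : ∀ {s : Memory K} {k : ℕ}, Optimal n s → Optimal n (s.setNat 8 0 k) := by
    rintro s k ⟨h1, h2, h3⟩
    constructor <;> simpa [Memory.setNat_nat]
  set W := mat (s.wt 0) n with hWdef
  set adj := mat (s.nat 1) n with hadjdef
  set M : K := ∑ i ∈ Finset.range n, ∑ j ∈ Finset.range n, (W i j + W i j) with hMdef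
  have hS : ∀ i < n, ∀ j < n, W i j ≤ ∑ i ∈ Finset.range n, ∑ j ∈ Finset.range n, W i j := by
    intro i hi j hj
    refine (Finset.single_le_sum (f := fun j => W i j) (fun j hj => hW i hi j
      (Finset.mem_range.1 hj)) (Finset.mem_range.2 hj)).trans ?_
    exact Finset.single_le_sum (f := fun i => ∑ j ∈ Finset.range n, W i j) (fun i hi =>
      Finset.sum_nonneg fun j hj => hW i (Finset.mem_range.1 hi) j (Finset.mem_range.1 hj))
      (Finset.mem_range.2 hi)
  have hMS : M = (∑ i ∈ Finset.range n, ∑ j ∈ Finset.range n, W i j) +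
      ∑ i ∈ Finset.range n, ∑ j ∈ Finset.range n, W i j := by
    rw [hMdef, ← Finset.sum_add_distrib]
    exact Finset.sum_congr rfl fun i _ => Finset.sum_add_distrib
  have hS0 : 0 < ∑ i ∈ Finset.range n, ∑ j ∈ Finset.range n, W i j := by
    obtain ⟨i, hi, j, hj, hij⟩ := hpos
    exact hij.trans_le (hS i hi j hj)
  have hM0 : 0 ≤ M := by linarith
  have hlt : ∀ A, Orients n A → reversalCost n W A < M := by
    intro A hA
    have : reversalCost n W A ≤ ∑ i ∈ Finset.range n, ∑ j ∈ Finset.range n, W i j := by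
      refine Finset.sum_le_sum fun i hi => Finset.sum_le_sum fun j hj => ?_
      rw [Finset.mem_range] at hi hj
      have h1 : (A j i : K) ≤ 1 := by exact_mod_cast hA.le_one hj hi
      nlinarith [hW i hi j hj]
    linarith
  refine WP.seq ((initOrientation_spec hs hn hx hcell (by lia) hbW h3 h4 hw2).conseq le_rfl ?_)
  rintro s₁ hg₁ hf₁ ⟨hA₁, hd₁, hc₁, hM₁, hb₁⟩
  rw [← hMdef] at hM₁
  rw [hM₁] at hb₁
  refine WP.seq (WP.setWt hg₁ (hg₁.wt _ _) fun hg₂ => ?_)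
  refine WP.seq (WP.setWt hg₂ (hg₂.wt _ _) fun hg₃ => ?_)
  refine WP.seq (WP.setWt hg₃ (Λ.bd_mono (by lia) (Λ.bd_sub Λ.bd_zero (hg₃.wt 2 0))) fun hg₄ => ?_)
  simp only [NatExpr.val, WtExpr.val, Memory.setWt_nat, Memory.setWt_wt, Nat.reduceEqDiff, if_false,
    hM₁, hf₁.nat 0 (by decide), hx] at hg₄ ⊢
  generalize hs₄ : ((s₁.setWt 5 0 M).setWt 7 x M).setWt 3 x (0 - M) = s₄ at *
  have hnat : s₄.nat = s₁.nat := by simp [← hs₄]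
  have n0 : s₄.nat 0 = s.nat 0 := by rw [hnat, hf₁.nat 0 (by decide)]
  have n1 : s₄.nat 1 = s.nat 1 := by rw [hnat, hf₁.nat 1 (by decide)]
  have w0 : s₄.wt 0 = s.wt 0 := by simp [← hs₄, Memory.setWt_wt, hf₁.wt 0 (by decide)]
  have w2 : s₄.wt 2 0 = M := by simp [← hs₄, Memory.setWt_wt, hM₁]
  have w3 : ∀ v, s₄.wt 3 v = - if v = x then M else 0 := by
    intro v
    simp only [← hs₄, Memory.setWt_wt, Nat.reduceEqDiff, if_false, if_true,
      hf₁.wt 3 (by decide), hw3, Function.update_apply]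
    split_ifs <;> simp
  have w5 : s₄.wt 5 0 = M := by simp [← hs₄, Memory.setWt_wt]
  have w7 : ∀ v, s₄.wt 7 v = if v = x then M else 0 := by
    intro v
    simp only [← hs₄, Memory.setWt_wt, Nat.reduceEqDiff, if_false, if_true,
      hf₁.wt 7 (by decide), hw7, Function.update_apply]
    split_ifs <;> simp
  have he₄ : Env Λ n (2 * (n * n)) s₄ := by
    refine ⟨by rw [n0, hn], hcell, by lia, by rwa [w2], by rwa [w0], by rwa [w2], fun v _ => ?_⟩
    rw [w7]
    split_ifs
    · exact hb₁
    · exact Λ.bd_mono (Nat.zero_le _) Λ.bd_zero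
  have horient : Orients n (mat (s₄.nat 3) n) := by
    intro i hi j hj
    rw [hnat, hA₁ i hi j hj, hA₁ j hj i hi]
    exact startOrientation_orients hadj x i hi j hj
  have hopt : Optimal n s₄ := by
    have hp : Potential n W M (s₄.wt 7) (startOrientation adj x) (s₄.nat 4) (s₄.nat 7)
        (s₄.wt 3) := by
      refine startOrientation_potential hadj (fun v _ => w7 v) (fun v _ => by rw [w3, w7])
        (fun v hv => by rw [hnat, hc₁ v hv]) (fun v hv => by rw [hnat, hd₁ v hv]) hW hW0
        fun i hi j hj => ?_
      have := hS i hi j hj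
      linarith
    refine ⟨horient, ⟨fun i hi j hj hij => ?_, ?_, ?_⟩, fun v hv => ?_⟩
    · rw [hnat, hA₁ i hi j hj] at hij
      rw [w0]
      exact hp.arc i hi j hj hij
    · rw [w2]
      exact hp.le
    · rw [w2]
      exact hp.ge
    · rw [hnat, hd₁ v hv]
      exact Finset.sum_congr rfl fun j hj => hA₁ v hv j (Finset.mem_range.1 hj)
  -- After `r` rounds the best cost is at most that of every orientation in which `x` wins with at
  -- least `n - r` edges. This is void for `r = 0`, since no vertex owns `n` edges, and covers all
  -- cases for `r = n`.
  refine WP.seq ((WP.forLoop (fun r s' => Optimal n s' ∧ (∀ v < n, s'.nat 7 v = n - r) ∧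
    (s'.wt 5 0 = M ∨ ∃ A, Orients n A ∧
      (∀ v < n, ∑ j ∈ Finset.range n, A v j ≤ ∑ j ∈ Finset.range n, A x j) ∧
      s'.wt 5 0 = reversalCost n W A ∧
      (∀ i < n, ∀ j < n, mat (s'.nat 2) n i j = adj i j * A j i)) ∧
    ∀ A', Orients n A' →
        (∀ v < n, ∑ j ∈ Finset.range n, A' v j ≤ ∑ j ∈ Finset.range n, A' x j) →
        n - r ≤ ∑ j ∈ Finset.range n, A' x j →
        s'.wt 5 0 ≤ reversalCost n W A') hg₄ he₄.size (by decide)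
    (by decide) (by decide) ?_ ?_).conseq le_rfl ?_)
  · simp only [Memory.setNat_nat, Memory.setNat_wt, Nat.reduceEqDiff, if_false]
    refine ⟨hset hopt, fun v hv => by rw [hnat, hc₁ v hv]; rfl, Or.inl w5, fun A' hA' _ hle => ?_⟩
    have := hA'.sum_lt hxn
    lia
  · rintro r hr s₅ hg₅ hf₅ hv₅ ⟨hI, hcap, hbest, hall⟩
    have m0 : s₅.nat 0 = s.nat 0 := by rw [hf₅.nat 0 (by decide), n0]
    have m1 : s₅.nat 1 = s.nat 1 := by rw [hf₅.nat 1 (by decide), n1]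
    have v0 : s₅.wt 0 = s.wt 0 := by rw [hf₅.wt 0 (by decide), w0]
    have he₅ : Env Λ n (2 * (n * n)) s₅ := he₄.congr (hf₅.nat 0 (by decide))
      (hf₅.wt 0 (by decide)) (hf₅.wt 2 (by decide)) (hf₅.wt 7 (by decide))
    refine WP.seq ((lowerCaps_spec (c := n - r - 1) hg₅ he₅ hI fun v hv => by
      rw [hcap v hv]; lia).conseq le_rfl ?_)
    rintro s₆ hg₆ hf₆ ⟨hI₆, hcap₆⟩
    have he₆ : Env Λ n (2 * (n * n)) s₆ := he₅.congr (hf₆.nat 0 (by decide))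
      (hf₆.wt 0 (by decide)) (hf₆.wt 2 (by decide)) (hf₆.wt 7 (by decide))
    have l0 : s₆.nat 0 = s.nat 0 := by rw [hf₆.nat 0 (by decide), m0]
    have l1 : s₆.nat 1 = s.nat 1 := by rw [hf₆.nat 1 (by decide), m1]
    have l2 : s₆.nat 2 = s₅.nat 2 := hf₆.nat 2 (by decide)
    have u0 : s₆.wt 0 = s.wt 0 := by rw [hf₆.wt 0 (by decide), v0]
    have u2 : s₆.wt 2 0 = M := by rw [hf₆.wt 2 (by decide), hf₅.wt 2 (by decide), w2]
    have u5 : s₆.wt 5 = s₅.wt 5 := hf₆.wt 5 (by decide)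
    have u7 : ∀ v, s₆.wt 7 v = if v = x then M else 0 := fun v => by
      rw [hf₆.wt 7 (by decide), hf₅.wt 7 (by decide), w7]
    refine (updateBest_spec (x := x) hg₆ he₆ (by rw [l0, hx]) (by lia) hI₆.orients
      (by rwa [l1])).conseq le_rfl ?_
    intro s₇ hg₇ hf₇ h₇
    have hI₇ : Optimal n s₇ := by
      obtain ⟨h1, h2, h3⟩ := hI₆
      have e3 := hf₇.nat 3 (by decide)
      have e4 := hf₇.nat 4 (by decide)
      have e7 := hf₇.nat 7 (by decide)
      have f0 := hf₇.wt 0 (by decide)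
      have f2 := hf₇.wt 2 (by decide)
      have f3 := hf₇.wt 3 (by decide)
      have f7 := hf₇.wt 7 (by decide)
      exact ⟨by rwa [e3], by rwa [f0, f2, f7, e3, e4, e7, f3], by rwa [e3, e4]⟩
    have hfeas : ∀ A', Orients n A' →
        (∀ v < n, ∑ j ∈ Finset.range n, A' v j ≤ ∑ j ∈ Finset.range n, A' x j) →
        n - (r + 1) = ∑ j ∈ Finset.range n, A' x j → (∀ v < n, s₆.nat 4 v ≤ s₆.nat 4 x) ∧
          reversalCost n W (mat (s₆.nat 3) n) ≤ reversalCost n W A' := by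
      intro A' hA' hle hxA
      have hp := hI₆.potential
      rw [u0, u2] at hp
      exact hp.optimal_of_feasible (c := n - r - 1) hxn (fun v _ => u7 v) hcap₆ hW hI₆.orients hA'
        hI₆.owned (by lia) (fun i hi => (hle i hi).trans (by lia)) (hlt A' hA')
    simp only [Memory.setNat_nat, Memory.setNat_wt, Nat.reduceEqDiff, if_false]
    rw [u0, u5, l1, l2, ← hWdef, ← hadjdef] at h₇
    refine ⟨hset hI₇, fun v hv => ?_, ?_, fun A' hA' hle hxA => ?_⟩
    · rw [hf₇.nat 7 (by decide), hcap₆ v hv]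
      lia
    · rcases h₇ with ⟨h1, h2, h3⟩ | ⟨-, h2, h3⟩
      · refine Or.inr ⟨_, hI₆.orients, fun v hv => ?_, h2, h3⟩
        rw [hI₆.owned v hv, hI₆.owned x hxn]
        exact h1.1 v hv
      · rwa [h2, h3]
    -- Only orientations in which `x` owns exactly `n - (r + 1)` edges are new in this round, and
    -- those are dominated by the current optimum.
    · by_cases hxA' : n - (r + 1) = ∑ j ∈ Finset.range n, A' x j
      · obtain ⟨h4, h5⟩ := hfeas A' hA' hle hxA'
        rcases h₇ with ⟨-, h2, -⟩ | ⟨h1, h2, -⟩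
        · rw [h2]
          exact h5
        · rw [h2]
          exact (not_lt.1 fun h => h1 ⟨h4, h⟩).trans h5
      · have h6 := hall A' hA' hle (by lia)
        rcases h₇ with ⟨h1, h2, -⟩ | ⟨-, h2, -⟩
        · rw [h2]
          exact h1.2.le.trans h6
        · rwa [h2]
  · rintro s₅ hg₅ hf₅ ⟨-, -, hbest, hall⟩
    refine WP.setWt (b := 0) hg₅ (Λ.bd_mono (by lia) (Λ.bd_sub Λ.bd_zero (hg₅.wt 5 0))) fun _ => ?_
    simp only [WtExpr.val, NatExpr.val, Memory.setWt_wt, Memory.setWt_nat, if_true,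
      Function.update_self, zero_sub]
    rcases hbest with hbest | ⟨A, hA, hxA, hcost, hR⟩
    -- The best cost cannot still be `M`: in the initial orientation `x` owns all its edges, thus
    -- wins, at a cost below `M`.
    · exfalso
      have hS := startOrientation_orients hadj x
      have h1 := hall _ hS (fun v hv => ?_) (by lia)
      · rw [hbest] at h1
        exact absurd (hlt _ hS) (not_lt.2 h1)
      · by_cases hvx : v = x
        · rw [hvx]
        · have h2 : ∑ j ∈ Finset.range n, startOrientation adj x x j =
              ∑ j ∈ Finset.range n, if j = x then 0 else 1 := by
            refine Finset.sum_congr rfl fun j _ => ?_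
            unfold startOrientation
            grind
          have h3 : ∑ j ∈ Finset.range n, startOrientation adj x v j ≤
              ∑ j ∈ Finset.range n, if j = x then 0 else 1 := by
            refine Finset.sum_le_sum fun j _ => ?_
            unfold startOrientation
            grind
          lia
    · refine ⟨A, hA, hxA, by rw [hcost], hR, fun A' hA' hle => ?_⟩
      rw [← hcost]
      exact hall A' hA' hle (by lia)

end MainSpecs

/-! ## Correctness and running time of the program -/

section Correctness

theorem mat_matrixCells {β : Type*} [Zero β] {n : ℕ} (g : Fin n → Fin n → β) {i j : ℕ} (hi : i < n)
    (hj : j < n) : mat (matrixCells g) n i j = g ⟨i, hi⟩ ⟨j, hj⟩ := by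
  have h : i * n + j < n * n := by nlinarith
  have h1 : (i * n + j) / n = i := by
    rw [mul_comm, Nat.mul_add_div (by lia), Nat.div_eq_of_lt hj, add_zero]
  have h2 : (i * n + j) % n = j := by
    rw [mul_comm, Nat.mul_add_mod, Nat.mod_eq_of_lt hj]
  rw [mat, matrixCells, dif_pos h]
  congr 1 <;> simp [h1, h2]

variable {n : ℕ}

/-- The adjacency matrix of a tournament, with natural numbers as indices. -/
def Tournament.adjacency (T : Tournament (Fin n)) (i j : ℕ) : ℕ :=
  if h : i < n ∧ j < n then if (⟨i, h.1⟩, ⟨j, h.2⟩) ∈ T.edges then 1 else 0 else 0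

theorem Tournament.adjacency_val (T : Tournament (Fin n)) (i j : Fin n) :
    T.adjacency i j = if (i, j) ∈ T.edges then 1 else 0 := by
  simp [adjacency]

theorem Tournament.orients_adjacency (T : Tournament (Fin n)) : Orients n T.adjacency := by
  intro i hi j hj
  have h1 := T.adjacency_val ⟨i, hi⟩ ⟨j, hj⟩
  have h2 := T.adjacency_val ⟨j, hj⟩ ⟨i, hi⟩
  simp only at h1 h2
  rw [h1, h2]
  by_cases hij : i = j
  · subst hij
    simp [T.no_loop]
  · have := T.one_edge ⟨i, hi⟩ ⟨j, hj⟩ (by simpa using hij)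
    rw [if_neg hij]
    split_ifs <;> simp_all

theorem Tournament.sum_adjacency (T : Tournament (Fin n)) (v : Fin n) :
    ∑ j ∈ Finset.range n, T.adjacency v j = T.outdegree v := by
  rw [Finset.sum_range, outdegree, dominion, Finset.card_filter]
  exact Finset.sum_congr rfl fun j _ => T.adjacency_val v j

theorem Tournament.mem_copelandSet_iff (T : Tournament (Fin n)) (x : Fin n) :
    x ∈ T.copelandSet ↔ ∀ v < n, ∑ j ∈ Finset.range n, T.adjacency v j ≤
      ∑ j ∈ Finset.range n, T.adjacency x j := by
  constructor
  · intro h v hv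
    rw [T.sum_adjacency x, show v = ((⟨v, hv⟩ : Fin n) : ℕ) from rfl, T.sum_adjacency]
    exact h _
  · intro h y
    rw [← T.sum_adjacency x, ← T.sum_adjacency y]
    exact h y y.2

variable {K : Type*} [Field K] [LinearOrder K] [IsStrictOrderedRing K]

/-- A pair `(i, j)` contributes iff it is an edge of `T` that `j` owns after the reversal, that is,
iff it lies in `R`. -/
theorem reversalCost_reverse {T : Tournament (Fin n)} {w : Fin n × Fin n → K} {W : ℕ → ℕ → K}
    (hW : ∀ i j : Fin n, W i j = if (i, j) ∈ T.edges then w (i, j) else 0)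
    {R : Finset (Fin n × Fin n)} (hR : R ⊆ T.edges) :
    reversalCost n W (T.reverse R hR).adjacency = weight w R := by
  rw [reversalCost, weight, Finset.sum_range]
  simp only [Finset.sum_range]
  rw [← Finset.sum_product' (f := fun i j : Fin n =>
    ((T.reverse R hR).adjacency j i : K) * W i j), Finset.univ_product_univ,
    ← Finset.sum_filter_add_sum_filter_not Finset.univ (· ∈ R)]
  rw [Finset.sum_eq_zero (s := Finset.univ.filter (· ∉ R)), add_zero, Finset.filter_mem_eq_inter,
    Finset.univ_inter]
  · refine Finset.sum_congr rfl fun e he => ?_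
    rw [Tournament.adjacency_val, hW, if_pos (hR he), if_pos, Nat.cast_one, one_mul]
    exact (T.mem_reverse_iff _ _).2 (Or.inr he)
  · rintro ⟨i, j⟩ he
    simp only [Finset.mem_filter, Finset.mem_univ, true_and] at he
    rw [Tournament.adjacency_val, hW]
    by_cases hij : (i, j) ∈ T.edges
    · rw [if_neg, Nat.cast_zero, zero_mul]
      intro h
      rcases (T.mem_reverse_iff _ _).1 h with h | h
      · have hne : i ≠ j := by
          rintro rfl
          exact T.no_loop _ hij
        exact (T.one_edge i j hne).1 hij h.1
      · exact he h
    · rw [if_neg hij, mul_zero]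

/-- The edges that an orientation reverses. -/
def reversalSet (T : Tournament (Fin n)) (A : ℕ → ℕ → ℕ) : Finset (Fin n × Fin n) :=
  T.edges.filter fun e => A e.2 e.1 = 1

theorem reversalSet_subset (T : Tournament (Fin n)) (A : ℕ → ℕ → ℕ) :
    reversalSet T A ⊆ T.edges := Finset.filter_subset _ _

/-- Every orientation thus arises from a reversal set, so minimising over orientations is minimising
over reversal sets. -/
theorem adjacency_reverse_reversalSet (T : Tournament (Fin n)) {A : ℕ → ℕ → ℕ} (hA : Orients n A) :
    ∀ i < n, ∀ j < n,
      (T.reverse (reversalSet T A) (reversalSet_subset T A)).adjacency i j = A i j := by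
  intro i hi j hj
  have h1 := hA i hi j hj
  have h2 := Tournament.adjacency_val (T.reverse (reversalSet T A) (reversalSet_subset T A))
    ⟨i, hi⟩ ⟨j, hj⟩
  simp only at h2
  rw [h2]
  have h3 := T.mem_reverse_iff (R := reversalSet T A) ⟨i, hi⟩ ⟨j, hj⟩
  have h4 := T.one_edge ⟨i, hi⟩ ⟨j, hj⟩
  have h5 := T.no_loop ⟨i, hi⟩
  simp only [Tournament.reverse] at h3 ⊢
  simp only [reversalSet, Finset.mem_filter] at h3 ⊢
  by_cases hij : i = j
  · subst hij
    simp_all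
  · rw [if_neg hij] at h1
    have h6 := h4 (by simpa using hij)
    split_ifs with h7
    · have := h3.1 h7
      by_cases h8 : A j i = 1
      · grind
      · lia
    · have := mt h3.2 h7
      by_cases h8 : A j i = 1
      · lia
      · grind

/-- Transfers `copelandProgram_spec` to tournaments: reversal sets and orientations correspond, with
equal costs and with row sums as outdegrees. -/
theorem computesMoV_copelandProgram {sz : K → ℕ} {Λ : Limits sz} {T : Tournament (Fin n)}
    {w : Fin n × Fin n → K} {x : Fin n} (hw : ∀ e ∈ T.edges, 0 < w e) (hx : x ∉ T.copelandSet)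
    (hcell : n + 1 ≤ Λ.cell) (hlvl : 4 * (n * n) + 2 * n ≤ Λ.lvl)
    (hbd : ∀ e ∈ T.edges, Λ.bd 1 (w e)) :
    ComputesMoV sz copelandProgram T w x (stepCount n * Λ.rate copelandProgram) := by
  have hn : 0 < n := x.pos
  set s := inputMemory T w x with hs
  have hadj : ∀ i < n, ∀ j < n, mat (s.nat 1) n i j = T.adjacency i j := by
    intro i hi j hj
    have h1 : s.nat 1 = matrixCells (fun i j => if (i, j) ∈ T.edges then 1 else 0) := by
      funext k; simp [hs, inputMemory]
    have h2 := T.adjacency_val ⟨i, hi⟩ ⟨j, hj⟩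
    rw [h1, mat_matrixCells _ hi hj, ← h2]
  have hWt : ∀ i j : Fin n, mat (s.wt 0) n i j = if (i, j) ∈ T.edges then w (i, j) else 0 := by
    intro i j
    have h1 : s.wt 0 = matrixCells (fun i j => if (i, j) ∈ T.edges then w (i, j) else 0) := by
      funext k; simp [hs, inputMemory]
    rw [h1, mat_matrixCells _ i.2 j.2]
  have hbd' : ∀ i j : Fin n, Λ.bd 1 (if (i, j) ∈ T.edges then w (i, j) else 0) := by
    intro i j
    split_ifs with h
    · exact hbd _ h
    · exact Λ.bd_mono (Nat.zero_le _) Λ.bd_zero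
  have hg : Λ.Good s := by
    constructor
    · intro a i
      simp only [hs, inputMemory, matrixCells]
      have := x.2
      split_ifs <;> lia
    · intro a i
      refine Λ.bd_mono (show 1 ≤ Λ.lvl by nlinarith) ?_
      simp only [hs, inputMemory, matrixCells]
      split_ifs <;> first | exact Λ.bd_mono (Nat.zero_le _) Λ.bd_zero | skip
      exact hbd _ ‹_›
  -- Since `x` is not a winner, some vertex has positive outdegree; this yields the positive weight
  -- that the program's choice of `M` requires.
  obtain ⟨y, hy⟩ : ∃ y, T.outdegree x < T.outdegree y := by
    by_contra hcon
    push Not at hcon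
    exact hx hcon
  obtain ⟨z, hz⟩ : ∃ z, (y, z) ∈ T.edges := by
    have h1 : 0 < T.outdegree y := by lia
    obtain ⟨z, hz⟩ := Finset.card_pos.1 h1
    exact ⟨z, by simpa [Tournament.dominion] using hz⟩
  have hadjO : Orients n (mat (s.nat 1) n) := by
    intro i hi j hj
    rw [hadj i hi j hj, hadj j hj i hi]
    exact T.orients_adjacency i hi j hj
  obtain ⟨s', t, hr, ht, -, -, A, hA, hxA, hcost, hR, hmin⟩ := copelandProgram_spec (Λ := Λ) (x := x)
    hg (by simp [hs, inputMemory]) (by simp [hs, inputMemory]) x.2 hcell hlvl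
    (fun i hi j hj => by rw [hWt ⟨i, hi⟩ ⟨j, hj⟩]; exact hbd' _ _)
    (by funext k; simp [hs, inputMemory]) (by funext k; simp [hs, inputMemory])
    (by simp [hs, inputMemory]) (by funext k; simp [hs, inputMemory])
    (by funext k; simp [hs, inputMemory]) hadjO
    (fun i hi j hj => by
      rw [hWt ⟨i, hi⟩ ⟨j, hj⟩]
      split_ifs with h
      · exact (hw _ h).le
      · exact le_rfl)
    (fun i hi j hj h => by
      rw [hWt ⟨i, hi⟩ ⟨j, hj⟩, if_neg]
      intro h'
      rw [hadj i hi j hj, T.adjacency_val ⟨i, hi⟩ ⟨j, hj⟩, if_pos h'] at h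
      exact h rfl)
    ⟨y, y.2, z, z.2, by rw [hWt, if_pos hz]; exact hw _ hz⟩
  have hadjR := adjacency_reverse_reversalSet T hA
  have hsumR : ∀ v < n, ∑ j ∈ Finset.range n,
      (T.reverse (reversalSet T A) (reversalSet_subset T A)).adjacency v j =
      ∑ j ∈ Finset.range n, A v j := fun v hv =>
    Finset.sum_congr rfl fun j hj => hadjR v hv j (Finset.mem_range.1 hj)
  have hcostR : reversalCost n (mat (s.wt 0) n) A = weight w (reversalSet T A) := by
    rw [← reversalCost_reverse hWt (reversalSet_subset T A)]
    refine Finset.sum_congr rfl fun i hi => Finset.sum_congr rfl fun j hj => ?_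
    rw [hadjR j (Finset.mem_range.1 hj) i (Finset.mem_range.1 hi)]
  have hCRS : IsCRS Tournament.copelandSet T x (reversalSet T A) := by
    refine ⟨hx, reversalSet_subset T A, (Tournament.mem_copelandSet_iff _ _).2 fun v hv => ?_⟩
    rw [hsumR v hv, hsumR x x.2]
    exact hxA v hv
  refine ⟨s', t, hr, ht, ⟨fun h => absurd h hx, fun _ => ⟨⟨_, hCRS, ?_⟩, ?_⟩⟩, _, hCRS, ?_, ?_⟩
  · rw [hcost, neg_neg, hcostR]
  · rintro _ ⟨R, ⟨-, hRT, hxR⟩, rfl⟩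
    rw [hcost, neg_neg, ← reversalCost_reverse hWt hRT]
    exact hmin _ (Tournament.orients_adjacency _) ((Tournament.mem_copelandSet_iff _ _).1 hxR)
  · rw [hcost, hcostR]
  · intro i j
    have h1 := hR i i.2 j j.2
    rw [hadj i i.2 j j.2, T.adjacency_val] at h1
    rw [show s'.nat 2 ((i : ℕ) * n + (j : ℕ)) = mat (s'.nat 2) n i j from rfl, h1]
    simp only [reversalSet, Finset.mem_filter]
    have h2 := hA.le_one j.2 i.2
    split_ifs <;> (simp_all; try lia)

end Correctness

/-! ### Sizes of weights and the polynomial time bound -/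

section Sizes

/-- No limits on weights. -/
def unitLimits (n : ℕ) : Limits (fun _ : ℝ => 0) where
  cell := n + 1
  bd _ _ := True
  lvl := 4 * (n * n) + 2 * n
  unit := 0
  bd_zero := trivial
  bd_mono _ _ := trivial
  bd_add _ _ := trivial
  bd_sub _ _ := trivial
  size_le _ := by simp

/-- One plus the sum is at most the product of the `f e + 1`, and each factor is at most `2 ^
Nat.size (f e)`. -/
theorem sum_add_one_le_two_pow {ι : Type*} (E : Finset ι) (f : ι → ℕ) :
    ∑ e ∈ E, f e + 1 ≤ 2 ^ ∑ e ∈ E, Nat.size (f e) := by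
  classical
  induction E using Finset.induction_on with
  | empty => simp
  | insert a E ha ih =>
    rw [Finset.sum_insert ha, Finset.sum_insert ha, pow_add]
    have h : f a + 1 ≤ 2 ^ Nat.size (f a) := Nat.lt_size_self _
    refine le_trans ?_ (Nat.mul_le_mul h ih)
    nlinarith [Nat.zero_le (f a * ∑ e ∈ E, f e)]

theorem prod_le_two_pow {ι : Type*} (E : Finset ι) (f : ι → ℕ) :
    ∏ e ∈ E, f e ≤ 2 ^ ∑ e ∈ E, Nat.size (f e) := by
  rw [← Finset.prod_pow_eq_pow_sum]
  exact Finset.prod_le_prod' fun e _ => (Nat.lt_size_self (f e)).le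

/-- The reduced denominator divides the common denominator `D`, and the numerator is `|q|` times the
reduced denominator. The crude bound `m < 2 ^ m` suffices, as `m` will be polynomial in the input.
-/
theorem ratBits_le {q S : ℚ} {D : ℕ} {z : ℤ} {m a d : ℕ} (hD : q * D = z) (hD0 : 0 < D)
    (hq : |q| ≤ m * S) (hS : S ≤ (2 : ℚ) ^ a) (hd : D ≤ 2 ^ d) : ratBits q ≤ 2 + m + a + 2 * d := by
  have hden : q.den ∣ D := by
    have h1 : q = (z : ℚ) / ((D : ℤ) : ℚ) := by
      rw [← hD]
      have : (D : ℚ) ≠ 0 := by positivity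
      push_cast
      field_simp
    rw [h1]
    exact_mod_cast Rat.den_dvd z D
  have hden' : q.den ≤ 2 ^ d := (Nat.le_of_dvd hD0 hden).trans hd
  have hnum : q.num.natAbs < 2 ^ (m + a + d) := by
    have h1 : (q.num.natAbs : ℚ) = |q| * q.den := by
      rw [Nat.cast_natAbs, Int.cast_abs, ← Rat.mul_den_eq_num q, abs_mul, Nat.abs_cast]
    have hm : (m : ℚ) + 1 ≤ 2 ^ m := by exact_mod_cast Nat.lt_two_pow_self
    have h2 : (q.num.natAbs : ℚ) < 2 ^ (m + a + d) := by
      calc (q.num.natAbs : ℚ) = |q| * q.den := h1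
        _ ≤ (m * 2 ^ a) * 2 ^ d := by
          have : (q.den : ℚ) ≤ 2 ^ d := by exact_mod_cast hden'
          have h3 : |q| ≤ m * 2 ^ a := hq.trans (by gcongr)
          gcongr
        _ < (2 ^ m * 2 ^ a) * 2 ^ d := by
          have : (m : ℚ) < 2 ^ m := by linarith
          gcongr
        _ = 2 ^ (m + a + d) := by rw [pow_add, pow_add]
    exact_mod_cast h2
  have h3 : Nat.size q.num.natAbs ≤ m + a + d := Nat.size_le.2 hnum
  have h4 : Nat.size q.den ≤ d + 1 := Nat.size_le.2
    (by rw [pow_succ]; have := Nat.two_pow_pos d; lia)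
  unfold ratBits
  lia

/-- Limits on rational weights that are sums of differences of the given weights. -/
def ratLimits {ι : Type*} (n : ℕ) (E : Finset ι) (w : ι → ℚ) (hw : ∀ e ∈ E, 0 < w e) :
    Limits ratBits where
  cell := n + 1
  bd m q := (∃ z : ℤ, q * (∏ e ∈ E, (w e).den : ℕ) = z) ∧ |q| ≤ m * ∑ e ∈ E, w e
  lvl := 4 * (n * n) + 2 * n
  -- Taken from `ratBits_le` with `m = a * lvl`: the part proportional to `a` fits into `a * unit`,
  -- and the rest into one more `unit`.
  unit := 2 + (4 * (n * n) + 2 * n) + 2 * ∑ e ∈ E, ratBits (w e)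
  bd_zero := ⟨⟨0, by simp⟩, by simp⟩
  bd_mono h hq := ⟨hq.1, hq.2.trans (by
    have := Finset.sum_nonneg fun e he => (hw e he).le
    gcongr)⟩
  bd_add := by
    rintro a b v v' ⟨⟨z, hz⟩, h⟩ ⟨⟨z', hz'⟩, h'⟩
    refine ⟨⟨z + z', by rw [add_mul, hz, hz']; push_cast; rfl⟩, ?_⟩
    refine (abs_add_le _ _).trans ?_
    push_cast
    linarith
  bd_sub := by
    rintro a b v v' ⟨⟨z, hz⟩, h⟩ ⟨⟨z', hz'⟩, h'⟩
    refine ⟨⟨z - z', by rw [sub_mul, hz, hz']; push_cast; rfl⟩, ?_⟩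
    refine (abs_sub _ _).trans ?_
    push_cast
    linarith
  size_le := by
    rintro a v ⟨⟨z, hz⟩, h⟩
    have hS : ∑ e ∈ E, w e ≤ (2 : ℚ) ^ ∑ e ∈ E, Nat.size (w e).num.natAbs := by
      have h1 := sum_add_one_le_two_pow E fun e => (w e).num.natAbs
      have h2 : ∑ e ∈ E, w e ≤ ((∑ e ∈ E, (w e).num.natAbs : ℕ) : ℚ) := by
        push_cast
        refine Finset.sum_le_sum fun e he => ?_
        have h3 : (0 : ℚ) < (w e).num := by exact_mod_cast Rat.num_pos.2 (hw e he)
        have h4 : (1 : ℚ) ≤ (w e).den := by exact_mod_cast (w e).pos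
        rw [Nat.cast_natAbs, Int.cast_abs, abs_of_pos h3]
        conv_lhs => rw [← Rat.num_div_den (w e)]
        exact div_le_self h3.le h4
      refine h2.trans ?_
      exact_mod_cast (Nat.le_succ _).trans h1
    have h1 := ratBits_le hz (Finset.prod_pos fun e _ => (w e).pos) h hS
      (prod_le_two_pow E fun e => (w e).den)
    have h2 : ∑ e ∈ E, ratBits (w e) = E.card + ∑ e ∈ E, Nat.size (w e).num.natAbs +
        ∑ e ∈ E, Nat.size (w e).den := by
      simp only [ratBits, Finset.sum_add_distrib]
      simp
    rw [h2]
    refine h1.trans ?_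
    rw [add_mul, one_mul]
    have h3 : a * (4 * (n * n) + 2 * n) ≤ a * (2 + (4 * (n * n) + 2 * n) + 2 * (E.card +
        ∑ e ∈ E, Nat.size (w e).num.natAbs + ∑ e ∈ E, Nat.size (w e).den)) :=
      Nat.mul_le_mul_left _ (by lia)
    lia

theorem ratLimits_bd {ι : Type*} (n : ℕ) (E : Finset ι) (w : ι → ℚ) (hw : ∀ e ∈ E, 0 < w e) :
    ∀ e ∈ E, (ratLimits n E w hw).bd 1 (w e) := by
  classical
  intro e he
  refine ⟨⟨(w e).num * (∏ e ∈ E.erase e, (w e).den : ℕ), ?_⟩, ?_⟩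
  · rw [← Finset.mul_prod_erase E _ he]
    push_cast
    rw [← mul_assoc, Rat.mul_den_eq_num]
  · rw [abs_of_pos (hw e he), Nat.cast_one, one_mul]
    exact Finset.single_le_sum (f := w) (fun e he => (hw e he).le) he

-- The time bound is the product of three polynomials: the number of steps, the step bound at the
-- largest cell value `n + 1`, and one plus the size unit. Polynomials over `ℕ` are monotone, so `n`
-- may be replaced by the input length, and the same polynomial serves for unit costs.
open Polynomial in
theorem exists_polynomial_time : ∃ (P : Program) (p : Polynomial ℕ),
    (∀ (n : ℕ) (T : Tournament (Fin n)) (w : Fin n × Fin n → ℝ) (x : Fin n),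
      (∀ e ∈ T.edges, 0 < w e) → x ∉ T.copelandSet →
        ComputesMoV (fun _ => 0) P T w x (p.eval n)) ∧
    (∀ (n : ℕ) (T : Tournament (Fin n)) (w : Fin n × Fin n → ℚ) (x : Fin n),
      (∀ e ∈ T.edges, 0 < w e) → x ∉ T.copelandSet →
        ComputesMoV ratBits P T w x (p.eval (n + ∑ e ∈ T.edges, ratBits (w e)))) := by
  have mono : ∀ (p : ℕ[X]) {a b : ℕ}, a ≤ b → p.eval a ≤ p.eval b := by
    intro p a b hab
    rw [eval_eq_sum, eval_eq_sum]
    exact Finset.sum_le_sum fun i _ => Nat.mul_le_mul_left _ (Nat.pow_le_pow_left hab i)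
  obtain ⟨q, hq⟩ : ∃ q : ℕ[X], ∀ n, q.eval n = stepCount n := by
    refine ⟨X * (6 * X + 5) + 2 + (1 + (1 + (1 + ((X * (X * (9 * X * X + 19 * X + 12) + 2 +
      (X * (4 * X + 6) + 4 + (X * (3 * X + 4) + 4)) + 2) + 2) + 1)))), fun n => ?_⟩
    simp [stepCount]
  have weaken : ∀ {K : Type} [AddCommGroup K] [LinearOrder K] {sz : K → ℕ} {P : Program} {n : ℕ}
      {T : Tournament (Fin n)} {w : Fin n × Fin n → K} {x : Fin n} {B B' : ℕ}, B ≤ B' →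
      ComputesMoV sz P T w x B → ComputesMoV sz P T w x B' := by
    rintro K _ _ sz P n T w x B B' hB ⟨s, t, hr, ht, h⟩
    exact ⟨s, t, hr, ht.trans hB, h⟩
  refine ⟨copelandProgram, q * (copelandProgram.stepBound.comp (X + 1) *
    (1 + (2 + (4 * (X * X) + 2 * X) + 2 * X))), fun n T w x hw hx => ?_, fun n T w x hw hx => ?_⟩
  · refine weaken ?_ (computesMoV_copelandProgram (Λ := unitLimits n) hw hx le_rfl le_rfl
      fun _ _ => trivial)
    simp only [Limits.rate, unitLimits, eval_mul, eval_comp, eval_add, eval_X, eval_one, hq]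
    gcongr
    exact Nat.zero_le _
  · refine weaken ?_ (computesMoV_copelandProgram (Λ := ratLimits n T.edges w hw) hw hx le_rfl
      le_rfl (ratLimits_bd n T.edges w hw))
    set L := ∑ e ∈ T.edges, ratBits (w e) with hL
    have h1 : stepCount n ≤ q.eval (n + L) := by
      rw [← hq]
      exact mono q (Nat.le_add_right _ _)
    have h2 : copelandProgram.stepBound.eval (n + 1) ≤
        copelandProgram.stepBound.eval (n + L + 1) := mono _ (by lia)
    simp only [Limits.rate, ratLimits, eval_mul, eval_comp, eval_add, eval_X, eval_one,
      eval_ofNat, ← hL]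
    gcongr <;> lia

end Sizes

/-! ## The reduction to minimum-cost flows -/

section Flows

variable {V : Type*} [Fintype V] [DecidableEq V]

theorem Tournament.sum_outdegree (T : Tournament V) : ∑ v, T.outdegree v = T.edges.card := by
  simp only [outdegree, dominion, Finset.card_filter]
  rw [← Finset.sum_product' (f := fun v y : V => if (v, y) ∈ T.edges then 1 else 0),
    Finset.univ_product_univ, ← Finset.card_filter, Finset.filter_mem_eq_inter, Finset.univ_inter]

/-- The edges and their reversals partition the pairs of distinct vertices. -/
theorem Tournament.two_mul_card_edges (T : Tournament V) :
    2 * T.edges.card = Fintype.card V * (Fintype.card V - 1) := by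
  have h1 : T.edges ∪ T.edges.image Prod.swap = (Finset.univ : Finset V).offDiag := by
    ext ⟨x, y⟩
    simp only [Finset.mem_union, Finset.mem_image, Prod.exists, Prod.swap_prod_mk, Prod.mk.injEq,
      Finset.mem_offDiag, Finset.mem_univ, true_and]
    constructor
    · rintro (h | ⟨a, b, h, rfl, rfl⟩) rfl <;> exact T.no_loop _ h
    · intro h
      by_cases hxy : (x, y) ∈ T.edges
      · exact Or.inl hxy
      · exact Or.inr ⟨y, x, (T.one_edge y x (Ne.symm h)).2 hxy, rfl, rfl⟩
  have h2 : Disjoint T.edges (T.edges.image Prod.swap) := by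
    rw [Finset.disjoint_left]
    rintro ⟨x, y⟩ h h'
    simp only [Finset.mem_image, Prod.exists, Prod.swap_prod_mk, Prod.mk.injEq] at h'
    obtain ⟨a, b, h', rfl, rfl⟩ := h'
    have hne : b ≠ a := by
      rintro rfl
      exact T.no_loop _ h
    exact (T.one_edge b a hne).1 h h'
  have h3 := Finset.card_union_of_disjoint h2
  rw [h1, Finset.offDiag_card, Finset.card_image_of_injective _ Prod.swap_injective,
    Finset.card_univ] at h3
  rw [Nat.mul_sub, mul_one]
  lia

theorem Tournament.card_edges (T : Tournament V) :
    T.edges.card = Fintype.card V * (Fintype.card V - 1) / 2 := by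
  have := T.two_mul_card_edges
  lia

theorem Node.sum {T : Tournament V} {M : Type*} [AddCommMonoid M] (h : Node T → M) :
    ∑ a, h a = h source + h sink + (∑ e, h (edge e) + ∑ v, h (vertex v)) := by
  rw [← (Node.equiv T).symm.sum_comp, Fintype.sum_sum_type, Fintype.sum_sum_type,
    Fintype.sum_sum_type]
  simp [Node.equiv]

/-- The vertex that an edge leaves after the edges in `R` have been reversed. -/
def edgeOwner (R : Finset (V × V)) (e : V × V) : V := if e ∈ R then e.2 else e.1

/-- The edges that `v` owns correspond to the vertices that it dominates after the reversal: an edge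
is sent to its other endpoint. -/
theorem sum_edgeOwner (T : Tournament V) {R : Finset (V × V)} (hR : R ⊆ T.edges) (v : V) :
    ∑ e : {e : V × V // e ∈ T.edges}, (if v = edgeOwner R e.1 then 1 else 0 : ℝ) =
      (T.reverse R hR).outdegree v := by
  rw [Finset.sum_coe_sort T.edges fun e => (if v = edgeOwner R e then 1 else 0 : ℝ),
    Finset.sum_boole]
  congr 1
  refine Finset.card_bij' (fun e _ => if e ∈ R then e.1 else e.2)
    (fun y _ => if (v, y) ∈ T.edges ∧ (v, y) ∉ R then (v, y) else (y, v)) ?_ ?_ ?_ ?_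
  · rintro ⟨a, b⟩ h
    simp only [Finset.mem_filter, Tournament.dominion, Finset.mem_univ, true_and] at h ⊢
    rw [edgeOwner] at h
    refine (T.mem_reverse_iff _ _).2 ?_
    split_ifs at h ⊢ with h1
    · obtain ⟨-, rfl⟩ := h
      exact Or.inr h1
    · obtain ⟨h2, rfl⟩ := h
      exact Or.inl ⟨h2, h1⟩
  · intro y h
    simp only [Tournament.dominion, Finset.mem_univ, true_and, Finset.mem_filter] at h ⊢
    rw [edgeOwner]
    rcases (T.mem_reverse_iff _ _).1 h with h1 | h1
    · rw [if_pos h1, if_neg h1.2]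
      exact ⟨h1.1, rfl⟩
    · by_cases h2 : (v, y) ∈ T.edges ∧ (v, y) ∉ R
      · rw [if_pos h2, if_neg h2.2]
        exact ⟨h2.1, rfl⟩
      · rw [if_neg h2, if_pos h1]
        exact ⟨hR h1, rfl⟩
  · rintro ⟨a, b⟩ h
    simp only [Finset.mem_filter] at h ⊢
    rw [edgeOwner] at h
    by_cases h1 : (a, b) ∈ R
    · simp only [h1, if_true] at h ⊢
      obtain ⟨h2, rfl⟩ := h
      rw [if_neg]
      rintro ⟨h3, -⟩
      have hne : a ≠ v := by
        rintro rfl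
        exact T.no_loop _ h2
      exact (T.one_edge a v hne).1 h2 h3
    · simp only [h1, if_false] at h ⊢
      obtain ⟨h2, rfl⟩ := h
      rw [if_pos ⟨h2, h1⟩]
  · intro y h
    simp only [Tournament.dominion, Finset.mem_univ, true_and, Finset.mem_filter] at h ⊢
    rcases (T.mem_reverse_iff _ _).1 h with h1 | h1
    · rw [if_pos h1, if_neg h1.2]
    · have h4 : ¬ ((v, y) ∈ T.edges ∧ (v, y) ∉ R) := by
        rintro ⟨h2, -⟩
        have h3 := hR h1
        have hne : y ≠ v := by
          rintro rfl
          exact T.no_loop _ h2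
        exact (T.one_edge y v hne).1 h3 h2
      rw [if_neg h4, if_pos h1]

variable {T : Tournament V} {w : V × V → ℝ} {x : V} {c : ℕ}

/-- Each edge node sends its unit to the owner and pays `w e` exactly if the owner is the head of
the edge, that is, if the edge is reversed. -/
theorem flowCost_eq_weight {R : Finset (V × V)} (hR : R ⊆ T.edges) {f : Node T × Node T → ℝ}
    (hf : ∀ (e : {e : V × V // e ∈ T.edges}) (v : V),
      f (.edge e, .vertex v) = if v = edgeOwner R e.1 then 1 else 0) :
    (copelandNetwork T w x c).flowCost f = weight w R := by
  have h1 : ∀ e : {e : V × V // e ∈ T.edges},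
      ∑ v, f (.edge e, .vertex v) * (if v = e.1.1 then 0 else w e.1) =
        if e.1 ∈ R then w e.1 else 0 := by
    intro e
    rw [Finset.sum_eq_single (edgeOwner R e.1)]
    · rw [hf, if_pos rfl, one_mul, edgeOwner]
      split_ifs with h2 h3 <;> try rfl
      · exact absurd e.2 (by
          have : e.1 = (e.1.1, e.1.1) := Prod.ext rfl h3
          rw [this]
          exact T.no_loop _)
      · simp_all
    · intro v _ hv
      rw [hf, if_neg hv, zero_mul]
    · simp
  rw [Network.flowCost, ← Finset.univ_product_univ, Finset.sum_product, Node.sum]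
  simp only [copelandNetwork, Node.sum, mul_zero, Finset.sum_const_zero, add_zero, zero_add, h1]
  rw [Finset.sum_coe_sort T.edges fun e => if e ∈ R then w e else 0, ← Finset.sum_filter,
    Finset.filter_mem_eq_inter, Finset.inter_eq_right.2 hR, weight]

/-- The source must send out as many units as it has arcs, each of capacity one, so every edge node
receives one unit. By integrality that unit goes to one endpoint, and the edge is reversed if this
is the head. The inflow of a vertex is then its new outdegree: all of it must leave to the sink
through capacity `c`, except at `x`, where it is absorbed and equals `c`. -/
theorem exists_reversal_of_isIntegralBFlow {f : Node T × Node T → ℝ}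
    (hf : (copelandNetwork T w x c).IsIntegralBFlow f) :
    ∃ (R : Finset (V × V)) (hR : R ⊆ T.edges), x ∈ (T.reverse R hR).copelandSet ∧
      (T.reverse R hR).outdegree x = c ∧
      weight w R = (copelandNetwork T w x c).flowCost f := by
  classical
  obtain ⟨⟨hoff, hnn, hcap, hbal⟩, hint⟩ := hf
  set R : Finset (V × V) := T.edges.filter fun e =>
    ∃ h : e ∈ T.edges, f (.edge ⟨e, h⟩, .vertex e.2) = 1 with hRdef
  have hR : R ⊆ T.edges := Finset.filter_subset _ _
  have hN := T.card_edges
  have hsource : ∀ e, f (.source, .edge e) = 1 := by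
    have h1 := hbal .source
    have h2 : ∀ u, f (u, .source) = 0 := fun u => hoff _ (by cases u <;> simp [copelandNetwork])
    have h3 : f (.source, .sink) = 0 := hoff _ (by simp [copelandNetwork])
    have h4 : ∀ v, f (.source, .vertex v) = 0 := fun v => hoff _ (by simp [copelandNetwork])
    have h5 : ∀ e, f (.source, .edge e) ≤ 1 := fun e => by
      simpa [copelandNetwork] using hcap (.source, .edge e) (by simp [copelandNetwork])
    simp only [h2, Finset.sum_const_zero, Node.sum, h3, h4, zero_add, add_zero, zero_sub] at h1
    simp only [copelandNetwork, ← hN] at h1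
    have h6 : ∑ e : {e : V × V // e ∈ T.edges}, (1 - f (.source, .edge e)) = 0 := by
      rw [Finset.sum_sub_distrib]
      push_cast at h1
      simp only [Finset.sum_const, Finset.card_univ, Fintype.card_coe, nsmul_eq_mul, mul_one]
      linarith
    intro e
    have := (Finset.sum_eq_zero_iff_of_nonneg fun e _ => sub_nonneg.2 (h5 e)).1 h6 e
      (Finset.mem_univ _)
    linarith
  have hedge0 : ∀ (e : {e : V × V // e ∈ T.edges}) (v : V), v ≠ e.1.1 → v ≠ e.1.2 →
      f (.edge e, .vertex v) = 0 := fun e v h1 h2 => hoff _ (by simp [copelandNetwork, h1, h2])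
  have hne : ∀ e : {e : V × V // e ∈ T.edges}, e.1.1 ≠ e.1.2 := fun e h => by
    have h1 : e.1 = (e.1.1, e.1.1) := Prod.ext rfl h.symm
    exact T.no_loop _ (h1 ▸ e.2)
  have hedge : ∀ e : {e : V × V // e ∈ T.edges},
      f (.edge e, .vertex e.1.1) + f (.edge e, .vertex e.1.2) = 1 := by
    intro e
    have h1 := hbal (.edge e)
    have h2 : ∀ e', f (.edge e', .edge e) = 0 := fun e' => hoff _ (by simp [copelandNetwork])
    have h3 : ∀ e', f (.edge e, .edge e') = 0 := fun e' => hoff _ (by simp [copelandNetwork])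
    have h4 : ∀ v, f (.vertex v, .edge e) = 0 := fun v => hoff _ (by simp [copelandNetwork])
    have h5 : f (.sink, .edge e) = 0 := hoff _ (by simp [copelandNetwork])
    have h6 : f (.edge e, .source) = 0 := hoff _ (by simp [copelandNetwork])
    have h7 : f (.edge e, .sink) = 0 := hoff _ (by simp [copelandNetwork])
    have h8 : ∑ v, f (.edge e, .vertex v) =
        f (.edge e, .vertex e.1.1) + f (.edge e, .vertex e.1.2) :=
      Fintype.sum_eq_add _ _ (hne e) fun v hv => hedge0 e v hv.1 hv.2
    simp only [Node.sum, h2, h3, h4, h5, h6, h7, h8, hsource, Finset.sum_const_zero] at h1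
    simp only [copelandNetwork] at h1
    push_cast at h1
    linarith
  have hR' : ∀ e : {e : V × V // e ∈ T.edges}, e.1 ∈ R ↔ f (.edge e, .vertex e.1.2) = 1 := by
    intro e
    simp only [hRdef, Finset.mem_filter]
    exact ⟨fun ⟨_, _, h⟩ => h, fun h => ⟨e.2, e.2, h⟩⟩
  have hown : ∀ (e : {e : V × V // e ∈ T.edges}) (v : V),
      f (.edge e, .vertex v) = if v = edgeOwner R e.1 then 1 else 0 := by
    intro e v
    have h1 := hedge e
    have h2 : f (.edge e, .vertex e.1.2) = 0 ∨ f (.edge e, .vertex e.1.2) = 1 := by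
      obtain ⟨z, hz⟩ := hint (.edge e, .vertex e.1.2)
      have h3 := hnn (.edge e, .vertex e.1.2)
      have h4 := hnn (.edge e, .vertex e.1.1)
      have h5 : f (.edge e, .vertex e.1.2) ≤ 1 := by linarith
      rw [hz] at h3 h5 ⊢
      have h6 : 0 ≤ z := by exact_mod_cast h3
      have h7 : z ≤ 1 := by exact_mod_cast h5
      have h8 : z = 0 ∨ z = 1 := by lia
      exact_mod_cast h8
    by_cases hv1 : v = e.1.1
    · subst hv1
      rcases h2 with h2 | h2
      · have : e.1 ∉ R := fun h => by rw [hR', h2] at h; simp at h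
        rw [edgeOwner, if_neg this, if_pos rfl]
        linarith
      · rw [edgeOwner, if_pos ((hR' e).2 h2), if_neg (hne e)]
        linarith
    · by_cases hv2 : v = e.1.2
      · subst hv2
        rcases h2 with h2 | h2
        · have : e.1 ∉ R := fun h => by rw [hR', h2] at h; simp at h
          rw [edgeOwner, if_neg this, if_neg hv1, h2]
        · rw [edgeOwner, if_pos ((hR' e).2 h2), if_pos rfl, h2]
      · rw [hedge0 e v hv1 hv2, edgeOwner]
        split_ifs <;> rfl
  have hvert : ∀ v, ((T.reverse R hR).outdegree v : ℝ) - f (.vertex v, .sink) =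
      if v = x then (c : ℝ) else 0 := by
    intro v
    have h1 := hbal (.vertex v)
    have h2 : ∀ v', f (.vertex v', .vertex v) = 0 := fun e' => hoff _ (by simp [copelandNetwork])
    have h3 : ∀ v', f (.vertex v, .vertex v') = 0 := fun e' => hoff _ (by simp [copelandNetwork])
    have h4 : ∀ e, f (.vertex v, .edge e) = 0 := fun v => hoff _ (by simp [copelandNetwork])
    have h5 : f (.sink, .vertex v) = 0 := hoff _ (by simp [copelandNetwork])
    have h6 : f (.vertex v, .source) = 0 := hoff _ (by simp [copelandNetwork])
    have h7 : f (.source, .vertex v) = 0 := hoff _ (by simp [copelandNetwork])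
    have h8 : ∑ e, f (.edge e, .vertex v) = (T.reverse R hR).outdegree v := by
      rw [← sum_edgeOwner T hR v]
      exact Finset.sum_congr rfl fun e _ => hown e v
    simp only [Node.sum, h2, h3, h4, h5, h6, h7, h8, Finset.sum_const_zero] at h1
    simp only [copelandNetwork] at h1
    push_cast at h1
    linarith
  have hxc : (T.reverse R hR).outdegree x = c := by
    have h1 := hvert x
    have h2 : f (.vertex x, .sink) = 0 := hoff _ (by simp [copelandNetwork])
    rw [if_pos rfl, h2, sub_zero] at h1
    exact_mod_cast h1
  refine ⟨R, hR, fun y => ?_, hxc, (flowCost_eq_weight hR hown).symm⟩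
  rw [hxc]
  by_cases hy : y = x
  · rw [hy, hxc]
  · have h1 := hvert y
    have h2 := hcap (.vertex y, .sink) (by simp [copelandNetwork, hy])
    rw [if_neg hy] at h1
    simp only [copelandNetwork] at h2
    have h3 : ((T.reverse R hR).outdegree y : ℝ) ≤ c := by linarith
    exact_mod_cast h3

/-- The flow that belongs to a reversal set. -/
def reversalFlow (T : Tournament V) (x : V) (R : Finset (V × V)) (hR : R ⊆ T.edges) :
    Node T × Node T → ℝ
  | (.source, .edge _) => 1
  | (.edge e, .vertex v) => if v = edgeOwner R e.1 then 1 else 0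
  | (.vertex v, .sink) => if v = x then 0 else (T.reverse R hR).outdegree v
  | _ => 0

/-- That `x` wins is exactly what the capacities of the arcs into the sink require. -/
theorem isIntegralBFlow_reversalFlow {R : Finset (V × V)} (hR : R ⊆ T.edges)
    (hx : x ∈ (T.reverse R hR).copelandSet) :
    (copelandNetwork T w x ((T.reverse R hR).outdegree x)).IsIntegralBFlow
      (reversalFlow T x R hR) := by
  have hN := T.card_edges
  have hN' := (T.reverse R hR).sum_outdegree
  rw [(T.reverse R hR).card_edges, ← hN] at hN'
  refine ⟨⟨?_, ?_, ?_, ?_⟩, ?_⟩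
  · rintro ⟨(_ | e | v | _), (_ | e' | v' | _)⟩ h <;>
      simp only [copelandNetwork, reversalFlow, Set.mem_ofPred_eq, not_true, not_or] at h ⊢
    · rw [if_neg]
      rw [edgeOwner]
      split_ifs
      · exact h.2
      · exact h.1
    · rw [if_pos (not_not.1 h)]
  · rintro ⟨(_ | e | v | _), (_ | e' | v' | _)⟩ <;> simp only [reversalFlow, le_refl, zero_le_one]
    · split_ifs <;> simp
    · split_ifs <;> simp
  · rintro ⟨(_ | e | v | _), (_ | e' | v' | _)⟩ - <;>
      simp only [copelandNetwork, reversalFlow, Nat.cast_one, le_refl, zero_le_one]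
    · split_ifs <;> simp
    · split_ifs
      · exact Nat.cast_nonneg _
      · exact_mod_cast hx v
  · rintro (_ | e | v | _)
    · simp only [Node.sum, reversalFlow, copelandNetwork, ← hN]
      simp
    · simp only [Node.sum, reversalFlow, copelandNetwork]
      simp
    · simp only [Node.sum, reversalFlow, copelandNetwork, sum_edgeOwner T hR v]
      split_ifs with h
      · subst h
        simp
      · simp
    · simp only [Node.sum, reversalFlow, copelandNetwork, ← hN, ← hN']
      -- The sink receives the outdegrees of all vertices but `x`; all outdegrees together make up
      -- the number of edges.
      have h1 : ∑ v, (if v = x then (0 : ℝ) else (T.reverse R hR).outdegree v) =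
          ∑ v, ((T.reverse R hR).outdegree v : ℝ) - (T.reverse R hR).outdegree x := by
        rw [eq_sub_iff_add_eq, ← Finset.add_sum_erase _ _ (Finset.mem_univ x), if_pos rfl,
          ← Finset.add_sum_erase _ (fun v => ((T.reverse R hR).outdegree v : ℝ))
          (Finset.mem_univ x), zero_add, add_comm]
        congr 1
        exact Finset.sum_congr rfl fun v hv => if_neg (Finset.ne_of_mem_erase hv)
      rw [h1]
      simp
  · rintro ⟨(_ | e | v | _), (_ | e' | v' | _)⟩ <;> simp only [reversalFlow]
    all_goals first | exact ⟨0, Int.cast_zero.symm⟩ | exact ⟨1, Int.cast_one.symm⟩ | skip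
    · split_ifs
      · exact ⟨1, by simp⟩
      · exact ⟨0, by simp⟩
    · split_ifs
      · exact ⟨0, by simp⟩
      · exact ⟨(T.reverse R hR).outdegree v, by simp⟩

theorem flowCosts_eq (w : V × V → ℝ) (hx : x ∉ T.copelandSet) (c : ℕ) :
    {k : ℝ | ∃ f, (copelandNetwork T w x c).IsIntegralBFlow f ∧
        (copelandNetwork T w x c).flowCost f = k} =
      {k : ℝ | ∃ (R : Finset (V × V)) (hR : R ⊆ T.edges),
        IsCRS Tournament.copelandSet T x R ∧ (T.reverse R hR).outdegree x = c ∧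
        weight w R = k} := by
  ext k
  constructor
  · rintro ⟨f, hf, rfl⟩
    obtain ⟨R, hR, h1, h2, h3⟩ := exists_reversal_of_isIntegralBFlow hf
    exact ⟨R, hR, ⟨hx, hR, h1⟩, h2, h3⟩
  · rintro ⟨R, hR, ⟨-, _, h1⟩, rfl, rfl⟩
    exact ⟨_, isIntegralBFlow_reversalFlow hR h1, flowCost_eq_weight hR fun _ _ => rfl⟩

/-- The largest outdegree is at least the average outdegree, which is `(n - 1) / 2`. -/
theorem Tournament.outdegree_bounds (hx : x ∈ T.copelandSet) :
    T.outdegree x ∈ Finset.Icc ⌈((Fintype.card V : ℚ) - 1) / 2⌉₊ (Fintype.card V) := by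
  rw [Finset.mem_Icc, Nat.ceil_le]
  refine ⟨?_, Finset.card_le_univ _⟩
  have h1 : ∑ v, T.outdegree v ≤ Fintype.card V * T.outdegree x := by
    simpa using Finset.sum_le_card_nsmul Finset.univ _ _ fun v _ => hx v
  have h2 := T.two_mul_card_edges
  rw [T.sum_outdegree] at h1
  have h3 : 0 < Fintype.card V := Fintype.card_pos_iff.2 ⟨x⟩
  have h4 : Fintype.card V - 1 ≤ 2 * T.outdegree x := by
    refine Nat.le_of_mul_le_mul_left ?_ h3
    rw [← h2]
    lia
  have h5 : ((Fintype.card V - 1 : ℕ) : ℚ) ≤ ((2 * T.outdegree x : ℕ) : ℚ) := by exact_mod_cast h4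
  rw [Nat.cast_sub h3] at h5
  push_cast at h5
  linarith

/-- Every reversal set that makes `x` win has its outdegree in the given range, so the union of the
flow costs over this range already contains the weights of all of them. -/
theorem isMoV_iff_isLeast_flowCosts (w : V × V → ℝ) (hx : x ∉ T.copelandSet) (m : ℝ) :
    IsMoV Tournament.copelandSet T w x m ↔
      IsLeast {k : ℝ | ∃ c ∈ Finset.Icc ⌈((Fintype.card V : ℚ) - 1) / 2⌉₊ (Fintype.card V), ∃ f,
        (copelandNetwork T w x c).IsIntegralBFlow f ∧
        (copelandNetwork T w x c).flowCost f = k} (-m) := by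
  have h : {k : ℝ | ∃ c ∈ Finset.Icc ⌈((Fintype.card V : ℚ) - 1) / 2⌉₊ (Fintype.card V), ∃ f,
        (copelandNetwork T w x c).IsIntegralBFlow f ∧
        (copelandNetwork T w x c).flowCost f = k} =
      {k | ∃ R, IsCRS Tournament.copelandSet T x R ∧ weight w R = k} := by
    ext k
    constructor
    · rintro ⟨c, -, hf⟩
      obtain ⟨R, hR, h1, -, h2⟩ := (Set.ext_iff.1 (flowCosts_eq w hx c) k).1 hf
      exact ⟨R, h1, h2⟩
    · rintro ⟨R, h1, h2⟩
      obtain ⟨-, hR, h3⟩ := id h1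
      exact ⟨_, Tournament.outdegree_bounds h3,
        (Set.ext_iff.1 (flowCosts_eq w hx _) k).2 ⟨R, hR, h1, rfl, h2⟩⟩
  rw [h]
  exact ⟨fun hm => hm.2 hx, fun hm => ⟨fun h => absurd h hx, fun _ => hm⟩⟩

end Flows

end CopelandMoV

open CopelandMoV
theorem mainTheorem11 :
    -- computation in polynomial time, for real and for rational weights
    (∃ (P : Program) (p : Polynomial ℕ),
      (∀ (n : ℕ) (T : Tournament (Fin n)) (w : Fin n × Fin n → ℝ) (x : Fin n),
        (∀ e ∈ T.edges, 0 < w e) → x ∉ T.copelandSet →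
          ComputesMoV (fun _ => 0) P T w x (p.eval n)) ∧
      (∀ (n : ℕ) (T : Tournament (Fin n)) (w : Fin n × Fin n → ℚ) (x : Fin n),
        (∀ e ∈ T.edges, 0 < w e) → x ∉ T.copelandSet →
          ComputesMoV ratBits P T w x (p.eval (n + ∑ e ∈ T.edges, ratBits (w e))))) ∧
    -- reduction to integral minimum-cost flows, one for each target outdegree
    (∀ (n : ℕ) (T : Tournament (Fin n)) (w : Fin n × Fin n → ℝ) (x : Fin n),
      (∀ e ∈ T.edges, 0 < w e) → x ∉ T.copelandSet →
        (∀ c : ℕ,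
          {k : ℝ | ∃ f, (copelandNetwork T w x c).IsIntegralBFlow f ∧
              (copelandNetwork T w x c).flowCost f = k} =
            {k : ℝ | ∃ (R : Finset (Fin n × Fin n)) (hR : R ⊆ T.edges),
              IsCRS Tournament.copelandSet T x R ∧ (T.reverse R hR).outdegree x = c ∧
              weight w R = k}) ∧
        (∀ m : ℝ, IsMoV Tournament.copelandSet T w x m ↔
          IsLeast {k : ℝ | ∃ c ∈ Finset.Icc ⌈((n : ℚ) - 1) / 2⌉₊ n, ∃ f,
            (copelandNetwork T w x c).IsIntegralBFlow f ∧
            (copelandNetwork T w x c).flowCost f = k} (-m))) := by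
  refine ⟨exists_polynomial_time, fun n T w x _ hx => ⟨flowCosts_eq w hx, fun m => ?_⟩⟩
  have := isMoV_iff_isLeast_flowCosts w hx m
  rwa [Fintype.card_fin] at this
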